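/- Let $A$ be the free group on $a,b$, and write $x^y=y^{-1}xy$. Let $m\ge 8$ and $s\ge 10$ be integers and let $k_{ij}^{(t)}$ ($1\le i\le m$, $1\le j\le s$, $t\in\{1,2\}$) be nonzero integers such that: (A) each of the two sets $$\{|k_{ij}^{(1)}| : 1\le i\le m,\ 1\le j\le s\}\cup\{|k_{i1}^{(1)}-k_{i'1}^{(1)}| : 1\le i<i'\le m\},$$ $$\{|k_{ij}^{(2)}| : 1\le i\le m,\ 1\le j\le s\}\cup\{|k_{is}^{(2)}-k_{i's}^{(2)}| : 1\le i<i'\le m\}$$ has cardinality $sm+\binom m2$; (B) for all $i\in\{1,\dots,8\}$ and $t\in\{1,2\}$, the integers $k_{i1}^{(t)},k_{i2}^{(t)},\dots,k_{is}^{(t)}$ have the same sign, denoted $\epsilon_{it}\in\{1,-1\}$; (C) $\epsilon_{i1}=\epsilon_{i2}=1$ for $i\in\{1,2,3,4\}$, and $\epsilon_{i1}=1$, $\epsilon_{i2}=-1$ for $i\in\{5,6,7,8\}$. Let $C$ be the subgroup of $A$ generated by the elements $$\alpha_i=a^{k_{i1}^{(1)}}b^{k_{i1}^{(2)}}a^{k_{i2}^{(1)}}b^{k_{i2}^{(2)}}\cdots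 a^{k_{is}^{(1)}}b^{k_{is}^{(2)}},\qquad 1\le i\le m.$$ Then $C$ is multi-malnormal in $A$; that is, for every subsemigroup $C'$ of $C$ that is invariant under conjugation by elements of $C$ and satisfies $1\notin C'$, and for all $n\ge 1$, all $c_1,\dots,c_n\in C'$ and all $a_1,\dots,a_n\in A\setminus C$, $$c_1^{a_1}c_2^{a_2}\cdots c_n^{a_n}\in A\setminus C.$$ -/

import Mathlib

/-- A subsemigroup `P` of a group `G` is normal if it is closed under conjugation by all
elements of `G`. -/
def IsNormalSubsemigroup {G : Type*} [Group G] (P : Subsemigroup G) : Prop :=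
  ∀ x ∈ P, ∀ g : G, g⁻¹ * x * g ∈ P

/-- A subgroup `C` of `A` is multi-malnormal if for every normal subsemigroup `P` of `C` not
containing `1`, every nonempty product of conjugates `(a i)⁻¹ * c i * a i`, with all `c i ∈ P` and
all `a i ∈ A` outside `C`, lies outside `C`. -/
def IsMultiMalnormal {A : Type*} [Group A] (C : Subgroup A) : Prop :=
  ∀ P : Subsemigroup C, IsNormalSubsemigroup P → (1 : C) ∉ P →
    ∀ n : ℕ, 1 ≤ n → ∀ (c : Fin n → C) (a : Fin n → A),
      (∀ i, c i ∈ P) → (∀ i, a i ∉ C) →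
        (List.ofFn fun i => (a i)⁻¹ * (c i : A) * a i).prod ∉ C

/-- The conditions on the numbers `m`, `s` and the exponents. Here `k 0 i j` is the exponent of the
first free generator and `k 1 i j` that of the second one, in the `j`-th pair of syllables of the
`i`-th word; indices start from `0`. -/
structure AdmissibleExponents (m s : ℕ) (k : Fin 2 → Fin m → Fin s → ℤ) : Prop where
  eight_le : 8 ≤ m
  ten_le : 10 ≤ s
  ne_zero : ∀ t i j, k t i j ≠ 0
  /-- the exponents of the first generator, and the differences of the initial ones -/
  card_first :
    ({x : ℤ | ∃ i j, x = |k 0 i j|} ∪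
      {x : ℤ | ∃ (i i' : Fin m) (j : Fin s), i < i' ∧ (j : ℕ) = 0 ∧
        x = |k 0 i j - k 0 i' j|}).ncard = s * m + m.choose 2
  /-- the exponents of the second generator, and the differences of the final ones -/
  card_second :
    ({x : ℤ | ∃ i j, x = |k 1 i j|} ∪
      {x : ℤ | ∃ (i i' : Fin m) (j : Fin s), i < i' ∧ (j : ℕ) + 1 = s ∧
        x = |k 1 i j - k 1 i' j|}).ncard = s * m + m.choose 2
  /-- in each of the first eight words each generator has exponents of one sign -/
  sign_eq : ∀ (t : Fin 2) (i : Fin m), (i : ℕ) < 8 → ∀ j j' : Fin s,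
    (k t i j).sign = (k t i j').sign
  sign_low : ∀ i : Fin m, (i : ℕ) < 4 → ∀ j : Fin s, (j : ℕ) = 0 →
    (k 0 i j).sign = 1 ∧ (k 1 i j).sign = 1
  sign_high : ∀ i : Fin m, 4 ≤ (i : ℕ) → (i : ℕ) < 8 → ∀ j : Fin s, (j : ℕ) = 0 →
    (k 0 i j).sign = 1 ∧ (k 1 i j).sign = -1

/-- The word `a ^ k 0 i 0 * b ^ k 1 i 0 * ⋯ * a ^ k 0 i (s-1) * b ^ k 1 i (s-1)` in the free group
on `a = FreeGroup.of 0` and `b = FreeGroup.of 1`. -/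
def alphaWord {m s : ℕ} (k : Fin 2 → Fin m → Fin s → ℤ) (i : Fin m) : FreeGroup (Fin 2) :=
  (List.ofFn fun j : Fin s =>
    FreeGroup.of (0 : Fin 2) ^ k 0 i j * FreeGroup.of (1 : Fin 2) ^ k 1 i j).prod

/-- The subgroup of the free group of rank two generated by the words `alphaWord k i`. -/
def subgroupC {m s : ℕ} (k : Fin 2 → Fin m → Fin s → ℤ) : Subgroup (FreeGroup (Fin 2)) :=
  Subgroup.closure (Set.range (alphaWord k))

set_option linter.unusedSectionVars false

open scoped Pointwise

/-! Let `A` act on the Bass–Serre tree of the free product of the cyclic groups of `a` and `b`,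
subdivided so that every group element has a central vertex joined to the vertices of its two
cosets. The subgroup `C` spans a subtree, `hull`, and the translates of that subtree are indexed by
the cosets of `C`. The argument has two halves: these translates form a small cancellation family,
and every subgroup with such a family of translates is multi-malnormal.

Small cancellation (`AdmissibleExponents.smallCancellation`) means that distinct translates overlap
in diameter at most 2, while a nontrivial element stabilizing a translate moves every point far. For
the overlap, a longer common segment would contain a turn from `g` to `g * t ^ n` spelled along both
translates. The vertices passed by the words sit on lines along which a generator acts by
translation, and condition (A) makes every gap `n ≠ 0` determine its starting state; hence the two
translates agree (`mem_of_turn`). For the displacement, every generator of `C` and every inverse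
spells a path of `4 * s` edges, and two different such paths share at most one edge. A cyclically
reduced product therefore loses at most two edges per letter, which gives displacement at least `4 *
s - 2 ≥ 38` (`FreeGroup.le_d_smul_of_ne_one`).

In the second half, a conjugate `c ^ x` of an element of `C` fixes the coset of `x⁻¹`, so it is a
rotation about that member of the family. By `RotationFamily.eq_of_prod_smul_eq`, a product of
rotations, taken from conjugation-invariant semigroups without `1`, can fix a member `v₀` only if
each factor rotates about `v₀`. For `v₀ = C` this says that a product lying in `C` has all its
conjugators in `C`.

That statement is proved by a windmill. A convex set `W` starts as the member `v₀` and is enlarged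
until it contains all members involved. In one enlargement the translates of `W` and of the members
attached to it form a tree of labels: large displacement against small overlaps is a ping-pong that
keeps different branches apart. The tree is handled through a direction relation `Dir` and a rank.
If the product fixes `v₀`, it preserves `W` and thus fixes the root label. By
`exists_hurwitz_forall_eq_base`, Hurwitz moves turn the factors into elements that all rotate about
that root, so the claim for `W` applies to them. The moves keep the product, and the property of
having all member labels equal to `v₀` passes back along them. Excluding `1` from the semigroups
ensures that successive rotations about one label never cancel. -/

/-- A tree-like distance: a pseudometric with natural values that is geodesic and bipartite and
satisfies the four-point condition. -/
class TreeMetric (X : Type*) where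
  d : X → X → ℕ
  d_self : ∀ x, d x x = 0
  d_comm : ∀ x y, d x y = d y x
  d_triangle : ∀ x y z, d x z ≤ d x y + d y z
  four_point : ∀ x y z w, d x y + d z w ≤ d x z + d y w ∨ d x y + d z w ≤ d x w + d y z
  exists_between : ∀ x y n, n ≤ d x y → ∃ z, d x z = n ∧ d z y + n = d x y
  even_perimeter : ∀ x y z, (d x y + d y z + d x z) % 2 = 0

/-! ### Convex sets, projections and neighbourhoods in a tree. -/

namespace TreeMetric

variable {X : Type*} [TreeMetric X]

/-- A set is convex if it contains every point between two of its points. -/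
def IsConvex (Y : Set X) : Prop :=
  ∀ p ∈ Y, ∀ q ∈ Y, ∀ z, d p z + d z q = d p q → z ∈ Y

/-- `u` is a nearest-point projection of `p` to `Y`. -/
def IsProj (Y : Set X) (p u : X) : Prop :=
  u ∈ Y ∧ ∀ y ∈ Y, d p y = d p u + d u y

/-- The neighbourhood of radius one. -/
def nbhd (W : Set X) : Set X := {p | ∃ w ∈ W, d p w ≤ 1}

theorem subset_nbhd (W : Set X) : W ⊆ nbhd W := fun p hp => ⟨p, hp, by simp [d_self]⟩

/-- The median lies on the side from `x` to `y`, at a distance from `x` equal to the Gromov product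
of `y` and `z`. Even perimeter makes that product an integer, and the four-point condition puts the
point on the other two sides. -/
theorem exists_median (x y z : X) : ∃ m, d x m + d m y = d x y ∧ d x m + d m z = d x z ∧
    d y m + d m z = d y z := by
  have h1 := d_triangle x y z
  have h2 := d_triangle y x z
  have h3 := d_triangle x z y
  have c1 := d_comm x y
  have c3 := d_comm y z
  have e := even_perimeter x y z
  obtain ⟨m, hm1, hm2⟩ := exists_between x y ((d x y + d x z - d y z) / 2) (by omega)
  have t1 := d_triangle x m z
  have t2 := d_triangle y m z
  have c4 := d_comm y m
  have c5 := d_comm m z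
  refine ⟨m, by omega, ?_, ?_⟩ <;> rcases four_point x y m z with h | h <;> omega

/-- Triangles are tripods, so each point of one side lies on another side. This is what splits
geodesics at a chosen point when convexity is proved. -/
theorem between_or_between {p q z : X} (h : d p z + d z q = d p q) (r : X) :
    d p z + d z r = d p r ∨ d r z + d z q = d r q := by
  have t1 := d_triangle p z r
  have t2 := d_triangle r z q
  have c1 := d_comm z r
  have c2 := d_comm q r
  have c3 := d_comm q z
  rcases four_point p q z r with h' | h' <;> omega

theorem exists_isProj {Y : Set X} (hY : IsConvex Y) (hne : Y.Nonempty) (p : X) :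
    ∃ u, IsProj Y p u := by
  have hex : ∃ n, ∃ u ∈ Y, d p u = n := ⟨_, hne.choose, hne.choose_spec, rfl⟩
  classical
  obtain ⟨u, hu, hn⟩ := Nat.find_spec hex
  refine ⟨u, hu, fun y hy => ?_⟩
  obtain ⟨m, h1, h2, h3⟩ := exists_median p u y
  have hm : m ∈ Y := hY u hu y hy m h3
  have := Nat.find_min' hex ⟨m, hm, rfl⟩
  have c := d_comm m u
  omega

theorem IsProj.d_eq {Y : Set X} {p q u v : X} (hp : IsProj Y p u) (hq : IsProj Y q v)
    (h : 1 ≤ d u v) : d p q = d p u + d u v + d v q := by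
  have h1 := hp.2 v hq.1
  have h2 := hq.2 u hp.1
  have c1 := d_comm u v
  have c2 := d_comm v q
  have t1 := d_triangle p u q
  have t2 := d_triangle u v q
  have c3 := d_comm p v
  have c4 := d_comm v u
  have c5 := d_comm q u
  rcases four_point p v q u with h' | h' <;> omega

theorem IsProj.unique {Y : Set X} {p u v : X} (h : IsProj Y p u) (h' : IsProj Y p v) :
    d u v = 0 := by
  have h1 := h.2 v h'.1
  have h2 := h'.2 u h.1
  have c := d_comm u v
  omega

theorem IsProj.mem_of_isConvex {Y W : Set X} {p u : X} (hp : IsProj Y p u) (hW : IsConvex W)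
    (hpW : p ∈ W) (hne : (Y ∩ W).Nonempty) : u ∈ W := by
  obtain ⟨i, hiY, hiW⟩ := hne
  exact hW p hpW i hiW u (hp.2 i hiY).symm

/-- When the projections differ, the geodesic from `p` to `q` runs through both of them. Distant
projections thus force two convex sets to overlap. -/
theorem IsProj.mem_of_far {Y Y' : Set X} {p q u v : X} (hp : IsProj Y p u) (hq : IsProj Y q v)
    (hY' : IsConvex Y') (hpY : p ∈ Y') (hqY : q ∈ Y') (h : 1 ≤ d u v) : u ∈ Y' ∧ v ∈ Y' := by
  have := hp.d_eq hq h
  have t1 := d_triangle u v q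
  have t2 := d_triangle p u v
  have t3 := d_triangle p u q
  have t4 := d_triangle p v q
  exact ⟨hY' p hpY q hqY u (by omega), hY' p hpY q hqY v (by omega)⟩

/-- If all of `Y'` projects to `Y` away from the projection `u` of `p`, then `p` and `u` have the
same projection to `Y'`. -/
theorem IsProj.trans {Y Y' : Set X} {p u s : X} (hY : IsConvex Y) (hp : IsProj Y p u)
    (hs : IsProj Y' u s) (hfar : ∀ y ∈ Y', ∀ v, IsProj Y y v → 1 ≤ d u v) : IsProj Y' p s := by
  have key : ∀ y ∈ Y', d p y = d p u + d u y := by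
    intro y hy
    obtain ⟨v, hv⟩ := exists_isProj hY ⟨u, hp.1⟩ y
    have h1 := hp.d_eq hv (hfar y hy v hv)
    have t := d_triangle u v y
    have t' := d_triangle p u y
    have h2 := hv.2 u hp.1
    have c1 := d_comm y u
    have c2 := d_comm y v
    have c3 := d_comm u v
    omega
  refine ⟨hs.1, fun y hy => ?_⟩
  rw [key y hy, key s hs.1, hs.2 y hy, add_assoc]

theorem between_of_near {p q p' z : X} (h : d p z + d z q = d p q) (hp : d p p' ≤ 1)
    (hz : 1 ≤ d p z) : d p' z + d z q = d p' q := by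
  rcases between_or_between h p' with h' | h'
  · have c := d_comm z p'
    have t := d_triangle p' z q
    have t' := d_triangle z p' q
    omega
  · exact h'

theorem between_comm {p q z : X} (h : d p z + d z q = d p q) : d q z + d z p = d q p := by
  rw [d_comm q z, d_comm z p, d_comm q p]; omega

theorem isConvex_nbhd {W : Set X} (hW : IsConvex W) : IsConvex (nbhd W) := by
  rintro p ⟨p', hp', hp⟩ q ⟨q', hq', hq⟩ z hz
  rcases Nat.lt_or_ge (d p z) 1 with h | h
  · refine ⟨p', hp', ?_⟩
    have c2 := d_comm z p
    have := d_triangle z p p'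
    omega
  rcases Nat.lt_or_ge (d z q) 1 with h' | h'
  · refine ⟨q', hq', ?_⟩
    have := d_triangle z q q'
    omega
  refine subset_nbhd W (hW p' hp' q' hq' z ?_)
  have h1 := between_comm (between_of_near hz hp h)
  exact between_comm (between_of_near h1 hq (by rwa [d_comm]))

/-- A point at distance at least one from both ends of a geodesic between points of `nbhd W` already
lies in `W`; only one step at each end is lost. -/
theorem d_le_of_nbhd {Y W : Set X} (hY : IsConvex Y) (hW : IsConvex W) {k : ℕ}
    (h : ∀ p ∈ Y ∩ W, ∀ q ∈ Y ∩ W, d p q ≤ k) :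
    ∀ p ∈ Y ∩ nbhd W, ∀ q ∈ Y ∩ nbhd W, d p q ≤ k + 2 := by
  rintro p ⟨hpY, p', hp', hp⟩ q ⟨hqY, q', hq', hq⟩
  by_contra! hlt
  obtain ⟨z, hz1, hz2⟩ := exists_between p q 1 (by omega)
  obtain ⟨y, hy1, hy2⟩ := exists_between z q (d z q - 1) (by omega)
  have key : ∀ z, d p z + d z q = d p q → 1 ≤ d p z → 1 ≤ d z q → z ∈ Y ∩ W := by
    intro z hz h1 h2
    refine ⟨hY p hpY q hqY z hz, hW p' hp' q' hq' z ?_⟩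
    have h1 := between_comm (between_of_near hz hp h1)
    exact between_comm (between_of_near h1 hq (by rwa [d_comm]))
  have t1 := d_triangle p z y
  have t2 := d_triangle p y q
  have := h z (key z (by omega) (by omega) (by omega)) y (key y (by omega) (by omega) (by omega))
  omega

/-- A set in which any two points are joined by a chain of steps of length at most one is convex. -/
theorem isConvex_of_chain {Y : Set X} (hY : ∀ p ∈ Y, ∀ q, d p q = 0 → q ∈ Y)
    (h : ∀ p ∈ Y, ∀ q ∈ Y, Relation.ReflTransGen (fun a b => b ∈ Y ∧ d a b ≤ 1) p q) :
    IsConvex Y := by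
  intro p hp q hq z hz
  have := h p hp q hq
  clear hq
  induction this with
  | refl =>
    rw [d_self] at hz
    exact hY p hp z (by omega)
  | @tail b c _ hbc ih =>
    rcases between_or_between hz b with h1 | h1
    · exact ih h1
    · rcases Nat.eq_zero_or_pos (d z c) with h0 | h0
      · exact hY c hbc.1 z (by rwa [d_comm])
      · by_cases hb : d b z = 0
        · have t := d_triangle p b z
          have t' := d_triangle p z b
          have c1 := d_comm z b
          exact ih (by omega)
        · have := hbc.2
          omega

variable {A : Type*} [Group A] [MulAction A X]


theorem IsConvex.smul (hd : ∀ (g : A) (x y : X), d (g • x) (g • y) = d x y) {Y : Set X}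
    (hY : IsConvex Y) (g : A) : IsConvex (g • Y) := by
  intro p hp q hq z hz
  rw [Set.mem_smul_set_iff_inv_smul_mem] at *
  refine hY _ hp _ hq _ ?_
  simpa only [hd] using hz

theorem IsProj.smul (hd : ∀ (g : A) (x y : X), d (g • x) (g • y) = d x y) {Y : Set X} {p u : X}
    (h : IsProj Y p u) (g : A) : IsProj (g • Y) (g • p) (g • u) := by
  refine ⟨Set.smul_mem_smul_set h.1, ?_⟩
  rintro _ ⟨y, hy, rfl⟩
  simpa only [hd] using h.2 y hy

theorem smul_nbhd (hd : ∀ (g : A) (x y : X), d (g • x) (g • y) = d x y) (W : Set X) (g : A) :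
    g • nbhd W = nbhd (g • W) := by
  ext p
  rw [Set.mem_smul_set_iff_inv_smul_mem]
  constructor
  · rintro ⟨w, hw, h⟩
    exact ⟨g • w, Set.smul_mem_smul_set hw, by rw [← hd g⁻¹]; simpa using h⟩
  · rintro ⟨_, ⟨w, hw, rfl⟩, h⟩
    exact ⟨w, hw, by rw [← hd g]; simpa using h⟩

end TreeMetric

open TreeMetric

/-! ### Hurwitz moves on products of labelled group elements. -/

/-- One Hurwitz move on a list of group elements, each of which carries a pair of labels: an entry
is moved past its neighbour and conjugated by it. -/
inductive HurwitzMove {A B V : Type*} [Group A] [MulAction A B] [MulAction A V] :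
    List (B × V × A) → List (B × V × A) → Prop
  | left (L₁ L₂ : List (B × V × A)) (b b' : B) (v v' : V) (g g' : A) :
      HurwitzMove (L₁ ++ (b, v, g) :: (b', v', g') :: L₂)
        (L₁ ++ (g • b', g • v', g * g' * g⁻¹) :: (b, v, g) :: L₂)
  | right (L₁ L₂ : List (B × V × A)) (b b' : B) (v v' : V) (g g' : A) :
      HurwitzMove (L₁ ++ (b, v, g) :: (b', v', g') :: L₂)
        (L₁ ++ (b', v', g') :: (g'⁻¹ • b, g'⁻¹ • v, g'⁻¹ * g * g') :: L₂)

section Hurwitz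

variable {A B V : Type*} [Group A]

/-- The product of the group elements in a labelled list. -/
def labelledProd (L : List (B × V × A)) : A := (L.map fun e => e.2.2).prod

@[simp] theorem labelledProd_nil : labelledProd ([] : List (B × V × A)) = 1 := rfl

@[simp] theorem labelledProd_cons (e : B × V × A) (L : List (B × V × A)) :
    labelledProd (e :: L) = e.2.2 * labelledProd L := by simp [labelledProd]

@[simp] theorem labelledProd_append (L L' : List (B × V × A)) :
    labelledProd (L ++ L') = labelledProd L * labelledProd L' := by simp [labelledProd]

variable [MulAction A B] [MulAction A V]

theorem HurwitzMove.prod_eq {L L' : List (B × V × A)} (h : HurwitzMove L L') :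
    labelledProd L' = labelledProd L := by
  cases h <;> simp [mul_assoc]

theorem HurwitzMove.length_eq {L L' : List (B × V × A)} (h : HurwitzMove L L') :
    L'.length = L.length := by
  cases h <;> simp

/-- Being equivalent under Hurwitz moves. -/
abbrev Hurwitz (L L' : List (B × V × A)) : Prop := Relation.ReflTransGen HurwitzMove L L'

theorem Hurwitz.prod_eq {L L' : List (B × V × A)} (h : Hurwitz L L') :
    labelledProd L' = labelledProd L := by
  induction h with
  | refl => rfl
  | tail _ h ih => rw [h.prod_eq, ih]

theorem Hurwitz.length_eq {L L' : List (B × V × A)} (h : Hurwitz L L') :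
    L'.length = L.length := by
  induction h with
  | refl => rfl
  | tail _ h ih => rw [h.length_eq, ih]

theorem HurwitzMove.cons {L L' : List (B × V × A)} (h : HurwitzMove L L') (e : B × V × A) :
    HurwitzMove (e :: L) (e :: L') := by
  cases h with
  | left L₁ => exact HurwitzMove.left (e :: L₁) ..
  | right L₁ => exact HurwitzMove.right (e :: L₁) ..

theorem HurwitzMove.append_left {L L' : List (B × V × A)} (h : HurwitzMove L L')
    (K : List (B × V × A)) : HurwitzMove (K ++ L) (K ++ L') := by
  induction K with
  | nil => exact h
  | cons e K ih => exact ih.cons e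

theorem Hurwitz.append_left {L L' : List (B × V × A)} (h : Hurwitz L L')
    (K : List (B × V × A)) : Hurwitz (K ++ L) (K ++ L') :=
  Relation.ReflTransGen.lift (fun L => K ++ L) (fun _ _ h => HurwitzMove.append_left h K) _ _ h

/-- Moving an entry to the right past a block. -/
theorem hurwitz_block (b : B) (v : V) (g : A) (M L : List (B × V × A)) :
    Hurwitz ((b, v, g) :: (M ++ L))
      (M ++ ((labelledProd M)⁻¹ • b, (labelledProd M)⁻¹ • v,
        (labelledProd M)⁻¹ * g * labelledProd M) :: L) := by
  induction M generalizing b v g with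
  | nil => simpa using Relation.ReflTransGen.refl
  | cons e M ih =>
    obtain ⟨b', v', g'⟩ := e
    refine Relation.ReflTransGen.head (HurwitzMove.right [] (M ++ L) b b' v v' g g') ?_
    have := (ih (g'⁻¹ • b) (g'⁻¹ • v) (g'⁻¹ * g * g')).append_left [(b', v', g')]
    simpa [mul_smul, mul_assoc] using this

/-- A property of labelled elements that is invariant under conjugation by elements which have it
is preserved by Hurwitz moves. -/
theorem Hurwitz.forall_mem {p : B → V → A → Prop} {H : Subgroup A}
    (hH : ∀ b v g, p b v g → g ∈ H)
    (hp : ∀ b v g, p b v g → ∀ h ∈ H, p (h • b) (h • v) (h * g * h⁻¹))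
    {L L' : List (B × V × A)} (h : Hurwitz L L')
    (hL : ∀ e ∈ L, p e.1 e.2.1 e.2.2) : ∀ e ∈ L', p e.1 e.2.1 e.2.2 := by
  induction h with
  | refl => exact hL
  | tail _ h ih =>
    cases h with
    | left L₁ L₂ b b' v v' g g' =>
      simp only [List.mem_append, List.mem_cons] at ih ⊢
      have h1 := ih (b, v, g) (by simp)
      have h2 := ih (b', v', g') (by simp)
      rintro e (he | rfl | rfl | he)
      · exact ih e (by simp [he])
      · exact hp _ _ _ h2 g (hH _ _ _ h1)
      · exact h1
      · exact ih e (by simp [he])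
    | right L₁ L₂ b b' v v' g g' =>
      simp only [List.mem_append, List.mem_cons] at ih ⊢
      have h1 := ih (b, v, g) (by simp)
      have h2 := ih (b', v', g') (by simp)
      rintro e (he | rfl | rfl | he)
      · exact ih e (by simp [he])
      · exact h2
      · simpa using hp _ _ _ h1 g'⁻¹ (H.inv_mem (hH _ _ _ h2))
      · exact ih e (by simp [he])

/-- If each element fixes its second label, then Hurwitz moves preserve the property that all these
labels are equal to a given one. -/
theorem Hurwitz.forall_label_eq {L L' : List (B × V × A)} (h : Hurwitz L L') {v₀ : V}
    (hL' : ∀ e ∈ L', e.2.1 = v₀) (hfix : ∀ K, Hurwitz L K → ∀ e ∈ K, e.2.2 • e.2.1 = e.2.1) :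
    ∀ e ∈ L, e.2.1 = v₀ := by
  induction h with
  | refl => exact hL'
  | @tail K K' hK h ih =>
    refine ih ?_
    have hf := hfix K hK
    cases h with
    | left L₁ L₂ b b' v v' g g' =>
      simp only [List.mem_append, List.mem_cons] at hf hL' ⊢
      have h1 : v = v₀ := hL' (b, v, g) (by simp)
      have h2 : g • v' = v₀ := hL' (g • b', g • v', g * g' * g⁻¹) (by simp)
      have h3 : g • v = v := hf (b, v, g) (by simp)
      rintro e (he | rfl | rfl | he)
      · exact hL' e (by simp [he])
      · exact h1
      · show v' = v₀
        rw [← h1, ← smul_left_cancel_iff g, h3, h2, h1]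
      · exact hL' e (by simp [he])
    | right L₁ L₂ b b' v v' g g' =>
      simp only [List.mem_append, List.mem_cons] at hf hL' ⊢
      have h1 : v' = v₀ := hL' (b', v', g') (by simp)
      have h2 : g'⁻¹ • v = v₀ := hL' (g'⁻¹ • b, g'⁻¹ • v, g'⁻¹ * g * g') (by simp)
      have h3 : g' • v' = v' := hf (b', v', g') (by simp)
      rintro e (he | rfl | rfl | he)
      · exact hL' e (by simp [he])
      · show v = v₀
        rw [inv_smul_eq_iff] at h2
        rw [h2, ← h1, h3]
      · exact h1
      · exact hL' e (by simp [he])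

theorem labelledProd_mem {H : Subgroup A} {L : List (B × V × A)} (hL : ∀ e ∈ L, e.2.2 ∈ H) :
    labelledProd L ∈ H :=
  H.list_prod_mem (by simpa using fun a b c h => hL (b, c, a) h)

theorem labelledProd_smul_eq {L : List (B × V × A)} {b : B} (hL : ∀ e ∈ L, e.2.2 • b = b) :
    labelledProd L • b = b := by
  induction L with
  | nil => simp
  | cons e L ih =>
    rw [labelledProd_cons, mul_smul, ih fun e' he' => hL e' (by simp [he'])]
    exact hL e (by simp)

/-! ### Tight lists of rotations of an abstract tree. -/

/-- A set of points with a group action, for which `R b c c'` says that `c` and `c'` lie in the same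
direction from `b`, together with a rank that behaves as the distance from a base point `o`. -/
structure RankedPretree (H : Subgroup A) (T : Set B) (R : B → B → B → Prop) (o : B) (ρ : B → ℕ) :
    Prop where
  base_mem : o ∈ T
  smul_mem : ∀ h ∈ H, ∀ b ∈ T, h • b ∈ T
  refl : ∀ b ∈ T, ∀ c ∈ T, c ≠ b → R b c c
  symm : ∀ b c c', R b c c' → R b c' c
  trans : ∀ b ∈ T, ∀ c ∈ T, ∀ c' ∈ T, ∀ c'' ∈ T, c ≠ b → c' ≠ b → c'' ≠ b →
    R b c c' → R b c' c'' → R b c c''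
  smul : ∀ h ∈ H, ∀ b c c', R b c c' → R (h • b) (h • c) (h • c')
  between : ∀ b ∈ T, ∀ c ∈ T, ∀ c' ∈ T, c ≠ b → c' ≠ b → ¬ R b c c' → R c' c b
  rank_lt : ∀ b ∈ T, ∀ c ∈ T, c ≠ b → (b = o ∨ ¬ R b o c) → ρ b < ρ c
  rank_smul_le : ∀ b ∈ T, ∀ c ∈ T, c ≠ b → (b = o ∨ ¬ R b o c) → ∀ h ∈ H, h • b = b →
    ρ (h • c) ≤ ρ c
  rank_smul_lt : ∀ b ∈ T, ∀ c ∈ T, c ≠ b → b ≠ o → ¬ R b o c → ∀ h ∈ H, h • b = b →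
    R b o (h • c) → ρ (h • c) < ρ c

variable {H : Subgroup A} {T : Set B} {R : B → B → B → Prop} {o : B} {ρ : B → ℕ}

/-- The sum of the ranks of the first labels. -/
def rankSum (ρ : B → ℕ) (L : List (B × V × A)) : ℕ := (L.map fun e => ρ e.1).sum

/-- The sum of the ranks of the first labels, weighted by the position in the list. -/
def weightedRankSum (ρ : B → ℕ) : List (B × V × A) → ℕ
  | [] => 0
  | _ :: L => rankSum ρ L + weightedRankSum ρ L

/-- A list that cannot be improved by Hurwitz moves of the two kinds that matter. -/
structure IsTight (R : B → B → B → Prop) (o : B) (ρ : B → ℕ) (L : List (B × V × A)) : Prop where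
  adjacent : ∀ L₁ e e' L₂, L = L₁ ++ e :: e' :: L₂ → e'.1 ≠ e.1 → e.1 ≠ o ∧ R e.1 o e'.1
  block : ∀ L₁ e M L₂, L = L₁ ++ e :: (M ++ L₂) → ρ e.1 ≤ ρ ((labelledProd M)⁻¹ • e.1)

theorem IsTight.of_append {K L : List (B × V × A)} (h : IsTight R o ρ (K ++ L)) :
    IsTight R o ρ L where
  adjacent L₁ e e' L₂ hL := h.adjacent (K ++ L₁) e e' L₂ (by simp [hL])
  block L₁ e M L₂ hL := h.block (K ++ L₁) e M L₂ (by simp [hL])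

theorem rankSum_append (ρ : B → ℕ) (L L' : List (B × V × A)) :
    rankSum ρ (L ++ L') = rankSum ρ L + rankSum ρ L' := by simp [rankSum]

theorem rankSum_cons (ρ : B → ℕ) (e : B × V × A) (L : List (B × V × A)) :
    rankSum ρ (e :: L) = ρ e.1 + rankSum ρ L := by simp [rankSum]

theorem weightedRankSum_append_lt (K : List (B × V × A)) {L L' : List (B × V × A)}
    (h : weightedRankSum ρ L < weightedRankSum ρ L') (h' : rankSum ρ L = rankSum ρ L') :
    weightedRankSum ρ (K ++ L) < weightedRankSum ρ (K ++ L') := by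
  induction K with
  | nil => exact h
  | cons e K ih =>
    simp only [List.cons_append, weightedRankSum, rankSum_append]
    omega

/-- Minimize the rank sum, and then its weighted version, over the Hurwitz class. The condition `b =
o ∨ ¬ R b o b'` says that `b` lies between `o` and `b'`; then `b'` has the larger rank, and rotating
it about `b` does not raise that rank. Moving it to the left either lowers the rank sum or keeps it
and lowers the weighted sum. A failure of `block` lowers the rank sum directly. -/
theorem exists_hurwitz_isTight (hT : RankedPretree H T R o ρ) {p : B → V → A → Prop}
    (hH : ∀ b v g, p b v g → g ∈ H ∧ b ∈ T ∧ g • b = b)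
    (hp : ∀ b v g, p b v g → ∀ h ∈ H, p (h • b) (h • v) (h * g * h⁻¹))
    {L : List (B × V × A)} (hL : ∀ e ∈ L, p e.1 e.2.1 e.2.2) :
    ∃ L', Hurwitz L L' ∧ IsTight R o ρ L' := by
  have wf : WellFounded (InvImage (Prod.Lex (· < ·) (· < ·))
      (fun L : List (B × V × A) => (rankSum ρ L, weightedRankSum ρ L))) :=
    InvImage.wf _ (WellFounded.prod_lex wellFounded_lt wellFounded_lt)
  obtain ⟨L', hL', hmin⟩ := wf.has_min {L' | Hurwitz L L'} ⟨L, Relation.ReflTransGen.refl⟩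
  have hval : ∀ e ∈ L', p e.1 e.2.1 e.2.2 :=
    Hurwitz.forall_mem (H := H) (fun b v g h => (hH b v g h).1) hp hL' hL
  refine ⟨L', hL', ⟨?_, ?_⟩⟩
  · rintro L₁ ⟨b, v, g⟩ ⟨b', v', g'⟩ L₂ rfl hne
    by_contra hcon
    have h1 := hH _ _ _ (hval (b, v, g) (by simp))
    have h2 := hH _ _ _ (hval (b', v', g') (by simp))
    have hb : b = o ∨ ¬ R b o b' := by tauto
    have hlt := hT.rank_lt b h1.2.1 b' h2.2.1 hne hb
    have hle := hT.rank_smul_le b h1.2.1 b' h2.2.1 hne hb g h1.1 h1.2.2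
    refine hmin _ (hL'.tail (HurwitzMove.left L₁ L₂ b b' v v' g g')) ?_
    simp only [InvImage, Prod.lex_def, rankSum_append, rankSum_cons]
    rcases hle.lt_or_eq with hle | hle
    · left; omega
    · right
      refine ⟨by omega, weightedRankSum_append_lt _ ?_ ?_⟩
      · simp only [weightedRankSum, rankSum_cons]; omega
      · simp only [rankSum_cons]; omega
  · rintro L₁ ⟨b, v, g⟩ M L₂ rfl
    by_contra! hlt
    refine hmin _ (hL'.trans ((hurwitz_block b v g M L₂).append_left L₁)) ?_
    simp only [InvImage, Prod.lex_def, rankSum_append, rankSum_cons]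
    left
    dsimp only at hlt
    omega

theorem IsTight.forall_eq_base {L : List (B × V × A)} {e : B × V × A}
    (h : IsTight R o ρ (e :: L)) (he : e.1 = o) : ∀ e' ∈ e :: L, e'.1 = o := by
  induction L generalizing e with
  | nil => simpa using he
  | cons e' L ih =>
    have h' : e'.1 = o := by
      by_contra hne
      exact (h.adjacent [] e e' L rfl (by rwa [he])).1 he
    have := ih (h.of_append (K := [e])) h'
    intro e'' he''
    rcases List.mem_cons.1 he'' with rfl | he''
    · exact he
    · exact this e'' he''

/-- In a tight list the base point is moved into the direction determined by the first block. -/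
theorem IsTight.direction (hT : RankedPretree H T R o ρ) {p : B → V → A → Prop}
    (hH : ∀ b v g, p b v g → g ∈ H ∧ b ∈ T ∧ g • b = b)
    (hrot : ∀ b ∈ T, ∀ M : List (B × V × A), M ≠ [] →
      (∀ e ∈ M, p e.1 e.2.1 e.2.2 ∧ e.1 = b) → ∀ c ∈ T, c ≠ b → ¬ R b c (labelledProd M • c))
    (n : ℕ) (L : List (B × V × A)) (hn : L.length ≤ n) (hL : ∀ e ∈ L, p e.1 e.2.1 e.2.2)
    (ht : IsTight R o ρ L) (e : B × V × A) (he : L.head? = some e) (hb : e.1 ≠ o) :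
    ∃ M L', L = M ++ L' ∧ M ≠ [] ∧ (∀ e' ∈ M, e'.1 = e.1) ∧ labelledProd L • o ≠ e.1 ∧
      R e.1 (labelledProd L • o) (labelledProd M • o) := by
  classical
  induction n generalizing L e with
  | zero =>
    have : L = [] := List.length_eq_zero_iff.1 (by omega)
    simp [this] at he
  | succ n ih =>
    set b := e.1 with hbdef
    have hsplit : L = L.takeWhile (fun e' => e'.1 = b) ++ L.dropWhile (fun e' => e'.1 = b) :=
      (List.takeWhile_append_dropWhile).symm
    have hMall : ∀ e' ∈ L.takeWhile (fun e' => e'.1 = b), e'.1 = b := by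
      intro e' he'
      simpa using List.mem_takeWhile_imp he'
    have hMne : L.takeWhile (fun e' => e'.1 = b) ≠ [] := by
      cases L with
      | nil => simp at he
      | cons a L =>
        obtain rfl : a = e := by simpa using he
        rw [List.takeWhile_cons_of_pos (by simp [hbdef])]
        simp
    have hdrop : ∀ a, (L.dropWhile (fun e' => e'.1 = b)).head? = some a → a.1 ≠ b := by
      intro a ha
      have := List.head?_dropWhile_not (fun e' : B × V × A => decide (e'.1 = b)) L
      rw [ha] at this
      simpa using this
    generalize L.takeWhile (fun e' => e'.1 = b) = M at *
    generalize L.dropWhile (fun e' => e'.1 = b) = L' at *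
    subst hsplit
    have hfix : ∀ e' ∈ M, e'.2.2 • b = b := fun e' he' => by
      have := (hH _ _ _ (hL e' (by simp [he']))).2.2
      rwa [hMall e' he'] at this
    have hMb : labelledProd M • b = b := labelledProd_smul_eq hfix
    have hmem : ∀ e' ∈ M ++ L', e'.2.2 ∈ H := fun e' he' => (hH _ _ _ (hL e' he')).1
    have hMH : labelledProd M ∈ H :=
      labelledProd_mem fun e' he' => hmem e' (by simp [he'])
    have hL'H : labelledProd L' ∈ H :=
      labelledProd_mem fun e' he' => hmem e' (by simp [he'])
    have hbT : b ∈ T := by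
      obtain ⟨a, M', rfl⟩ := List.exists_cons_of_ne_nil hMne
      have := (hH _ _ _ (hL a (by simp))).2.1
      rwa [hMall a (by simp)] at this
    refine ⟨M, L', rfl, hMne, hMall, ?_⟩
    suffices key : labelledProd L' • o ≠ b ∧ R b (labelledProd L' • o) o by
      rw [labelledProd_append, mul_smul]
      refine ⟨fun h => key.1 ?_, ?_⟩
      · rw [← smul_left_cancel_iff (labelledProd M), h, hMb]
      · have := hT.smul _ hMH _ _ _ key.2
        rwa [hMb] at this
    rcases hL' : L' with _ | ⟨a, L''⟩
    · simpa using ⟨Ne.symm hb, hT.refl b hbT o hT.base_mem (Ne.symm hb)⟩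
    rw [← hL']
    have ha : a.1 ≠ b := hdrop a (by simp [hL'])
    have htL' : IsTight R o ρ L' := ht.of_append
    have haT : a.1 ∈ T := (hH _ _ _ (hL a (by simp [hL']))).2.1
    by_cases hao : a.1 = o
    · have hall := (hL' ▸ htL').forall_eq_base hao
      have hfixo : labelledProd L' • o = o := by
        refine labelledProd_smul_eq fun e' he' => ?_
        have h1 := hall e' (by rwa [← hL'])
        have h2 := (hH _ _ _ (hL e' (by simp [he']))).2.2
        rwa [h1] at h2
      rw [hfixo]
      exact ⟨Ne.symm hb, hT.refl b hbT o hT.base_mem (Ne.symm hb)⟩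
    have hlen : L'.length ≤ n := by
      have := List.length_pos_iff.2 hMne
      rw [List.length_append] at hn
      omega
    obtain ⟨M', L₃, hL₃, hM'ne, hM'all, hz, hR⟩ :=
      ih L' hlen (fun e' he' => hL e' (by simp [he'])) htL' a (by simp [hL']) hao
    have hM'val : ∀ e' ∈ M', p e'.1 e'.2.1 e'.2.2 ∧ e'.1 = a.1 := fun e' he' =>
      ⟨hL e' (by simp [hL₃, he']), hM'all e' he'⟩
    have hM'fix : labelledProd M' • a.1 = a.1 := labelledProd_smul_eq fun e' he' => by
      have := (hH _ _ _ (hM'val e' he').1).2.2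
      rwa [(hM'val e' he').2] at this
    have hM'H : labelledProd M' ∈ H :=
      labelledProd_mem fun e' he' => (hH _ _ _ (hM'val e' he').1).1
    have hzT : labelledProd L' • o ∈ T := hT.smul_mem _ hL'H _ hT.base_mem
    -- the last entry of the first block
    obtain ⟨M₀, w, hw⟩ : ∃ M₀ w, M = M₀ ++ [w] :=
      ⟨_, _, (List.dropLast_append_getLast hMne).symm⟩
    have hwb : w.1 = b := hMall w (by simp [hw])
    have hadj : R b o a.1 := by
      have := (ht.adjacent M₀ w a L'' (by simp [hw, hL']) (by rwa [hwb])).2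
      rwa [hwb] at this
    have hblock : ρ b ≤ ρ ((labelledProd M')⁻¹ • b) := by
      have := ht.block M₀ w M' L₃ (by simp [hw, hL₃])
      rwa [hwb] at this
    have hxfix : (labelledProd M')⁻¹ • a.1 = a.1 := by rw [inv_smul_eq_iff, hM'fix]
    have hxH := H.inv_mem hM'H
    -- Seen from the second block, the image of `o` does not lie towards `b`; so from `b` it lies
    -- towards `a.1`, which by tightness is the direction of `o`.
    have hcon : ¬ R a.1 (labelledProd L' • o) b := by
      intro hzb
      have hM'o : labelledProd M' • o ≠ a.1 := fun h => hao (by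
        rw [← smul_left_cancel_iff (labelledProd M'), hM'fix, h])
      have hM'oT := hT.smul_mem _ hM'H _ hT.base_mem
      have h1 : R a.1 b (labelledProd M' • o) :=
        hT.trans _ haT _ hbT _ hzT _ hM'oT (Ne.symm ha) hz hM'o (hT.symm _ _ _ hzb) hR
      by_cases h2 : R a.1 o b
      · exact hrot a.1 haT M' hM'ne hM'val o hT.base_mem (Ne.symm hao)
          (hT.trans _ haT _ hT.base_mem _ hbT _ hM'oT (Ne.symm hao) (Ne.symm ha) hM'o h2 h1)
      -- Moving the last entry of `M` past `M'` would turn `b` into the direction of `o` as seen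
      -- from `a.1` and lower its rank, contrary to `block`.
      · have h3 := hT.smul _ hxH _ _ _ h1
        rw [hxfix, inv_smul_smul] at h3
        have := hT.rank_smul_lt a.1 haT b hbT (Ne.symm ha) hao h2 _ hxH hxfix
          (hT.symm _ _ _ h3)
        omega
    have hzb : labelledProd L' • o ≠ b := by
      intro h
      rw [h] at hcon
      exact hcon (hT.refl _ haT _ hbT (Ne.symm ha))
    refine ⟨hzb, ?_⟩
    have h4 := hT.between _ haT _ hzT _ hbT hz (Ne.symm ha) hcon
    exact hT.trans _ hbT _ hzT _ haT _ hT.base_mem hzb ha (Ne.symm hb) h4 (hT.symm _ _ _ hadj)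

/-- If the product of a list of rotations of a tree fixes the base point, then the list is
equivalent under Hurwitz moves to a list of elements that all rotate about the base point. -/
theorem exists_hurwitz_forall_eq_base (hT : RankedPretree H T R o ρ) {p : B → V → A → Prop}
    (hH : ∀ b v g, p b v g → g ∈ H ∧ b ∈ T ∧ g • b = b)
    (hp : ∀ b v g, p b v g → ∀ h ∈ H, p (h • b) (h • v) (h * g * h⁻¹))
    (hrot : ∀ b ∈ T, ∀ M : List (B × V × A), M ≠ [] →
      (∀ e ∈ M, p e.1 e.2.1 e.2.2 ∧ e.1 = b) → ∀ c ∈ T, c ≠ b → ¬ R b c (labelledProd M • c))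
    {L : List (B × V × A)} (hL : ∀ e ∈ L, p e.1 e.2.1 e.2.2) (ho : labelledProd L • o = o) :
    ∃ L', Hurwitz L L' ∧ ∀ e ∈ L', e.1 = o := by
  obtain ⟨L', hL', ht⟩ := exists_hurwitz_isTight hT hH hp hL
  refine ⟨L', hL', ?_⟩
  have hval : ∀ e ∈ L', p e.1 e.2.1 e.2.2 :=
    Hurwitz.forall_mem (H := H) (fun b v g h => (hH b v g h).1) hp hL' hL
  rw [← hL'.prod_eq] at ho
  clear hL' hL
  rcases hL'' : L' with _ | ⟨a, K⟩
  · simp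
  by_cases hao : a.1 = o
  · exact (hL'' ▸ ht).forall_eq_base hao
  exfalso
  obtain ⟨M, L₃, hL₃, hMne, hMall, hz, hR⟩ := IsTight.direction hT hH hrot L'.length L' le_rfl hval
    ht a (by simp [hL'']) hao
  have haT : a.1 ∈ T := (hH _ _ _ (hval a (by simp [hL'']))).2.1
  -- If the product fixes `o`, the first block preserves the direction of `o` at `a.1`, which `hrot`
  -- forbids.
  rw [ho] at hR
  exact hrot a.1 haT M hMne (fun e he => ⟨hval e (by simp [hL₃, he]), hMall e he⟩) o hT.base_mem
    (Ne.symm hao) hR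

end Hurwitz

/-! ### Small cancellation families, mills and the labels around a mill. -/

/-- A family of convex subsets of a tree that is invariant under a group and has small overlaps
compared with the displacements of the stabilizers of its members. -/
structure SmallCancellation (A : Type*) {V X : Type*} [Group A] [MulAction A V] [MulAction A X]
    [TreeMetric X] (Y : V → Set X) : Prop where
  isometry : ∀ (g : A) (x y : X), d (g • x) (g • y) = d x y
  convex : ∀ v, IsConvex (Y v)
  nonempty : ∀ v, (Y v).Nonempty
  smul_set : ∀ (g : A) (v : V), Y (g • v) = g • Y v
  inter : ∀ v w, v ≠ w → ∀ p ∈ Y v ∩ Y w, ∀ q ∈ Y v ∩ Y w, d p q ≤ 2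
  disp : ∀ (v : V) (g : A), g • v = v → g ≠ 1 → ∀ p ∈ Y v, 21 ≤ d p (g • p)
  exists_stab : ∀ v : V, ∃ g : A, g • v = v ∧ g ≠ 1

section Windmill

variable {A V X : Type*} [Group A] [MulAction A V] [MulAction A X] [TreeMetric X]

/-- The subset attached to a label: the neighbourhood of a set or the member with a given index. -/
def piece (Y : V → Set X) : Set X ⊕ V → Set X
  | .inl U => nbhd U
  | .inr v => Y v

/-- Two pieces have nearby projections to the member with index `f`. -/
def Near (Y : V → Set X) (f : V) (c c' : Set X ⊕ V) : Prop :=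
  ∃ p ∈ piece Y c, ∃ q ∈ piece Y c', ∃ u u', IsProj (Y f) p u ∧ IsProj (Y f) q u' ∧ d u u' ≤ 10

/-- A member that is not contained in `U` but meets its neighbourhood. -/
def Attached (Y : V → Set X) (U : Set X) (e : V) : Prop :=
  ¬ Y e ⊆ U ∧ (Y e ∩ nbhd U).Nonempty

/-- The label `e` is equal to `c` or separates it from `U`. -/
def Beyond (Y : V → Set X) (U : Set X) (e : V) (c : Set X ⊕ V) : Prop :=
  c = .inr e ∨ ¬ Near Y e (.inl U) c

/-- Two labels lie in the same direction from a third one. -/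
def Dir (Y : V → Set X) : Set X ⊕ V → Set X ⊕ V → Set X ⊕ V → Prop
  | .inl U, c, c' => ∃ e, Attached Y U e ∧ Beyond Y U e c ∧ Beyond Y U e c'
  | .inr f, c, c' => Near Y f c c'

/-- The group generated by the stabilizers of the members that lie in `W` or are attached to it. -/
def growGroup (A : Type*) [Group A] [MulAction A V] (Y : V → Set X) (W : Set X) : Subgroup A :=
  Subgroup.closure {g | ∃ v, (Y v ⊆ W ∨ Attached Y W v) ∧ g • v = v}

/-- The labels that are reached from `W` through the attached member `e`. -/
inductive Branch (A : Type*) {V X : Type*} [Group A] [MulAction A V] [MulAction A X]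
    [TreeMetric X] (Y : V → Set X) (W : Set X) : V → Set X ⊕ V → Prop
  | self (e : V) : Attached Y W e → Branch A Y W e (.inr e)
  | base (e : V) (y : A) : Attached Y W e → y • e = e → y ≠ 1 → Branch A Y W e (.inl (y • W))
  | step (e e' : V) (y : A) (c : Set X ⊕ V) : Attached Y W e → y • e = e → y ≠ 1 → e' ≠ e →
      Branch A Y W e' c → Branch A Y W e (y • c)

/-- All labels reached from `W`. -/
def labelTree (A : Type*) {V X : Type*} [Group A] [MulAction A V] [MulAction A X]
    [TreeMetric X] (Y : V → Set X) (W : Set X) : Set (Set X ⊕ V) :=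
  {c | c = .inl W ∨ ∃ e, Branch A Y W e c}

/-- The union of all pieces reached from `W`. -/
def grown (A : Type*) {V X : Type*} [Group A] [MulAction A V] [MulAction A X]
    [TreeMetric X] (Y : V → Set X) (W : Set X) : Set X :=
  {p | ∃ c ∈ labelTree A Y W, p ∈ piece Y c}

/-- A convex set that meets every member not contained in it in a small set and is invariant under
the stabilizers of the members contained in it. -/
structure IsMill (A : Type*) {V X : Type*} [Group A] [MulAction A V] [MulAction A X]
    [TreeMetric X] (Y : V → Set X) (W : Set X) : Prop where
  convex : IsConvex W
  nonempty : W.Nonempty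
  bound : ∀ v, ¬ Y v ⊆ W → ∀ p ∈ Y v ∩ W, ∀ q ∈ Y v ∩ W, d p q ≤ 4
  stab : ∀ v, Y v ⊆ W → ∀ g : A, g • v = v → g • W = W

variable {Y : V → Set X} {W : Set X}

theorem piece_smul (hY : SmallCancellation A Y) (g : A) (c : Set X ⊕ V) :
    piece Y (g • c) = g • piece Y c := by
  rcases c with U | v
  · exact (smul_nbhd hY.isometry U g).symm
  · exact hY.smul_set g v

theorem smul_mem_piece (hY : SmallCancellation A Y) (g : A) {c : Set X ⊕ V} {p : X}
    (hp : p ∈ piece Y c) : g • p ∈ piece Y (g • c) := by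
  rw [piece_smul hY]; exact Set.smul_mem_smul_set hp

theorem SmallCancellation.isProj_smul (hY : SmallCancellation A Y) {f : V} {p u : X}
    (h : IsProj (Y f) p u) (g : A) : IsProj (Y (g • f)) (g • p) (g • u) := by
  rw [hY.smul_set]; exact h.smul hY.isometry g

theorem near_smul (hY : SmallCancellation A Y) (g : A) {f : V} {c c' : Set X ⊕ V}
    (h : Near Y f c c') : Near Y (g • f) (g • c) (g • c') := by
  obtain ⟨p, hp, q, hq, u, u', hu, hu', hd⟩ := h
  exact ⟨g • p, smul_mem_piece hY g hp, g • q, smul_mem_piece hY g hq, g • u, g • u',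
    hY.isProj_smul hu g, hY.isProj_smul hu' g, by rwa [hY.isometry]⟩

theorem near_smul_iff (hY : SmallCancellation A Y) (g : A) {f : V} {c c' : Set X ⊕ V} :
    Near Y (g • f) (g • c) (g • c') ↔ Near Y f c c' := by
  refine ⟨fun h => ?_, near_smul hY g⟩
  simpa using near_smul hY g⁻¹ h

theorem Near.symm {f : V} {c c' : Set X ⊕ V} (h : Near Y f c c') : Near Y f c' c := by
  obtain ⟨p, hp, q, hq, u, u', hu, hu', hd⟩ := h
  exact ⟨q, hq, p, hp, u', u, hu', hu, by rwa [d_comm]⟩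

theorem Attached.smul (hY : SmallCancellation A Y) (g : A) {U : Set X} {e : V}
    (h : Attached Y U e) : Attached Y (g • U) (g • e) := by
  refine ⟨?_, ?_⟩
  · rw [hY.smul_set, Set.smul_set_subset_smul_set_iff]; exact h.1
  · rw [hY.smul_set, ← smul_nbhd hY.isometry, ← Set.smul_set_inter]
    exact h.2.smul_set

theorem Beyond.smul (hY : SmallCancellation A Y) (g : A) {U : Set X} {e : V} {c : Set X ⊕ V}
    (h : Beyond Y U e c) : Beyond Y (g • U) (g • e) (g • c) := by
  rcases h with rfl | h
  · exact Or.inl rfl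
  · exact Or.inr fun h' => h ((near_smul_iff hY g).1 h')

theorem Dir.smul (hY : SmallCancellation A Y) (g : A) {b c c' : Set X ⊕ V} (h : Dir Y b c c') :
    Dir Y (g • b) (g • c) (g • c') := by
  rcases b with U | f
  · obtain ⟨e, he, h1, h2⟩ := h
    exact ⟨g • e, he.smul hY g, h1.smul hY g, h2.smul hY g⟩
  · exact near_smul hY g h

theorem Dir.symm {b c c' : Set X ⊕ V} (h : Dir Y b c c') : Dir Y b c' c := by
  rcases b with U | f
  · obtain ⟨e, he, h1, h2⟩ := h
    exact ⟨e, he, h2, h1⟩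
  · exact Near.symm h

/-- The part of an attached member that is close to `W`. -/
def cell (Y : V → Set X) (W : Set X) (e : V) : Set X :=
  {u | u ∈ Y e ∧ ∃ i ∈ Y e ∩ nbhd W, d u i ≤ 2}

/-- The bound is `4` for the overlap with a mill, `2` for passing to its neighbourhood, and `2` more
at each end. It explains the threshold `10` in `Near`. -/
theorem d_le_of_mem_cell (hY : SmallCancellation A Y) (hW : IsMill A Y W) {e : V}
    (he : Attached Y W e) {u u' : X} (hu : u ∈ cell Y W e) (hu' : u' ∈ cell Y W e) :
    d u u' ≤ 10 := by
  obtain ⟨_, i, hi, h⟩ := hu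
  obtain ⟨_, i', hi', h'⟩ := hu'
  have := d_le_of_nbhd (hY.convex e) hW.convex (hW.bound e he.1) i hi i' hi'
  have t1 := d_triangle u i u'
  have t2 := d_triangle i i' u'
  have c := d_comm i' u'
  omega

theorem mem_cell_of_mem_nbhd (hW : IsMill A Y W) {e : V} (he : Attached Y W e) {p u : X}
    (hp : p ∈ nbhd W) (hu : IsProj (Y e) p u) : u ∈ cell Y W e :=
  ⟨hu.1, u, ⟨hu.1, hu.mem_of_isConvex (isConvex_nbhd hW.convex) hp he.2⟩, by simp [d_self]⟩

/-- A point of `Y e'` near `W` projects into `nbhd W`. Any other projection from `Y e'` is either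
the same point or lies with it in the overlap of the two members, whose diameter is at most 2. -/
theorem mem_cell_of_attached (hY : SmallCancellation A Y) (hW : IsMill A Y W) {e e' : V}
    (he : Attached Y W e) (he' : Attached Y W e') (hne : e' ≠ e) {p u : X}
    (hp : p ∈ Y e') (hu : IsProj (Y e) p u) : u ∈ cell Y W e := by
  obtain ⟨i, hi, hiW⟩ := he'.2
  obtain ⟨w, hw⟩ := exists_isProj (hY.convex e) (hY.nonempty e) i
  refine ⟨hu.1, w, ⟨hw.1, hw.mem_of_isConvex (isConvex_nbhd hW.convex) hiW he.2⟩, ?_⟩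
  rcases Nat.lt_or_ge (d u w) 1 with h | h
  · omega
  · obtain ⟨h1, h2⟩ := hu.mem_of_far hw (hY.convex e') hp hi h
    exact hY.inter e' e hne u ⟨h1, hu.1⟩ w ⟨h2, hw.1⟩

/-- Translates of a small subset of a member by different elements of its stabilizer are far
apart. -/
theorem SmallCancellation.far (hY : SmallCancellation A Y) {f : V} {y y' : A} (hy : y • f = f)
    (hy' : y' • f = f) (hne : y ≠ y') {u u' : X} (hu' : u' ∈ Y f) (h : d u u' ≤ 10) :
    11 ≤ d (y • u) (y' • u') := by
  -- The displacement 21 minus the cell diameter 10 leaves 11, just beyond the threshold of `Near`.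
  have h1 := hY.disp f (y⁻¹ * y') (by rw [mul_smul, hy', inv_smul_eq_iff, hy])
    (by rwa [Ne, inv_mul_eq_one]) u' hu'
  have h2 := d_triangle u' u ((y⁻¹ * y') • u')
  have h3 : d u ((y⁻¹ * y') • u') = d (y • u) (y' • u') := by
    rw [← hY.isometry y]; simp [mul_smul]
  have c := d_comm u u'
  omega

/-- The ping-pong step: all of `Y e'` projects to the cell of `e`, far from the projection of `p`.
Hence `p` is seen from `Y e'` through a point of `Y e`, and points of `Y e` project to the cell of
`e'`. -/
theorem mem_cell_of_forall (hY : SmallCancellation A Y) (hW : IsMill A Y W) {e e' : V}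
    (he : Attached Y W e) (he' : Attached Y W e') (hne : e' ≠ e) {y : A} (hy : y • e = e)
    (hy1 : y ≠ 1) {p u : X} (hp : ∀ u, IsProj (Y e) p u → u ∈ y • cell Y W e)
    (hu : IsProj (Y e') p u) : u ∈ cell Y W e' := by
  obtain ⟨s, hs⟩ := exists_isProj (hY.convex e) (hY.nonempty e) p
  obtain ⟨w, hw⟩ := exists_isProj (hY.convex e') (hY.nonempty e') s
  have hsy := hp s hs
  have hpw : IsProj (Y e') p w := by
    refine hs.trans (hY.convex e) hw fun x hx v hv => ?_
    obtain ⟨t, ht, rfl⟩ := hsy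
    have hv' := mem_cell_of_attached hY hW he he' hne hx hv
    have := hY.far hy (one_smul A e) hy1 hv'.1 (d_le_of_mem_cell hY hW he ht hv')
    rw [one_smul] at this
    exact le_trans (by norm_num) this
  obtain ⟨_, i, hi, hd⟩ := mem_cell_of_attached hY hW he' he hne.symm hs.1 hw
  have := hu.unique hpw
  have t := d_triangle u w i
  exact ⟨hu.1, i, hi, by omega⟩

theorem Branch.attached {e : V} {c : Set X ⊕ V} (h : Branch A Y W e c) : Attached Y W e := by
  cases h <;> assumption

/-- Induction along the branch: seen from another attached member the whole branch hides in the
cell, and seen from `e` a label other than `e` hides in a nontrivial translate of the cell. Each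
half feeds the other at the next step. -/
theorem Branch.mem_cell (hY : SmallCancellation A Y) (hW : IsMill A Y W) {e : V}
    {c : Set X ⊕ V} (h : Branch A Y W e c) :
    (∀ e', Attached Y W e' → e' ≠ e → ∀ p ∈ piece Y c, ∀ u, IsProj (Y e') p u →
      u ∈ cell Y W e') ∧
    (c = .inr e ∨ ∃ y : A, y • e = e ∧ y ≠ 1 ∧ ∀ p ∈ piece Y c, ∀ u, IsProj (Y e) p u →
      u ∈ y • cell Y W e) := by
  have aux : ∀ {e : V} {c : Set X ⊕ V}, Attached Y W e →
      (∃ y : A, y • e = e ∧ y ≠ 1 ∧ ∀ p ∈ piece Y c, ∀ u, IsProj (Y e) p u →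
        u ∈ y • cell Y W e) →
      ∀ e', Attached Y W e' → e' ≠ e → ∀ p ∈ piece Y c, ∀ u, IsProj (Y e') p u →
        u ∈ cell Y W e' := by
    rintro e c he ⟨y, hy, hy1, H⟩ e' he' hne p hp u hu
    exact mem_cell_of_forall hY hW he he' hne hy hy1 (H p hp) hu
  have aux2 : ∀ {e : V} {y : A} {p u : X}, y • e = e → IsProj (Y e) p u →
      IsProj (Y e) (y⁻¹ • p) (y⁻¹ • u) := by
    intro e y p u hy hu
    have := hY.isProj_smul hu y⁻¹
    rwa [inv_smul_eq_iff.2 hy.symm] at this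
  induction h with
  | self e he => exact ⟨fun e' he' hne p hp u hu =>
      mem_cell_of_attached hY hW he' he hne.symm hp hu, Or.inl rfl⟩
  | base e y he hy hy1 =>
    have key : ∃ y' : A, y' • e = e ∧ y' ≠ 1 ∧ ∀ p ∈ piece Y (.inl (y • W)), ∀ u,
        IsProj (Y e) p u → u ∈ y' • cell Y W e := by
      refine ⟨y, hy, hy1, fun p hp u hu => ?_⟩
      rw [Set.mem_smul_set_iff_inv_smul_mem]
      refine mem_cell_of_mem_nbhd hW he ?_ (aux2 hy hu)
      rw [← Set.mem_smul_set_iff_inv_smul_mem, smul_nbhd hY.isometry]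
      exact hp
    exact ⟨aux he key, Or.inr key⟩
  | step e e' y c he hy hy1 hne _ ih =>
    have key : ∃ y' : A, y' • e = e ∧ y' ≠ 1 ∧ ∀ p ∈ piece Y (y • c), ∀ u,
        IsProj (Y e) p u → u ∈ y' • cell Y W e := by
      refine ⟨y, hy, hy1, fun p hp u hu => ?_⟩
      rw [Set.mem_smul_set_iff_inv_smul_mem]
      refine ih.1 e he hne.symm _ ?_ _ (aux2 hy hu)
      rwa [← Set.mem_smul_set_iff_inv_smul_mem, ← piece_smul hY]
    exact ⟨aux he key, Or.inr key⟩

theorem mem_growGroup_of_attached {e : V} (he : Attached Y W e) {y : A} (hy : y • e = e) :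
    y ∈ growGroup A Y W := Subgroup.subset_closure ⟨e, Or.inr he, hy⟩

theorem mem_growGroup_of_subset {v : V} (hv : Y v ⊆ W) {y : A} (hy : y • v = v) :
    y ∈ growGroup A Y W := Subgroup.subset_closure ⟨v, Or.inl hv, hy⟩

theorem base_mem_labelTree : (.inl W : Set X ⊕ V) ∈ labelTree A Y W := Or.inl rfl

theorem Attached.mem_labelTree {e : V} (he : Attached Y W e) :
    (.inr e : Set X ⊕ V) ∈ labelTree A Y W := Or.inr ⟨e, .self e he⟩

theorem Branch.smul (hY : SmallCancellation A Y) {x : A} (hx : x • W = W) {e : V}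
    {c : Set X ⊕ V} (h : Branch A Y W e c) : Branch A Y W (x • e) (x • c) := by
  have hatt : ∀ {e}, Attached Y W e → Attached Y W (x • e) := fun he => by
    have := he.smul hY x
    rwa [hx] at this
  induction h with
  | self e he => exact .self _ (hatt he)
  | base e y he hy hy1 =>
    have := Branch.base (x • e) (x * y * x⁻¹) (hatt he) (by simp [mul_smul, hy])
      (by simpa using hy1)
    have hxy : (x * y * x⁻¹) • W = x • y • W := by
      rw [mul_smul, mul_smul, inv_smul_eq_iff.2 hx.symm]
    rwa [hxy, ← Sum.smul_inl] at this
  | step e e' y c he hy hy1 hne _ ih =>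
    have := Branch.step (x • e) (x • e') (x * y * x⁻¹) (x • c) (hatt he) (by simp [mul_smul, hy])
      (by simpa using hy1) (by simpa using hne) ih
    simpa [mul_smul] using this

/-- It suffices to treat generators. One stabilizing a member inside `W` preserves `W` and permutes
the branches; one stabilizing an attached member prolongs a branch or merges with its leading
factor, possibly cancelling it. -/
theorem smul_mem_labelTree (hY : SmallCancellation A Y) (hW : IsMill A Y W) {h : A}
    (hh : h ∈ growGroup A Y W) : ∀ c ∈ labelTree A Y W, h • c ∈ labelTree A Y W := by
  have gen : ∀ x : A, (∃ v, (Y v ⊆ W ∨ Attached Y W v) ∧ x • v = v) →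
      ∀ c ∈ labelTree A Y W, x • c ∈ labelTree A Y W := by
    rintro x ⟨v, hv | hv, hx⟩ c hc
    · have hxW := hW.stab v hv x hx
      rcases hc with rfl | ⟨e, hc⟩
      · left; rw [Sum.smul_inl, hxW]
      · exact Or.inr ⟨_, hc.smul hY hxW⟩
    · by_cases hx1 : x = 1
      · rwa [hx1, one_smul]
      rcases hc with rfl | ⟨e, hc⟩
      · exact Or.inr ⟨v, .base v x hv hx hx1⟩
      by_cases hev : e = v
      · subst hev
        cases hc with
        | self _ he => right; refine ⟨e, ?_⟩; rw [Sum.smul_inr, hx]; exact .self e hv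
        | base _ y he hy hy1 =>
          rw [Sum.smul_inl, ← mul_smul]
          by_cases hxy : x * y = 1
          · left; rw [hxy, one_smul]
          · exact Or.inr ⟨e, .base e _ hv (by rw [mul_smul, hy, hx]) hxy⟩
        | step _ e' y c he hy hy1 hne hc =>
          rw [← mul_smul]
          by_cases hxy : x * y = 1
          · right; rw [hxy, one_smul]; exact ⟨e', hc⟩
          · exact Or.inr ⟨e, .step e e' _ c hv (by rw [mul_smul, hy, hx]) hxy hne hc⟩
      · exact Or.inr ⟨v, .step v e x c hv hx hx1 hev hc⟩
  suffices key : (∀ c ∈ labelTree A Y W, h • c ∈ labelTree A Y W) ∧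
      ∀ c ∈ labelTree A Y W, h⁻¹ • c ∈ labelTree A Y W from key.1
  unfold growGroup at hh
  induction hh using Subgroup.closure_induction with
  | mem x hx =>
    obtain ⟨v, hv, hxv⟩ := hx
    exact ⟨gen x ⟨v, hv, hxv⟩, gen x⁻¹ ⟨v, hv, inv_smul_eq_iff.2 hxv.symm⟩⟩
  | one => simp
  | mul x y _ _ hx hy =>
    refine ⟨fun c hc => ?_, fun c hc => ?_⟩
    · rw [mul_smul]; exact hx.1 _ (hy.1 c hc)
    · rw [mul_inv_rev, mul_smul]; exact hy.2 _ (hx.2 c hc)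
  | inv x _ hx => exact ⟨hx.2, by simpa using hx.1⟩

end Windmill

/-! ### The direction relation satisfies the axioms of a pretree. -/

section Windmill

variable {A V X : Type*} [Group A] [MulAction A V] [MulAction A X] [TreeMetric X]
variable {Y : V → Set X} {W : Set X}

theorem Branch.exists_smul_eq {e : V} {c : Set X ⊕ V} (h : Branch A Y W e c) :
    ∃ g ∈ growGroup A Y W, c = .inl (g • W) ∨ ∃ e', Attached Y W e' ∧ c = .inr (g • e') := by
  induction h with
  | self e he => exact ⟨1, one_mem _, Or.inr ⟨e, he, by rw [one_smul]⟩⟩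
  | base e y he hy => exact ⟨y, mem_growGroup_of_attached he hy, Or.inl rfl⟩
  | step e e' y c he hy _ _ _ ih =>
    obtain ⟨g, hg, hc⟩ := ih
    refine ⟨y * g, mul_mem (mem_growGroup_of_attached he hy) hg, ?_⟩
    rcases hc with rfl | ⟨e'', he'', rfl⟩
    · left; rw [Sum.smul_inl, mul_smul]
    · right; exact ⟨e'', he'', by rw [Sum.smul_inr, mul_smul]⟩

theorem exists_smul_eq_of_mem {c : Set X ⊕ V} (h : c ∈ labelTree A Y W) :
    ∃ g ∈ growGroup A Y W, c = .inl (g • W) ∨ ∃ e', Attached Y W e' ∧ c = .inr (g • e') := by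
  rcases h with rfl | ⟨e, h⟩
  · exact ⟨1, one_mem _, Or.inl (by rw [one_smul])⟩
  · exact h.exists_smul_eq

theorem exists_of_inl_mem {U : Set X} (h : (.inl U : Set X ⊕ V) ∈ labelTree A Y W) :
    ∃ g ∈ growGroup A Y W, U = g • W := by
  obtain ⟨g, hg, h | ⟨e, _, h⟩⟩ := exists_smul_eq_of_mem h
  · exact ⟨g, hg, Sum.inl.inj h⟩
  · simp at h

theorem exists_of_inr_mem {f : V} (h : (.inr f : Set X ⊕ V) ∈ labelTree A Y W) :
    ∃ g ∈ growGroup A Y W, ∃ e, Attached Y W e ∧ f = g • e := by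
  obtain ⟨g, hg, h | ⟨e, he, h⟩⟩ := exists_smul_eq_of_mem h
  · simp at h
  · exact ⟨g, hg, e, he, Sum.inr.inj h⟩

theorem smul_mem_labelTree_iff (hY : SmallCancellation A Y) (hW : IsMill A Y W) {h : A}
    (hh : h ∈ growGroup A Y W) {c : Set X ⊕ V} :
    h • c ∈ labelTree A Y W ↔ c ∈ labelTree A Y W := by
  refine ⟨fun hc => ?_, smul_mem_labelTree hY hW hh c⟩
  simpa using smul_mem_labelTree hY hW (inv_mem hh) _ hc

theorem piece_nonempty (hY : SmallCancellation A Y) (hW : IsMill A Y W) {c : Set X ⊕ V}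
    (hc : c ∈ labelTree A Y W) : (piece Y c).Nonempty := by
  obtain ⟨g, -, rfl | ⟨e, -, rfl⟩⟩ := exists_smul_eq_of_mem hc
  · exact (hW.nonempty.smul_set).mono (subset_nbhd _)
  · exact hY.nonempty _

theorem exists_cell_attached (hY : SmallCancellation A Y) (hW : IsMill A Y W) {e : V}
    (he : Attached Y W e) {c : Set X ⊕ V} (hc : c ∈ labelTree A Y W) (hce : c ≠ .inr e) :
    ∃ y : A, y • e = e ∧ ∀ p ∈ piece Y c, ∀ u, IsProj (Y e) p u → u ∈ y • cell Y W e := by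
  rcases hc with rfl | ⟨e₁, hc⟩
  · exact ⟨1, one_smul _ _, fun p hp u hu => by
      rw [one_smul]; exact mem_cell_of_mem_nbhd hW he hp hu⟩
  by_cases h : e = e₁
  · subst h
    obtain h | ⟨y, hy, -, H⟩ := (hc.mem_cell hY hW).2
    · exact absurd h hce
    · exact ⟨y, hy, H⟩
  · exact ⟨1, one_smul _ _, by rw [one_smul]; exact (hc.mem_cell hY hW).1 e he h⟩

/-- Each other label occupies, in its projection to `Y f`, a single translate of one small set. The
translating element is the discrete name of its direction at `f`; after translation by the group,
`f` becomes an attached member. -/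
theorem exists_cell (hY : SmallCancellation A Y) (hW : IsMill A Y W) {f : V}
    (hf : (.inr f : Set X ⊕ V) ∈ labelTree A Y W) :
    ∃ Q ⊆ Y f, (∀ u ∈ Q, ∀ u' ∈ Q, d u u' ≤ 10) ∧ ∀ c ∈ labelTree A Y W, c ≠ .inr f →
      ∃ y : A, y • f = f ∧ ∀ p ∈ piece Y c, ∀ u, IsProj (Y f) p u → u ∈ y • Q := by
  obtain ⟨g, hg, e, he, rfl⟩ := exists_of_inr_mem hf
  refine ⟨g • cell Y W e, ?_, ?_, fun c hc hce => ?_⟩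
  · rw [hY.smul_set, Set.smul_set_subset_smul_set_iff]
    exact fun u hu => hu.1
  · rintro _ ⟨u, hu, rfl⟩ _ ⟨u', hu', rfl⟩
    simp only [hY.isometry]
    exact d_le_of_mem_cell hY hW he hu hu'
  · obtain ⟨y, hy, H⟩ := exists_cell_attached hY hW he
      (smul_mem_labelTree hY hW (inv_mem hg) c hc)
      (by rw [Ne, inv_smul_eq_iff]; exact hce)
    refine ⟨g * y * g⁻¹, by simp [mul_smul, hy], fun p hp u hu => ?_⟩
    have h1 := hY.isProj_smul hu g⁻¹
    rw [inv_smul_smul] at h1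
    have h2 := H _ (smul_mem_piece hY g⁻¹ hp) _ h1
    rw [Set.mem_smul_set_iff_inv_smul_mem] at h2 ⊢
    rw [Set.mem_smul_set_iff_inv_smul_mem]
    simpa [mul_smul] using h2

/-- The projections of a label stay in one translate of the small set and different translates are
at least 11 apart, so any choice of points decides `Near`. -/
theorem near_iff (hY : SmallCancellation A Y) (hW : IsMill A Y W) {f : V}
    (hf : (.inr f : Set X ⊕ V) ∈ labelTree A Y W) {c c' : Set X ⊕ V}
    (hc : c ∈ labelTree A Y W) (hc' : c' ∈ labelTree A Y W) (hcf : c ≠ .inr f)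
    (hcf' : c' ≠ .inr f) {p q u u' : X} (hp : p ∈ piece Y c) (hq : q ∈ piece Y c')
    (hu : IsProj (Y f) p u) (hu' : IsProj (Y f) q u') : Near Y f c c' ↔ d u u' ≤ 10 := by
  refine ⟨?_, fun h => ⟨p, hp, q, hq, u, u', hu, hu', h⟩⟩
  rintro ⟨p₀, hp₀, q₀, hq₀, u₀, u₀', hu₀, hu₀', h⟩
  obtain ⟨Q, hQ, hQ10, H⟩ := exists_cell hY hW hf
  obtain ⟨y, hy, hH⟩ := H c hc hcf
  obtain ⟨y', hy', hH'⟩ := H c' hc' hcf'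
  have h1 := hH p₀ hp₀ u₀ hu₀
  have h2 := hH' q₀ hq₀ u₀' hu₀'
  have h3 := hH p hp u hu
  have h4 := hH' q hq u' hu'
  obtain ⟨x₁, hx₁, rfl⟩ := h1
  obtain ⟨x₂, hx₂, rfl⟩ := h2
  obtain ⟨x₃, hx₃, rfl⟩ := h3
  obtain ⟨x₄, hx₄, rfl⟩ := h4
  simp only at h ⊢
  by_cases hyy : y = y'
  · subst hyy
    rw [hY.isometry]
    exact hQ10 _ hx₃ _ hx₄
  · have := hY.far hy hy' hyy (hQ hx₂) (hQ10 _ hx₁ _ hx₂)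
    omega

theorem near_trans (hY : SmallCancellation A Y) (hW : IsMill A Y W) {f : V}
    (hf : (.inr f : Set X ⊕ V) ∈ labelTree A Y W) {c c' c'' : Set X ⊕ V}
    (hc : c ∈ labelTree A Y W) (hc' : c' ∈ labelTree A Y W) (hc'' : c'' ∈ labelTree A Y W)
    (hcf : c ≠ .inr f) (hcf' : c' ≠ .inr f) (hcf'' : c'' ≠ .inr f)
    (h : Near Y f c c') (h' : Near Y f c' c'') : Near Y f c c'' := by
  obtain ⟨p, hp⟩ := piece_nonempty hY hW hc
  obtain ⟨q, hq⟩ := piece_nonempty hY hW hc'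
  obtain ⟨r, hr⟩ := piece_nonempty hY hW hc''
  obtain ⟨u, hu⟩ := exists_isProj (hY.convex f) (hY.nonempty f) p
  obtain ⟨v, hv⟩ := exists_isProj (hY.convex f) (hY.nonempty f) q
  obtain ⟨w, hw⟩ := exists_isProj (hY.convex f) (hY.nonempty f) r
  rw [near_iff hY hW hf hc hc' hcf hcf' hp hq hu hv] at h
  rw [near_iff hY hW hf hc' hc'' hcf' hcf'' hq hr hv hw] at h'
  rw [near_iff hY hW hf hc hc'' hcf hcf'' hp hr hu hw]
  obtain ⟨Q, hQ, hQ10, H⟩ := exists_cell hY hW hf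
  obtain ⟨y, hy, hH⟩ := H c hc hcf
  obtain ⟨y', hy', hH'⟩ := H c' hc' hcf'
  obtain ⟨y'', hy'', hH''⟩ := H c'' hc'' hcf''
  obtain ⟨x₁, hx₁, rfl⟩ := hH p hp u hu
  obtain ⟨x₂, hx₂, rfl⟩ := hH' q hq v hv
  obtain ⟨x₃, hx₃, rfl⟩ := hH'' r hr w hw
  simp only at h h' ⊢
  have e1 : y = y' := by
    by_contra hyy
    have := hY.far hy hy' hyy (hQ hx₂) (hQ10 _ hx₁ _ hx₂)
    omega
  have e2 : y' = y'' := by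
    by_contra hyy
    have := hY.far hy' hy'' hyy (hQ hx₃) (hQ10 _ hx₂ _ hx₃)
    omega
  subst e1 e2
  rw [hY.isometry]
  exact hQ10 _ hx₁ _ hx₃

theorem near_refl (hY : SmallCancellation A Y) (hW : IsMill A Y W) (f : V) {c : Set X ⊕ V}
    (hc : c ∈ labelTree A Y W) : Near Y f c c := by
  obtain ⟨p, hp⟩ := piece_nonempty hY hW hc
  obtain ⟨u, hu⟩ := exists_isProj (hY.convex f) (hY.nonempty f) p
  exact ⟨p, hp, p, hp, u, u, hu, hu, by simp [d_self]⟩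

/-- An element that fixes the member `f` moves every direction at `f`. -/
theorem not_near_smul (hY : SmallCancellation A Y) (hW : IsMill A Y W) {f : V}
    (hf : (.inr f : Set X ⊕ V) ∈ labelTree A Y W) {c : Set X ⊕ V} (hc : c ∈ labelTree A Y W)
    (hcf : c ≠ .inr f) {x : A} (hx : x • f = f) (hx1 : x ≠ 1)
    (hxc : x • c ∈ labelTree A Y W) : ¬ Near Y f c (x • c) := by
  obtain ⟨p, hp⟩ := piece_nonempty hY hW hc
  obtain ⟨u, hu⟩ := exists_isProj (hY.convex f) (hY.nonempty f) p
  have hxu := hY.isProj_smul hu x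
  rw [hx] at hxu
  have hxcf : x • c ≠ .inr f := by
    intro h
    apply hcf
    rw [← smul_left_cancel_iff x, h, Sum.smul_inr, hx]
  rw [near_iff hY hW hf hc hxc hcf hxcf hp (smul_mem_piece hY x hp) hu hxu]
  have := hY.disp f x hx hx1 u hu.1
  omega

/-- If `f` separates `c` from `f'`, then a point of `c` and its projection to `Y f` have the same
projection to `Y f'`. -/
theorem near_between (hY : SmallCancellation A Y) (hW : IsMill A Y W) {f f' : V}
    (hf : (.inr f : Set X ⊕ V) ∈ labelTree A Y W) (hf' : (.inr f' : Set X ⊕ V) ∈ labelTree A Y W)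
    {c : Set X ⊕ V} (hc : c ∈ labelTree A Y W) (hcf : c ≠ .inr f) (hff' : f' ≠ f)
    (h : ¬ Near Y f c (.inr f')) : Near Y f' c (.inr f) := by
  obtain ⟨p, hp⟩ := piece_nonempty hY hW hc
  obtain ⟨u, hu⟩ := exists_isProj (hY.convex f) (hY.nonempty f) p
  obtain ⟨s, hs⟩ := exists_isProj (hY.convex f') (hY.nonempty f') u
  refine ⟨p, hp, u, hu.1, s, s, hu.trans (hY.convex f) hs fun y hy v hv => ?_, hs, by
    simp [d_self]⟩
  rw [near_iff hY hW hf hc hf' hcf (by simpa using hff') hp hy hu hv] at h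
  omega

theorem near_base_attached (hY : SmallCancellation A Y) (hW : IsMill A Y W) {e e' : V}
    (he : Attached Y W e) (he' : Attached Y W e') (hne : e' ≠ e) :
    Near Y e (.inl W) (.inr e') := by
  obtain ⟨p, hp⟩ := piece_nonempty (A := A) (V := V) hY hW base_mem_labelTree
  obtain ⟨q, hq⟩ := hY.nonempty e'
  obtain ⟨u, hu⟩ := exists_isProj (hY.convex e) (hY.nonempty e) p
  obtain ⟨v, hv⟩ := exists_isProj (hY.convex e) (hY.nonempty e) q
  exact ⟨p, hp, q, hq, u, v, hu, hv, d_le_of_mem_cell hY hW he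
    (mem_cell_of_mem_nbhd hW he hp hu) (mem_cell_of_attached hY hW he he' hne hq hv)⟩

theorem Branch.beyond (hY : SmallCancellation A Y) (hW : IsMill A Y W) {e : V} {c : Set X ⊕ V}
    (h : Branch A Y W e c) : Beyond Y W e c := by
  have he := h.attached
  obtain hc | ⟨y, hy, hy1, H⟩ := (h.mem_cell hY hW).2
  · exact Or.inl hc
  by_cases hce : c = .inr e
  · exact Or.inl hce
  have hcT : c ∈ labelTree A Y W := Or.inr ⟨e, h⟩
  right
  obtain ⟨p, hp⟩ := piece_nonempty (A := A) (V := V) hY hW base_mem_labelTree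
  obtain ⟨q, hq⟩ := piece_nonempty hY hW hcT
  obtain ⟨u, hu⟩ := exists_isProj (hY.convex e) (hY.nonempty e) p
  obtain ⟨v, hv⟩ := exists_isProj (hY.convex e) (hY.nonempty e) q
  rw [near_iff hY hW he.mem_labelTree base_mem_labelTree hcT (by simp) hce hp hq hu hv]
  obtain ⟨v', hv', rfl⟩ := H q hq v hv
  have hu' := mem_cell_of_mem_nbhd hW he hp hu
  have := hY.far (one_smul A e) hy (Ne.symm hy1) hv'.1 (d_le_of_mem_cell hY hW he hu' hv')
  rw [one_smul] at this
  simp only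
  omega

theorem exists_beyond (hY : SmallCancellation A Y) (hW : IsMill A Y W) {c : Set X ⊕ V}
    (hc : c ∈ labelTree A Y W) (hcW : c ≠ .inl W) : ∃ e, Attached Y W e ∧ Beyond Y W e c := by
  rcases hc with rfl | ⟨e, h⟩
  · exact absurd rfl hcW
  · exact ⟨e, h.attached, h.beyond hY hW⟩

/-- If `e` separates `W` from `c`, it also separates `e'` from `c`, because `e'` is on the side of
`W`. From `e'` the label `c` is then seen in the direction of `e`, which is that of `W`, so `e'`
does not separate. -/
theorem beyond_unique (hY : SmallCancellation A Y) (hW : IsMill A Y W) {c : Set X ⊕ V}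
    (hc : c ∈ labelTree A Y W) {e e' : V} (he : Attached Y W e) (he' : Attached Y W e')
    (h : Beyond Y W e c) (h' : Beyond Y W e' c) : e = e' := by
  by_contra hne
  have h1 := near_base_attached hY hW he he' (Ne.symm hne)
  have h2 := near_base_attached hY hW he' he hne
  rcases h with rfl | h
  · rcases h' with h' | h'
    · exact hne (Sum.inr.inj h')
    · exact h' h2
  rcases h' with rfl | h'
  · exact h h1
  by_cases hce : c = .inr e
  · subst hce; exact h' h2
  by_cases hce' : c = .inr e'
  · subst hce'; exact h h1
  have hWT : (.inl W : Set X ⊕ V) ∈ labelTree A Y W := base_mem_labelTree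
  have h3 : ¬ Near Y e c (.inr e') := fun h4 => h <|
    near_trans hY hW he.mem_labelTree hWT he'.mem_labelTree hc (by simp)
      (by simpa using Ne.symm hne) hce h1 h4.symm
  have h4 := near_between hY hW he.mem_labelTree he'.mem_labelTree hc hce (Ne.symm hne) h3
  exact h' (near_trans hY hW he'.mem_labelTree hWT he.mem_labelTree hc (by simp)
    (by simpa using hne) hce' h2 h4.symm)

theorem dir_refl (hY : SmallCancellation A Y) (hW : IsMill A Y W) {b c : Set X ⊕ V}
    (hb : b ∈ labelTree A Y W) (hc : c ∈ labelTree A Y W) (hcb : c ≠ b) : Dir Y b c c := by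
  rcases b with U | f
  · obtain ⟨g, hg, rfl⟩ := exists_of_inl_mem hb
    have hgc := smul_mem_labelTree hY hW (inv_mem hg) c hc
    obtain ⟨e, he, h⟩ := exists_beyond hY hW hgc
      (by rw [Ne, inv_smul_eq_iff]; exact hcb)
    have : Dir Y (.inl W) (g⁻¹ • c) (g⁻¹ • c) := ⟨e, he, h, h⟩
    simpa using this.smul hY g
  · exact near_refl hY hW f hc

theorem dir_trans (hY : SmallCancellation A Y) (hW : IsMill A Y W) {b c c' c'' : Set X ⊕ V}
    (hb : b ∈ labelTree A Y W) (hc : c ∈ labelTree A Y W) (hc' : c' ∈ labelTree A Y W)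
    (hc'' : c'' ∈ labelTree A Y W) (hcb : c ≠ b) (hcb' : c' ≠ b) (hcb'' : c'' ≠ b)
    (h : Dir Y b c c') (h' : Dir Y b c' c'') : Dir Y b c c'' := by
  rcases b with U | f
  · obtain ⟨g, hg, rfl⟩ := exists_of_inl_mem hb
    have h1 := h.smul hY g⁻¹
    have h2 := h'.smul hY g⁻¹
    rw [Sum.smul_inl, inv_smul_smul] at h1 h2
    obtain ⟨e, he, h3, h4⟩ := h1
    obtain ⟨e', he', h5, h6⟩ := h2
    obtain rfl := beyond_unique hY hW (smul_mem_labelTree hY hW (inv_mem hg) c' hc') he he' h4 h5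
    have : Dir Y (.inl W) (g⁻¹ • c) (g⁻¹ • c'') := ⟨e, he, h3, h6⟩
    simpa using this.smul hY g
  · exact near_trans hY hW hb hc hc' hc'' hcb hcb' hcb'' h h'

/-- Let `e` be the attached member through which `f` is reached. If `f ≠ e`, then `W` and `e` are on
the same side of `f`, so `f` separates `c` from `e`; at `e`, therefore, `c` and `f` lie together,
away from `W`. -/
theorem dir_base_of_not_near (hY : SmallCancellation A Y) (hW : IsMill A Y W) {f : V}
    (hf : (.inr f : Set X ⊕ V) ∈ labelTree A Y W) {c : Set X ⊕ V} (hc : c ∈ labelTree A Y W)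
    (hcf : c ≠ .inr f) (h : ¬ Near Y f c (.inl W)) : Dir Y (.inl W) c (.inr f) := by
  have hWT : (.inl W : Set X ⊕ V) ∈ labelTree A Y W := base_mem_labelTree
  obtain ⟨e, he, hef⟩ := exists_beyond hY hW hf (by simp)
  refine ⟨e, he, ?_, hef⟩
  by_cases hce : c = .inr e
  · exact Or.inl hce
  right
  rcases hef with hef | hef
  · obtain rfl := Sum.inr.inj hef
    exact fun h' => h h'.symm
  by_cases hfe : f = e
  · subst hfe; exact fun h' => h h'.symm
  have h1 := near_between hY hW he.mem_labelTree hf hWT (by simp) hfe hef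
  have h2 : ¬ Near Y f c (.inr e) := fun h' =>
    h (near_trans hY hW hf hc he.mem_labelTree hWT hcf (by simpa using Ne.symm hfe) (by simp) h'
      h1.symm)
  have h3 := near_between hY hW hf he.mem_labelTree hc hcf (Ne.symm hfe) h2
  exact fun h4 => hef (near_trans hY hW he.mem_labelTree hWT hc hf (by simp) hce
    (by simpa using hfe) h4 h3)

theorem dir_of_not_near (hY : SmallCancellation A Y) (hW : IsMill A Y W) {f : V}
    (hf : (.inr f : Set X ⊕ V) ∈ labelTree A Y W) {c : Set X ⊕ V} (hc : c ∈ labelTree A Y W)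
    (hcf : c ≠ .inr f) {g : A} (hg : g ∈ growGroup A Y W) (h : ¬ Near Y f c (.inl (g • W))) :
    Dir Y (.inl (g • W)) c (.inr f) := by
  have h1 : ¬ Near Y (g⁻¹ • f) (g⁻¹ • c) (.inl W) := by
    rw [← near_smul_iff hY g]; simpa using h
  have := dir_base_of_not_near hY hW (f := g⁻¹ • f)
    (smul_mem_labelTree hY hW (inv_mem hg) _ hf)
    (smul_mem_labelTree hY hW (inv_mem hg) _ hc)
    (by rw [← Sum.smul_inr, Ne, smul_left_cancel_iff]; exact hcf) h1
  simpa using this.smul hY g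

theorem dir_between (hY : SmallCancellation A Y) (hW : IsMill A Y W) {b c c' : Set X ⊕ V}
    (hb : b ∈ labelTree A Y W) (hc : c ∈ labelTree A Y W) (hc' : c' ∈ labelTree A Y W)
    (hcb : c ≠ b) (hcb' : c' ≠ b) (h : ¬ Dir Y b c c') : Dir Y c' c b := by
  have hcc' : c ≠ c' := by
    rintro rfl
    exact h (dir_refl hY hW hb hc hcb)
  rcases b with U | f
  · obtain ⟨g, hg, rfl⟩ := exists_of_inl_mem hb
    rcases c' with U' | f'
    · obtain ⟨g', hg', rfl⟩ := exists_of_inl_mem hc'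
      have hne : (.inl ((g'⁻¹ * g) • W) : Set X ⊕ V) ≠ .inl W := by
        intro h'
        apply hcb'
        rw [Sum.inl.injEq, mul_smul, inv_smul_eq_iff] at h'
        rw [h']
      -- For two translates of `W`, the witness is the member attached to the second one that leads
      -- to the first. If it did not also lead to `c`, then `c` and `c'` would be seen from `b` in
      -- the common direction of that member.
      obtain ⟨e, he, hbe⟩ := exists_beyond hY hW
        (smul_mem_labelTree hY hW (mul_mem (inv_mem hg') hg) (.inl W) base_mem_labelTree) hne
      have hf : (.inr (g' • e) : Set X ⊕ V) ∈ labelTree A Y W :=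
        smul_mem_labelTree hY hW hg' (.inr e) he.mem_labelTree
      have hbe' := hbe.smul hY g'
      have hatt := he.smul hY g'
      have e1 : g' • ((g'⁻¹ * g) • (.inl W : Set X ⊕ V)) = .inl (g • W) := by
        simp [mul_smul]
      rw [e1] at hbe'
      refine ⟨g' • e, hatt, ?_, hbe'⟩
      by_cases hcf : c = .inr (g' • e)
      · exact Or.inl hcf
      right
      intro hnear
      obtain hbe' | hbe' := hbe'
      · simp at hbe'
      have h1 : ¬ Near Y (g' • e) c (.inl (g • W)) := fun h2 => hbe'
        (near_trans hY hW hf hc' hc hb (by simp) hcf (by simp) hnear h2)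
      have h2 := dir_of_not_near hY hW hf hc hcf hg h1
      have h3 := dir_of_not_near hY hW hf hc' (by simp) hg hbe'
      exact h (dir_trans hY hW hb hc hf hc' hcb (by simp) hcb' h2 h3.symm)
    · by_contra h'
      exact h (dir_of_not_near hY hW hc' hc hcc' hg h')
  · rcases c' with U' | f'
    · obtain ⟨g', hg', rfl⟩ := exists_of_inl_mem hc'
      exact dir_of_not_near hY hW hb hc hcb hg' h
    · exact near_between hY hW hb hc' hc hcb (by simpa using hcb') h

end Windmill

/-! ### The rank on the tree of labels, and convexity and overlaps of the grown set. -/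

section Windmill

variable {A V X : Type*} [Group A] [MulAction A V] [MulAction A X] [TreeMetric X]
variable {Y : V → Set X} {W : Set X}

/-- The members that separate two labels. -/
def separators (A : Type*) {V X : Type*} [Group A] [MulAction A V] [MulAction A X]
    [TreeMetric X] (Y : V → Set X) (W : Set X) (b c : Set X ⊕ V) : Set V :=
  {f | .inr f ∈ labelTree A Y W ∧ b ≠ .inr f ∧ c ≠ .inr f ∧ ¬ Near Y f b c}

theorem TreeMetric.d_eq_zero_of_between {p q z z' : X} (h : d p z + d z q = d p q)
    (h' : d p z' + d z' q = d p q) (hz : d p z = d p z') : d z z' = 0 := by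
  have c1 := d_comm q z
  have c2 := d_comm q z'
  rcases four_point p q z z' with h1 | h1 <;> omega

theorem TreeMetric.IsConvex.mem_of_d_eq_zero {U : Set X} (hU : IsConvex U) {p q : X}
    (hp : p ∈ U) (h : d p q = 0) : q ∈ U :=
  hU p hp p hp q (by rw [d_comm q p, h, d_self])

/-- Each separator contains a segment of length at least 11 of a fixed geodesic. The positions of
its ends determine the separator, since two members sharing the segment would overlap too much. -/
theorem finite_separators (hY : SmallCancellation A Y) (hW : IsMill A Y W) {b c : Set X ⊕ V}
    (hb : b ∈ labelTree A Y W) (hc : c ∈ labelTree A Y W) : (separators A Y W b c).Finite := by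
  obtain ⟨p, hp⟩ := piece_nonempty hY hW hb
  obtain ⟨q, hq⟩ := piece_nonempty hY hW hc
  choose u hu using fun f => exists_isProj (hY.convex f) (hY.nonempty f) p
  choose v hv using fun f => exists_isProj (hY.convex f) (hY.nonempty f) q
  have hfar : ∀ f ∈ separators A Y W b c, 11 ≤ d (u f) (v f) := by
    rintro f ⟨hf, hbf, hcf, h⟩
    rw [near_iff hY hW hf hb hc hbf hcf hp hq (hu f) (hv f)] at h
    omega
  have hd : ∀ f ∈ separators A Y W b c, d p q = d p (u f) + d (u f) (v f) + d (v f) q :=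
    fun f hf => (hu f).d_eq (hv f) (by have := hfar f hf; omega)
  refine Set.Finite.of_injOn (f := fun f => (d p (u f), d p (v f)))
    (t := Set.Iic (d p q) ×ˢ Set.Iic (d p q)) ?_ ?_ ((Set.finite_Iic _).prod (Set.finite_Iic _))
  · intro f hf
    have h1 := hd f hf
    have t := d_triangle p (u f) (v f)
    exact ⟨by simp only [Set.mem_Iic]; omega, by simp only [Set.mem_Iic]; omega⟩
  · intro f hf f' hf' heq
    simp only [Prod.mk.injEq] at heq
    by_contra hne
    have h1 := hd f hf
    have h2 := hd f' hf'
    have h3 := hfar f hf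
    have t1 := d_triangle p (u f) (v f)
    have t2 := d_triangle (u f) (v f) q
    have t3 := d_triangle p (v f) q
    have t4 := d_triangle p (u f) q
    have s1 := d_triangle p (u f') (v f')
    have s2 := d_triangle (u f') (v f') q
    have s3 := d_triangle p (v f') q
    have s4 := d_triangle p (u f') q
    have z1 : d (u f') (u f) = 0 :=
      d_eq_zero_of_between (p := p) (q := q) (by omega) (by omega) heq.1.symm
    have z2 : d (v f') (v f) = 0 :=
      d_eq_zero_of_between (p := p) (q := q) (by omega) (by omega) heq.2.symm
    have := hY.inter f f' hne (u f) ⟨(hu f).1, (hY.convex f').mem_of_d_eq_zero (hu f').1 z1⟩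
      (v f) ⟨(hv f).1, (hY.convex f').mem_of_d_eq_zero (hv f').1 z2⟩
    omega

theorem separators_smul (hY : SmallCancellation A Y) (hW : IsMill A Y W) {h : A}
    (hh : h ∈ growGroup A Y W) (b c : Set X ⊕ V) :
    separators A Y W (h • b) (h • c) = h • separators A Y W b c := by
  ext f
  rw [Set.mem_smul_set_iff_inv_smul_mem]
  have h1 : ∀ b : Set X ⊕ V, h • b = .inr f ↔ b = .inr (h⁻¹ • f) := fun b => by
    rw [← eq_inv_smul_iff, Sum.smul_inr]
  have h2 : Near Y f (h • b) (h • c) ↔ Near Y (h⁻¹ • f) b c := by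
    rw [← near_smul_iff hY h (f := h⁻¹ • f), smul_inv_smul]
  have h3 : (.inr f : Set X ⊕ V) ∈ labelTree A Y W ↔ (.inr (h⁻¹ • f) : Set X ⊕ V) ∈
      labelTree A Y W := by
    rw [← Sum.smul_inr, smul_mem_labelTree_iff hY hW (inv_mem hh)]
  simp only [separators, Set.mem_ofPred_eq, ne_eq, h1, h2, h3]

/-- One for a member of the family and zero for a set. -/
def kindRank : Set X ⊕ V → ℕ
  | .inl _ => 0
  | .inr _ => 1

theorem kindRank_smul (h : A) (c : Set X ⊕ V) : kindRank (h • c) = kindRank c := by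
  rcases c with U | v <;> rfl

theorem ncard_setOf_eq_inr (b : Set X ⊕ V) : {f | b = .inr f}.ncard = kindRank b := by
  rcases b with U | v
  · simp [kindRank]
  · have : {f | (.inr v : Set X ⊕ V) = .inr f} = {v} := by ext f; simp [eq_comm]
    rw [this, Set.ncard_singleton, kindRank]

theorem finite_setOf_eq_inr (b : Set X ⊕ V) : {f | b = .inr f}.Finite := by
  rcases b with U | v
  · simp
  · have : {f | (.inr v : Set X ⊕ V) = .inr f} = {v} := by ext f; simp [eq_comm]
    rw [this]; exact Set.finite_singleton v

theorem separators_subset (hY : SmallCancellation A Y) (hW : IsMill A Y W) {o b c : Set X ⊕ V}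
    (ho : o ∈ labelTree A Y W) (hb : b ∈ labelTree A Y W) (hc : c ∈ labelTree A Y W) :
    separators A Y W o c ⊆
      separators A Y W o b ∪ separators A Y W b c ∪ {f | b = .inr f} := by
  rintro f ⟨hf, hof, hcf, h⟩
  by_cases hbf : b = .inr f
  · exact Or.inr hbf
  left
  by_contra hcon
  simp only [separators, Set.mem_union, Set.mem_ofPred_eq, not_or, not_and, not_not] at hcon
  exact h (near_trans hY hW hf ho hb hc hof hbf hcf (hcon.1 hf hof hbf) (hcon.2 hf hbf hcf))

theorem ncard_separators_le (hY : SmallCancellation A Y) (hW : IsMill A Y W) {o b c : Set X ⊕ V}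
    (ho : o ∈ labelTree A Y W) (hb : b ∈ labelTree A Y W) (hc : c ∈ labelTree A Y W) :
    (separators A Y W o c).ncard ≤
      (separators A Y W o b).ncard + (separators A Y W b c).ncard + kindRank b := by
  have h1 := Set.ncard_le_ncard (separators_subset hY hW ho hb hc)
    (((finite_separators hY hW ho hb).union (finite_separators hY hW hb hc)).union
      (finite_setOf_eq_inr b))
  have h2 := Set.ncard_union_le (separators A Y W o b ∪ separators A Y W b c) {f | b = .inr f}
  have h3 := Set.ncard_union_le (separators A Y W o b) (separators A Y W b c)
  rw [ncard_setOf_eq_inr] at h2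
  omega

/-- Here `b` lies between `o` and `c`. The pretree axioms show that the separators on the two sides
of `b` are disjoint and still separate `o` from `c`; `b` itself is one more if it is a member. -/
theorem ncard_separators_eq (hY : SmallCancellation A Y) (hW : IsMill A Y W) {o b c : Set X ⊕ V}
    (ho : o ∈ labelTree A Y W) (hb : b ∈ labelTree A Y W) (hc : c ∈ labelTree A Y W)
    (hob : o ≠ b) (hcb : c ≠ b) (h : ¬ Dir Y b o c) :
    (separators A Y W o c).ncard =
      (separators A Y W o b).ncard + (separators A Y W b c).ncard + kindRank b := by
  refine le_antisymm (ncard_separators_le hY hW ho hb hc) ?_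
  have key1 : ∀ f ∈ separators A Y W o b, c ≠ .inr f ∧ Near Y f c b ∧ ¬ Near Y f o c := by
    rintro f ⟨hf, hof, hbf, hn⟩
    have h1 : Dir Y b o (.inr f) := dir_between hY hW hf ho hb hof hbf hn
    have hcf : c ≠ .inr f := by rintro rfl; exact h h1
    have h2 : ¬ Dir Y b c (.inr f) := fun h2 =>
      h (dir_trans hY hW hb ho hf hc hob (Ne.symm hbf) hcb h1 h2.symm)
    have h3 : Near Y f c b := dir_between hY hW hb hc hf hcb (Ne.symm hbf) h2
    exact ⟨hcf, h3, fun h4 => hn (near_trans hY hW hf ho hc hb hof hcf hbf h4 h3)⟩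
  have key2 : ∀ f ∈ separators A Y W b c, o ≠ .inr f ∧ ¬ Near Y f o c := by
    rintro f ⟨hf, hbf, hcf, hn⟩
    have h1 : Dir Y b c (.inr f) := dir_between hY hW hf hc hb hcf hbf fun h' => hn h'.symm
    have hof : o ≠ .inr f := by rintro rfl; exact h h1.symm
    have h2 : ¬ Dir Y b o (.inr f) := fun h2 =>
      h (dir_trans hY hW hb ho hf hc hob (Ne.symm hbf) hcb h2 h1.symm)
    have h3 : Near Y f o b := dir_between hY hW hb ho hf hob (Ne.symm hbf) h2
    exact ⟨hof, fun h4 => hn (near_trans hY hW hf hb ho hc hbf hof hcf h3.symm h4)⟩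
  have hsub : separators A Y W o b ∪ separators A Y W b c ∪ {f | b = .inr f} ⊆
      separators A Y W o c := by
    rintro f ((hf | hf) | rfl)
    · exact ⟨hf.1, hf.2.1, (key1 f hf).1, (key1 f hf).2.2⟩
    · exact ⟨hf.1, (key2 f hf).1, hf.2.2.1, (key2 f hf).2⟩
    · exact ⟨hb, hob, hcb, h⟩
  have f1 := finite_separators hY hW ho hb
  have f2 := finite_separators hY hW hb hc
  have d1 : Disjoint (separators A Y W o b) (separators A Y W b c) := by
    rw [Set.disjoint_left]
    exact fun f hf hf' => hf'.2.2.2 (key1 f hf).2.1.symm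
  have d2 : Disjoint (separators A Y W o b ∪ separators A Y W b c) {f | b = .inr f} := by
    rw [Set.disjoint_left]
    rintro f (hf | hf) hbf
    · exact hf.2.2.1 hbf
    · exact hf.2.1 hbf
  have := Set.ncard_le_ncard hsub (finite_separators hY hW ho hc)
  rwa [Set.ncard_union_eq d2 (f1.union f2) (finite_setOf_eq_inr b), Set.ncard_union_eq d1 f1 f2,
    ncard_setOf_eq_inr] at this

/-- When `o` and `c` lie in one direction from `b`, something on the right is superfluous. If `b` is
a member, it does not separate `o` from `c`. If `b` is a set, the attached member leading to both is
counted twice, or equals `c` and is not a separator of `o` and `c`. -/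
theorem ncard_separators_lt (hY : SmallCancellation A Y) (hW : IsMill A Y W) {o b c : Set X ⊕ V}
    (ho : o ∈ labelTree A Y W) (hb : b ∈ labelTree A Y W) (hc : c ∈ labelTree A Y W)
    (hob : o ≠ b) (hcb : c ≠ b) (ho0 : kindRank o = 0) (h : Dir Y b o c) :
    (separators A Y W o c).ncard <
      (separators A Y W o b).ncard + (separators A Y W b c).ncard + kindRank b := by
  have f1 := finite_separators hY hW ho hb
  have f2 := finite_separators hY hW hb hc
  rcases b with U | f
  · obtain ⟨g, hg, rfl⟩ := exists_of_inl_mem hb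
    have h' := h.smul hY g⁻¹
    rw [Sum.smul_inl, inv_smul_smul] at h'
    obtain ⟨e, he, h1, h2⟩ := h'
    have hf : (.inr (g • e) : Set X ⊕ V) ∈ labelTree A Y W :=
      smul_mem_labelTree hY hW hg (.inr e) he.mem_labelTree
    have h1' := h1.smul hY g
    have h2' := h2.smul hY g
    rw [smul_inv_smul] at h1' h2'
    have hof : o ≠ .inr (g • e) := by rintro rfl; simp [kindRank] at ho0
    have hm : g • e ∈ separators A Y W o (.inl (g • W)) :=
      ⟨hf, hof, by simp, fun h3 => (h1'.resolve_left hof) h3.symm⟩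
    have hsub := separators_subset hY hW ho hb hc
    have hemp : {f | (.inl (g • W) : Set X ⊕ V) = .inr f} = ∅ := by simp
    rw [hemp, Set.union_empty] at hsub
    have hle := Set.ncard_union_le (separators A Y W o (.inl (g • W)))
      (separators A Y W (.inl (g • W)) c)
    simp only [kindRank]
    by_cases hcf : c = .inr (g • e)
    · have hss : separators A Y W o c ⊂
          separators A Y W o (.inl (g • W)) ∪ separators A Y W (.inl (g • W)) c :=
        ⟨hsub, fun h3 => (h3 (Or.inl hm)).2.2.1 hcf⟩
      have := Set.ncard_lt_ncard hss (f1.union f2)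
      omega
    · have hm2 : g • e ∈ separators A Y W (.inl (g • W)) c :=
        ⟨hf, by simp, hcf, h2'.resolve_left hcf⟩
      have hsub2 : separators A Y W o c ⊆ separators A Y W o (.inl (g • W)) ∪
          separators A Y W (.inl (g • W)) c \ {g • e} := by
        intro f hf'
        by_cases hfe : f = g • e
        · rw [hfe]; exact Or.inl hm
        · rcases hsub hf' with h3 | h3
          · exact Or.inl h3
          · exact Or.inr ⟨h3, hfe⟩
      have h3 := Set.ncard_le_ncard hsub2 (f1.union (f2.subset Set.sdiff_subset))
      have h4 := Set.ncard_union_le (separators A Y W o (.inl (g • W)))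
        (separators A Y W (.inl (g • W)) c \ {g • e})
      have h5 := Set.ncard_sdiff_singleton_lt_of_mem hm2 f2
      omega
  · have hsub : separators A Y W o c ⊆
        separators A Y W o (.inr f) ∪ separators A Y W (.inr f) c := by
      intro f' hf'
      rcases separators_subset hY hW ho hb hc hf' with h1 | h1
      · exact h1
      · obtain rfl := Sum.inr.inj h1
        exact absurd h hf'.2.2.2
    have h1 := Set.ncard_le_ncard hsub (f1.union f2)
    have h2 := Set.ncard_union_le (separators A Y W o (.inr f)) (separators A Y W (.inr f) c)
    simp only [kindRank]
    omega

theorem separators_pos (hY : SmallCancellation A Y) (hW : IsMill A Y W) {b c : Set X ⊕ V}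
    (hb : b ∈ labelTree A Y W) (hc : c ∈ labelTree A Y W) (hcb : c ≠ b) (hb0 : kindRank b = 0) :
    0 < (separators A Y W b c).ncard + kindRank c := by
  rcases b with U | f
  · obtain ⟨g, hg, rfl⟩ := exists_of_inl_mem hb
    obtain ⟨e, he, hgc⟩ := exists_beyond hY hW (smul_mem_labelTree hY hW (inv_mem hg) c hc)
      (by rw [Ne, inv_smul_eq_iff]; exact hcb)
    have hf : (.inr (g • e) : Set X ⊕ V) ∈ labelTree A Y W :=
      smul_mem_labelTree hY hW hg (.inr e) he.mem_labelTree
    have h := hgc.smul hY g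
    rw [smul_inv_smul] at h
    by_cases hcf : c = .inr (g • e)
    · rw [hcf]; simp [kindRank]
    · have hm : g • e ∈ separators A Y W (.inl (g • W)) c :=
        ⟨hf, by simp, hcf, h.resolve_left hcf⟩
      have := (Set.ncard_pos (finite_separators hY hW hb hc)).2 ⟨_, hm⟩
      omega
  · simp [kindRank] at hb0

/-- The distance of a label from `W` in the tree of labels. -/
noncomputable def labelRank (A : Type*) {V X : Type*} [Group A] [MulAction A V] [MulAction A X]
    [TreeMetric X] (Y : V → Set X) (W : Set X) (c : Set X ⊕ V) : ℕ :=
  2 * (separators A Y W (.inl W) c).ncard + kindRank c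

theorem ncard_separators_smul (hY : SmallCancellation A Y) (hW : IsMill A Y W) {h : A}
    (hh : h ∈ growGroup A Y W) (b c : Set X ⊕ V) :
    (separators A Y W (h • b) (h • c)).ncard = (separators A Y W b c).ncard := by
  rw [separators_smul hY hW hh, Set.ncard_smul_set]

theorem labelRank_base (hY : SmallCancellation A Y) (hW : IsMill A Y W) :
    labelRank A Y W (.inl W) = 0 := by
  have : separators A Y W (.inl W) (.inl W) = ∅ := by
    ext f
    simp only [separators, Set.mem_ofPred_eq, Set.mem_empty_iff_false, iff_false]
    exact fun h => h.2.2.2 (near_refl hY hW f (A := A) base_mem_labelTree)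
  simp [labelRank, this, kindRank]

/-- In the bipartite tree of sets and members each separator accounts for two edges on the way from
`W`, and a member at the end for one more. The rank conditions thus reduce to additivity of
separator counts when `b` is between, subadditivity in general, and strict subadditivity within one
direction. -/
theorem rankedPretree_labelTree (hY : SmallCancellation A Y) (hW : IsMill A Y W) :
    RankedPretree (growGroup A Y W) (labelTree A Y W) (Dir Y) (.inl W) (labelRank A Y W) where
  base_mem := base_mem_labelTree
  smul_mem _ hh := smul_mem_labelTree hY hW hh
  refl _ hb _ hc := dir_refl hY hW hb hc
  symm _ _ _ := Dir.symm
  trans _ hb _ hc _ hc' _ hc'' := dir_trans hY hW hb hc hc' hc''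
  smul h _ _ _ _ := Dir.smul hY h
  between _ hb _ hc _ hc' := dir_between hY hW hb hc hc'
  rank_lt b hb c hc hcb h := by
    have hpos := separators_pos hY hW hb hc hcb
    by_cases hbo : b = .inl W
    · subst hbo
      rw [labelRank_base hY hW, labelRank]
      have := hpos rfl
      omega
    · have := ncard_separators_eq hY hW base_mem_labelTree hb hc (Ne.symm hbo) hcb
        (h.resolve_left hbo)
      simp only [labelRank, this]
      rcases Nat.eq_zero_or_pos (kindRank b) with h0 | h0
      · have := hpos h0
        omega
      · omega
  rank_smul_le b hb c hc hcb h g hg hgb := by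
    have hgc := smul_mem_labelTree hY hW hg c hc
    have h1 := ncard_separators_smul hY hW hg b c
    rw [hgb] at h1
    by_cases hbo : b = .inl W
    · subst hbo
      rw [labelRank, labelRank, h1, kindRank_smul]
    · have h2 := ncard_separators_eq hY hW base_mem_labelTree hb hc (Ne.symm hbo) hcb
        (h.resolve_left hbo)
      have h3 := ncard_separators_le hY hW base_mem_labelTree hb hgc
      simp only [labelRank, kindRank_smul]
      omega
  rank_smul_lt b hb c hc hcb hbo h g hg hgb h' := by
    have hgc := smul_mem_labelTree hY hW hg c hc
    have h1 := ncard_separators_smul hY hW hg b c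
    rw [hgb] at h1
    have h2 := ncard_separators_eq hY hW base_mem_labelTree hb hc (Ne.symm hbo) hcb h
    have h3 := ncard_separators_lt hY hW base_mem_labelTree hb hgc (Ne.symm hbo)
      (by intro h4; apply hcb; rw [← smul_left_cancel_iff g, h4, hgb]) rfl h'
    simp only [labelRank, kindRank_smul]
    omega

theorem smul_mem_grown_iff (hY : SmallCancellation A Y) (hW : IsMill A Y W) {h : A}
    (hh : h ∈ growGroup A Y W) {p : X} : h • p ∈ grown A Y W ↔ p ∈ grown A Y W := by
  have key : ∀ {h : A} {p : X}, h ∈ growGroup A Y W → p ∈ grown A Y W → h • p ∈ grown A Y W := by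
    rintro h p hh ⟨c, hc, hp⟩
    exact ⟨h • c, smul_mem_labelTree hY hW hh c hc, smul_mem_piece hY h hp⟩
  refine ⟨fun h' => ?_, key hh⟩
  simpa using key (inv_mem hh) h'

theorem smul_grown (hY : SmallCancellation A Y) (hW : IsMill A Y W) {h : A}
    (hh : h ∈ growGroup A Y W) : h • grown A Y W = grown A Y W := by
  ext p
  rw [Set.mem_smul_set_iff_inv_smul_mem, smul_mem_grown_iff hY hW (inv_mem hh)]

/-- Successive pieces share a translate of a point of `Y e ∩ nbhd W`. Splitting the geodesic there
leaves one part near the current member and moves the other one step back along the branch. -/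
theorem Branch.mem_grown_of_between (hY : SmallCancellation A Y) (hW : IsMill A Y W) {e : V}
    {c : Set X ⊕ V} (h : Branch A Y W e c) {p q z : X} (hp : p ∈ nbhd W ∨ p ∈ Y e)
    (hq : q ∈ piece Y c) (hz : d p z + d z q = d p q) : z ∈ grown A Y W := by
  have aux : ∀ {e : V} {p q z : X}, Attached Y W e → p ∈ nbhd W ∨ p ∈ Y e → q ∈ Y e →
      d p z + d z q = d p q → z ∈ grown A Y W := by
    intro e p q z he hp hq hz
    obtain ⟨i, hi, hiW⟩ := he.2
    rcases hp with hp | hp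
    · rcases between_or_between hz i with h1 | h1
      · exact ⟨_, base_mem_labelTree, isConvex_nbhd hW.convex p hp i hiW z h1⟩
      · exact ⟨_, he.mem_labelTree, hY.convex e i hi q hq z h1⟩
    · exact ⟨_, he.mem_labelTree, hY.convex e p hp q hq z hz⟩
  induction h generalizing p q z with
  | self e he => exact aux he hp hq hz
  | base e y he hy hy1 =>
    obtain ⟨i, hi, hiW⟩ := he.2
    have hyi : y • i ∈ Y e := by
      have := smul_mem_piece hY y (c := .inr e) hi
      rwa [Sum.smul_inr, hy] at this
    rcases between_or_between hz (y • i) with h1 | h1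
    · exact aux he hp hyi h1
    · refine ⟨.inl (y • W), Or.inr ⟨e, .base e y he hy hy1⟩, ?_⟩
      refine isConvex_nbhd (hW.convex.smul hY.isometry y) (y • i) ?_ q hq z h1
      rw [← smul_nbhd hY.isometry]
      exact Set.smul_mem_smul_set hiW
  | step e e' y c he hy hy1 hne hc ih =>
    obtain ⟨i, hi, hiW⟩ := he.2
    have hyi : y • i ∈ Y e := by
      have := smul_mem_piece hY y (c := .inr e) hi
      rwa [Sum.smul_inr, hy] at this
    rcases between_or_between hz (y • i) with h1 | h1
    · exact aux he hp hyi h1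
    · rw [← smul_mem_grown_iff hY hW (inv_mem (mem_growGroup_of_attached he hy))]
      refine ih (p := i) (q := y⁻¹ • q) (Or.inl hiW) ?_ ?_
      · rwa [← Set.mem_smul_set_iff_inv_smul_mem, ← piece_smul hY]
      · rw [← hY.isometry y i, ← hY.isometry y i, ← hY.isometry y (y⁻¹ • z)]
        simpa using h1

theorem isConvex_grown (hY : SmallCancellation A Y) (hW : IsMill A Y W) :
    IsConvex (grown A Y W) := by
  have base : ∀ p ∈ nbhd W, ∀ q ∈ grown A Y W, ∀ z, d p z + d z q = d p q →
      z ∈ grown A Y W := by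
    rintro p hp q ⟨c, rfl | ⟨e, hc⟩, hq⟩ z hz
    · exact ⟨_, base_mem_labelTree, isConvex_nbhd hW.convex p hp q hq z hz⟩
    · exact hc.mem_grown_of_between hY hW (Or.inl hp) hq hz
  have trans : ∀ g ∈ growGroup A Y W, ∀ p ∈ nbhd (g • W), ∀ q ∈ grown A Y W, ∀ z,
      d p z + d z q = d p q → z ∈ grown A Y W := by
    intro g hg p hp q hq z hz
    rw [← smul_mem_grown_iff hY hW (inv_mem hg)]
    refine base (g⁻¹ • p) ?_ (g⁻¹ • q) ?_ (g⁻¹ • z) (by simpa only [hY.isometry] using hz)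
    · rwa [← Set.mem_smul_set_iff_inv_smul_mem, smul_nbhd hY.isometry]
    · rwa [smul_mem_grown_iff hY hW (inv_mem hg)]
  rintro p ⟨b, hb, hp⟩ q hq z hz
  obtain ⟨g, hg, rfl | ⟨e, he, rfl⟩⟩ := exists_smul_eq_of_mem hb
  · exact trans g hg p hp q hq z hz
  · obtain ⟨i, hi, hiW⟩ := he.2
    have hgi : g • i ∈ Y (g • e) := smul_mem_piece hY g (c := .inr e) hi
    rcases between_or_between hz (g • i) with h1 | h1
    · exact ⟨_, hb, hY.convex _ p hp _ hgi z h1⟩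
    · refine trans g hg (g • i) ?_ q hq z h1
      rw [← smul_nbhd hY.isometry]
      exact Set.smul_mem_smul_set hiW

/-- A member outside the label tree meets two pieces only if no member separates them. -/
theorem near_of_mem_pieces (hY : SmallCancellation A Y) (hW : IsMill A Y W) {v : V}
    (hv : (.inr v : Set X ⊕ V) ∉ labelTree A Y W) {b c : Set X ⊕ V} (hb : b ∈ labelTree A Y W)
    (hc : c ∈ labelTree A Y W) {p q : X} (hp : p ∈ Y v) (hpb : p ∈ piece Y b) (hq : q ∈ Y v)
    (hqc : q ∈ piece Y c) {f : V} (hf : (.inr f : Set X ⊕ V) ∈ labelTree A Y W)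
    (hbf : b ≠ .inr f) (hcf : c ≠ .inr f) : Near Y f b c := by
  by_contra hn
  obtain ⟨u, hu⟩ := exists_isProj (hY.convex f) (hY.nonempty f) p
  obtain ⟨w, hw⟩ := exists_isProj (hY.convex f) (hY.nonempty f) q
  rw [near_iff hY hW hf hb hc hbf hcf hpb hqc hu hw] at hn
  obtain ⟨h1, h2⟩ := hu.mem_of_far hw (hY.convex v) hp hq (by omega)
  have hne : v ≠ f := by rintro rfl; exact hv hf
  have := hY.inter v f hne u ⟨h1, hu.1⟩ w ⟨h2, hw.1⟩
  omega

/-- Both points have the same projection to `nbhd W`, for otherwise `Y v` would meet that set. The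
projection lies in both attached members, so the median of the three points lies in all three
members; each half of the path has length at most 2, whence the bound 4 in `IsMill`. -/
theorem d_le_of_two_attached (hY : SmallCancellation A Y) (hW : IsMill A Y W) {v e e' : V}
    (hv : Y v ∩ nbhd W = ∅) (he : Attached Y W e) (he' : Attached Y W e') {p q : X}
    (hp : p ∈ Y v ∩ Y e) (hq : q ∈ Y v ∩ Y e') : d p q ≤ 4 := by
  have hve : ∀ e, Attached Y W e → v ≠ e := by
    rintro e he rfl
    rw [Set.eq_empty_iff_forall_notMem] at hv
    obtain ⟨i, hi⟩ := he.2
    exact hv i hi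
  have hWc := isConvex_nbhd hW.convex
  have hWne : (nbhd W).Nonempty := hW.nonempty.mono (subset_nbhd W)
  obtain ⟨z, hz⟩ := exists_isProj hWc hWne p
  obtain ⟨z', hz'⟩ := exists_isProj hWc hWne q
  have hzz' : d z' z = 0 := by
    by_contra h
    obtain ⟨h1, -⟩ := hz'.mem_of_far hz (hY.convex v) hq.1 hp.1 (by omega)
    rw [Set.eq_empty_iff_forall_notMem] at hv
    exact hv z' ⟨h1, hz'.1⟩
  have hze : z ∈ Y e := hz.mem_of_isConvex (hY.convex e) hp.2 (by
    rw [Set.inter_comm]; exact he.2)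
  have hze' : z ∈ Y e' := (hY.convex e').mem_of_d_eq_zero
    (hz'.mem_of_isConvex (hY.convex e') hq.2 (by rw [Set.inter_comm]; exact he'.2)) hzz'
  obtain ⟨m, h1, h2, h3⟩ := exists_median p q z
  have hmv := hY.convex v p hp.1 q hq.1 m h1
  have hme := hY.convex e p hp.2 z hze m h2
  have hme' := hY.convex e' q hq.2 z hze' m h3
  have b1 := hY.inter v e (hve e he) p hp m ⟨hmv, hme⟩
  have b2 := hY.inter v e' (hve e' he') q hq m ⟨hmv, hme'⟩
  have c1 := d_comm q m
  omega

/-- Up to the stabilizer of `e`, a label beyond `e` is next to `e` or beyond another member. -/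
theorem Branch.exists_eq_smul {e : V} {c : Set X ⊕ V} (h : Branch A Y W e c) :
    ∃ (y : A) (c₀ : Set X ⊕ V), y • e = e ∧ c = y • c₀ ∧
      (c₀ = .inl W ∨ c₀ = .inr e ∨ ∃ e₁, Branch A Y W e₁ c₀ ∧ e₁ ≠ e) := by
  cases h with
  | self => exact ⟨1, .inr e, one_smul _ _, by simp, Or.inr (Or.inl rfl)⟩
  | base _ y _ hy => exact ⟨y, .inl W, hy, rfl, Or.inl rfl⟩
  | step _ e' y c _ hy _ hne hc => exact ⟨y, c, hy, rfl, Or.inr (Or.inr ⟨e', hc, hne⟩)⟩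

/-- A member outside the tree cannot reach two pieces separated by a member of the tree. After a
translation both pieces are therefore `W` or attached to it, and the estimate for two attached
members applies. -/
theorem d_le_of_notMem_labelTree (hY : SmallCancellation A Y) (hW : IsMill A Y W) {v : V}
    (hv : (.inr v : Set X ⊕ V) ∉ labelTree A Y W)
    (hvW : ∀ g ∈ growGroup A Y W, ¬ Y v ⊆ g • W) :
    ∀ p ∈ Y v ∩ grown A Y W, ∀ q ∈ Y v ∩ grown A Y W, d p q ≤ 4 := by
  have transl : ∀ {v : V} {g : A}, g ∈ growGroup A Y W →
      (.inr v : Set X ⊕ V) ∉ labelTree A Y W → (∀ g ∈ growGroup A Y W, ¬ Y v ⊆ g • W) →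
      (.inr (g • v) : Set X ⊕ V) ∉ labelTree A Y W ∧
        ∀ h ∈ growGroup A Y W, ¬ Y (g • v) ⊆ h • W := by
    intro v g hg hv hvW
    refine ⟨fun h => hv ?_, fun h hh h' => hvW (g⁻¹ * h) (mul_mem (inv_mem hg) hh) ?_⟩
    · rwa [← smul_mem_labelTree_iff hY hW hg, Sum.smul_inr]
    · rw [hY.smul_set, Set.smul_set_subset_iff_subset_inv_smul_set] at h'
      rwa [mul_smul]
  -- both pieces are next to `W`
  have near : ∀ {v : V}, (.inr v : Set X ⊕ V) ∉ labelTree A Y W →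
      (∀ g ∈ growGroup A Y W, ¬ Y v ⊆ g • W) → ∀ {b c : Set X ⊕ V} {p q : X},
      (b = .inl W ∨ ∃ e, Attached Y W e ∧ b = .inr e) →
      (c = .inl W ∨ ∃ e, Attached Y W e ∧ c = .inr e) → p ∈ Y v → p ∈ piece Y b → q ∈ Y v →
      q ∈ piece Y c → d p q ≤ 4 := by
    intro v hv hvW b c p q hb hc hp hpb hq hqc
    have hvWs : ¬ Y v ⊆ W := by simpa using hvW 1 (one_mem _)
    have hemp : Y v ∩ nbhd W = ∅ := by
      by_contra h
      exact hv (Attached.mem_labelTree ⟨hvWs, Set.nonempty_iff_ne_empty.2 h⟩)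
    rcases hb with rfl | ⟨e, he, rfl⟩
    · exact absurd (hemp ▸ Set.mem_inter hp hpb : p ∈ (∅ : Set X)) (by simp)
    rcases hc with rfl | ⟨e', he', rfl⟩
    · exact absurd (hemp ▸ Set.mem_inter hq hqc : q ∈ (∅ : Set X)) (by simp)
    exact d_le_of_two_attached hY hW hemp he he' ⟨hp, hpb⟩ ⟨hq, hqc⟩
  -- the first piece is next to `W` and the other one is not beyond it
  have half : ∀ {v : V}, (.inr v : Set X ⊕ V) ∉ labelTree A Y W →
      (∀ g ∈ growGroup A Y W, ¬ Y v ⊆ g • W) → ∀ {b c : Set X ⊕ V} {p q : X},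
      (b = .inl W ∨ ∃ e, Attached Y W e ∧ b = .inr e) →
      (c = .inl W ∨ (∃ e, Attached Y W e ∧ c = .inr e) ∨ ∃ e₁, Branch A Y W e₁ c ∧ b ≠ .inr e₁) →
      p ∈ Y v → p ∈ piece Y b → q ∈ Y v →
      q ∈ piece Y c → d p q ≤ 4 := by
    intro v hv hvW b c p q hb hc hp hpb hq hqc
    refine near hv hvW hb ?_ hp hpb hq hqc
    rcases hc with rfl | hc | ⟨e₁, hc, hbe⟩
    · exact Or.inl rfl
    · exact Or.inr hc
    have he₁ := hc.attached
    rcases hc.beyond hY hW with h | h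
    · exact Or.inr ⟨e₁, he₁, h⟩
    by_cases hce : c = .inr e₁
    · exact Or.inr ⟨e₁, he₁, hce⟩
    exfalso
    have hbT : b ∈ labelTree A Y W := by
      rcases hb with rfl | ⟨e, he, rfl⟩
      · exact base_mem_labelTree
      · exact he.mem_labelTree
    have hcT : c ∈ labelTree A Y W := Or.inr ⟨e₁, hc⟩
    have h1 := near_of_mem_pieces hY hW hv hbT hcT hp hpb hq hqc he₁.mem_labelTree hbe hce
    apply h
    rcases hb with rfl | ⟨e, he, rfl⟩
    · exact h1
    · exact near_trans hY hW he₁.mem_labelTree base_mem_labelTree hbT hcT (by simp) hbe hce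
        (near_base_attached hY hW he₁ he (by simpa using hbe)) h1
  rintro p ⟨hp, b, hb, hpb⟩ q ⟨hq, c, hc, hqc⟩
  have move : ∀ g ∈ growGroup A Y W, ∀ b₀ c₀ : Set X ⊕ V, b = g • b₀ → c = g • c₀ →
      (b₀ = .inl W ∨ ∃ e, Attached Y W e ∧ b₀ = .inr e) →
      (c₀ = .inl W ∨ (∃ e, Attached Y W e ∧ c₀ = .inr e) ∨
        ∃ e₁, Branch A Y W e₁ c₀ ∧ b₀ ≠ .inr e₁) → d p q ≤ 4 := by
    rintro g hg b₀ c₀ rfl rfl h1 h2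
    obtain ⟨h3, h4⟩ := transl (inv_mem hg) hv hvW
    rw [← hY.isometry g⁻¹]
    have h5 : ∀ {p : X}, p ∈ Y v → g⁻¹ • p ∈ Y (g⁻¹ • v) := fun hp =>
      smul_mem_piece hY g⁻¹ (c := .inr v) hp
    have h6 : ∀ {p : X} {c : Set X ⊕ V}, p ∈ piece Y (g • c) → g⁻¹ • p ∈ piece Y c := by
      intro p c hp
      have := smul_mem_piece hY g⁻¹ hp
      rwa [inv_smul_smul] at this
    exact half h3 h4 h1 h2 (h5 hp) (h6 hpb) (h5 hq) (h6 hqc)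
  obtain ⟨g, hg, rfl | ⟨e, he, rfl⟩⟩ := exists_smul_eq_of_mem hb
  · refine move g hg (.inl W) (g⁻¹ • c) rfl (by simp) (Or.inl rfl) ?_
    rcases smul_mem_labelTree hY hW (inv_mem hg) c hc with h | ⟨e₁, h⟩
    · exact Or.inl h
    · exact Or.inr (Or.inr ⟨e₁, h, by simp⟩)
  · have hb₀ : (.inr e : Set X ⊕ V) = .inl W ∨ ∃ e₁, Attached Y W e₁ ∧
        (.inr e : Set X ⊕ V) = .inr e₁ := Or.inr ⟨e, he, rfl⟩
    rcases smul_mem_labelTree hY hW (inv_mem hg) c hc with h | ⟨e₁, h⟩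
    · exact move g hg (.inr e) (g⁻¹ • c) rfl (by simp) hb₀ (Or.inl h)
    by_cases hne : e₁ = e
    · subst hne
      obtain ⟨y, c₀, hy, hc₀, h'⟩ := h.exists_eq_smul
      refine move (g * y) (mul_mem hg (mem_growGroup_of_attached he hy)) (.inr e₁) c₀
        (by rw [Sum.smul_inr, mul_smul, hy]) (by rw [mul_smul, ← hc₀, smul_inv_smul]) hb₀ ?_
      rcases h' with h' | h' | ⟨e₂, h', hne⟩
      · exact Or.inl h'
      · exact Or.inr (Or.inl ⟨e₁, he, h'⟩)
      · exact Or.inr (Or.inr ⟨e₂, h', by simpa using Ne.symm hne⟩)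
    · exact move g hg (.inr e) (g⁻¹ • c) rfl (by simp) hb₀
        (Or.inr (Or.inr ⟨e₁, h, by simpa using Ne.symm hne⟩))

end Windmill

/-! ### Rotation families and the growth of rotation mills. -/

section Windmill

variable {A V X : Type*} [Group A] [MulAction A V] [MulAction A X] [TreeMetric X]
variable {Y : V → Set X} {W : Set X}

/-- An invariant family of subsemigroups of the stabilizers that do not contain the identity. -/
structure RotationFamily (S : V → Set A) : Prop where
  smul_eq : ∀ v, ∀ g ∈ S v, g • v = v
  conj_mem : ∀ v, ∀ g ∈ S v, ∀ h : A, h * g * h⁻¹ ∈ S (h • v)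
  mul_mem : ∀ v, ∀ g ∈ S v, ∀ g' ∈ S v, g * g' ∈ S v
  one_notMem : ∀ v, (1 : A) ∉ S v

theorem RotationFamily.prod_mem {S : V → Set A} (hS : RotationFamily S) {v : V} {L : List A}
    (hne : L ≠ []) (hL : ∀ g ∈ L, g ∈ S v) : L.prod ∈ S v := by
  induction L with
  | nil => exact absurd rfl hne
  | cons g L ih =>
    by_cases h : L = []
    · subst h; simpa using hL g (by simp)
    · rw [List.prod_cons]
      exact hS.mul_mem v _ (hL g (by simp)) _ (ih h fun g' hg' => hL g' (by simp [hg']))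

/-- A mill containing the member `v₀` such that products of elements of a rotation family over the
members in it are nontrivial, and outside the stabilizer of `v₀` unless all members are `v₀`. -/
structure IsRotationMill (Y : V → Set X) (S : V → Set A) (v₀ : V) (W : Set X) : Prop
    extends IsMill A Y W where
  base_subset : Y v₀ ⊆ W
  prod_ne_one : ∀ L : List (V × A), L ≠ [] → (∀ e ∈ L, Y e.1 ⊆ W ∧ e.2 ∈ S e.1) →
    (L.map Prod.snd).prod ≠ 1
  eq_base_of_prod : ∀ L : List (V × A), (∀ e ∈ L, Y e.1 ⊆ W ∧ e.2 ∈ S e.1) →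
    (L.map Prod.snd).prod • v₀ = v₀ → ∀ e ∈ L, e.1 = v₀

/-- A member contains two points of an orbit of its stabilizer at distance at least 21, too far
apart for an overlap of distinct members. -/
theorem SmallCancellation.eq_of_subset (hY : SmallCancellation A Y) {v w : V} (h : Y v ⊆ Y w) :
    v = w := by
  by_contra hne
  obtain ⟨p, hp⟩ := hY.nonempty v
  obtain ⟨g, hg, hg1⟩ := hY.exists_stab v
  have hgp : g • p ∈ Y v := by
    have := smul_mem_piece hY g (c := .inr v) hp
    rwa [Sum.smul_inr, hg] at this
  have h1 := hY.disp v g hg hg1 p hp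
  have h2 := hY.inter v w hne p ⟨hp, h hp⟩ _ ⟨hgp, h hgp⟩
  omega

theorem isRotationMill_base (hY : SmallCancellation A Y) {S : V → Set A}
    (hS : RotationFamily S) (v₀ : V) : IsRotationMill Y S v₀ (Y v₀) where
  convex := hY.convex v₀
  nonempty := hY.nonempty v₀
  bound v hv p hp q hq := by
    have hne : v ≠ v₀ := by rintro rfl; exact hv subset_rfl
    exact (hY.inter v v₀ hne p hp q hq).trans (by norm_num)
  stab v hv g hg := by
    obtain rfl := hY.eq_of_subset hv
    rw [← hY.smul_set, hg]
  base_subset := subset_rfl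
  prod_ne_one L hne hL h := by
    refine hS.one_notMem v₀ ?_
    rw [← h]
    refine hS.prod_mem (by simpa using hne) fun g hg => ?_
    obtain ⟨e, he, rfl⟩ := List.mem_map.1 hg
    rw [← hY.eq_of_subset (hL e he).1]
    exact (hL e he).2
  eq_base_of_prod L hL _ e he := hY.eq_of_subset (hL e he).1

/-- The members that belong to a label. -/
def BelongsTo (Y : V → Set X) (v : V) : Set X ⊕ V → Prop
  | .inl U => Y v ⊆ U
  | .inr f => f = v

theorem BelongsTo.smul (hY : SmallCancellation A Y) (g : A) {v : V} {b : Set X ⊕ V}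
    (h : BelongsTo Y v b) : BelongsTo Y (g • v) (g • b) := by
  rcases b with U | f
  · show Y (g • v) ⊆ g • U
    rw [hY.smul_set, Set.smul_set_subset_smul_set_iff]
    exact h
  · show g • f = g • v
    rw [show f = v from h]

/-- A member not carried by any label meets the grown set in diameter at most 4, whereas every
member has diameter at least 21. -/
theorem exists_belongsTo_of_subset_grown (hY : SmallCancellation A Y) (hW : IsMill A Y W) {v : V}
    (hv : Y v ⊆ grown A Y W) : ∃ b ∈ labelTree A Y W, BelongsTo Y v b := by
  by_contra! hcon
  obtain ⟨p, hp⟩ := hY.nonempty v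
  obtain ⟨g, hg, hg1⟩ := hY.exists_stab v
  have hgp : g • p ∈ Y v := by
    have := smul_mem_piece hY g (c := .inr v) hp
    rwa [Sum.smul_inr, hg] at this
  have h1 := hY.disp v g hg hg1 p hp
  have h2 := d_le_of_notMem_labelTree hY hW (v := v) (fun h => hcon _ h rfl)
    (fun g hg => hcon (.inl (g • W)) (smul_mem_labelTree hY hW hg (.inl W) base_mem_labelTree))
    p ⟨hp, hv hp⟩ _ ⟨hgp, hv hgp⟩
  omega

theorem BelongsTo.mem_growGroup (hY : SmallCancellation A Y) {v : V}
    {b : Set X ⊕ V} (hb : b ∈ labelTree A Y W) (h : BelongsTo Y v b) {x : A} (hx : x • v = v) :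
    x ∈ growGroup A Y W := by
  obtain ⟨g, hg, rfl | ⟨e, he, rfl⟩⟩ := exists_smul_eq_of_mem hb
  · have h1 : Y (g⁻¹ • v) ⊆ W := by
      have h' : Y v ⊆ g • W := h
      rwa [hY.smul_set, ← Set.subset_smul_set_iff]
    have h2 : g⁻¹ * x * g ∈ growGroup A Y W :=
      mem_growGroup_of_subset h1 (by simp [mul_smul, hx])
    have := mul_mem (mul_mem hg h2) (inv_mem hg)
    simpa [mul_assoc] using this
  · have h' : g • e = v := h
    have h2 : g⁻¹ * x * g ∈ growGroup A Y W :=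
      mem_growGroup_of_attached he (by rw [mul_smul, h', mul_smul, hx, ← h', inv_smul_smul])
    have := mul_mem (mul_mem hg h2) (inv_mem hg)
    simpa [mul_assoc] using this

theorem BelongsTo.smul_eq (hY : SmallCancellation A Y) (hW : IsMill A Y W) {v : V}
    {b : Set X ⊕ V} (hb : b ∈ labelTree A Y W) (h : BelongsTo Y v b) {x : A} (hx : x • v = v) :
    x • b = b := by
  rcases b with U | f
  · obtain ⟨g, hg, rfl⟩ := exists_of_inl_mem hb
    have h1 : Y (g⁻¹ • v) ⊆ W := by
      have h' : Y v ⊆ g • W := h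
      rwa [hY.smul_set, ← Set.subset_smul_set_iff]
    have h2 := hW.stab _ h1 (g⁻¹ * x * g) (by simp [mul_smul, hx])
    rw [mul_smul, mul_smul, inv_smul_eq_iff] at h2
    rw [Sum.smul_inl, h2]
  · obtain rfl : f = v := h
    rw [Sum.smul_inr, hx]

/-- An element that preserves `W` moves every direction at `W`. -/
theorem not_dir_base_smul (hY : SmallCancellation A Y) (hW : IsMill A Y W) {c : Set X ⊕ V}
    {x : A} (hxT : x • c ∈ labelTree A Y W)
    (hx : x • W = W) (hx1 : x ≠ 1) : ¬ Dir Y (.inl W) c (x • c) := by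
  rintro ⟨e, he, h1, h2⟩
  have h3 := h1.smul hY x
  have h4 := he.smul hY x
  rw [hx] at h3 h4
  have hxe := beyond_unique hY hW hxT h4 he h3 h2
  obtain ⟨i, hi, hiW⟩ := he.2
  have hxi : x • i ∈ Y e := by
    have := smul_mem_piece hY x (c := .inr e) hi
    rwa [Sum.smul_inr, hxe] at this
  have hxiW : x • i ∈ nbhd W := by
    have : x • i ∈ x • nbhd W := Set.smul_mem_smul_set hiW
    rwa [smul_nbhd hY.isometry, hx] at this
  have b1 := d_le_of_nbhd (hY.convex e) hW.convex (hW.bound e he.1) i ⟨hi, hiW⟩ _ ⟨hxi, hxiW⟩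
  have b2 := hY.disp e x hxe hx1 i hi
  omega

/-- At a member the block product stays in a semigroup without `1`. At a translate of `W` its
conjugate is nontrivial by `prod_ne_one` and preserves `W`. In both cases a nontrivial rotation
displaces more than the width of a direction. -/
theorem IsRotationMill.not_dir_smul (hY : SmallCancellation A Y) {S : V → Set A}
    (hS : RotationFamily S) {v₀ : V} (hW : IsRotationMill Y S v₀ W) {b : Set X ⊕ V}
    (hb : b ∈ labelTree A Y W) (M : List ((Set X ⊕ V) × V × A)) (hne : M ≠ [])
    (hM : ∀ e ∈ M, (e.1 ∈ labelTree A Y W ∧ BelongsTo Y e.2.1 e.1 ∧ e.2.2 ∈ S e.2.1) ∧ e.1 = b)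
    {c : Set X ⊕ V} (hc : c ∈ labelTree A Y W) (hcb : c ≠ b) :
    ¬ Dir Y b c (labelledProd M • c) := by
  have hmill := hW.toIsMill
  have hxH : labelledProd M ∈ growGroup A Y W := labelledProd_mem fun e he =>
    (hM e he).1.2.1.mem_growGroup hY (hM e he).1.1 (hS.smul_eq _ _ (hM e he).1.2.2)
  have hxc := smul_mem_labelTree hY hmill hxH c hc
  rcases b with U | f
  · obtain ⟨g, hg, rfl⟩ := exists_of_inl_mem hb
    have hsub : ∀ e ∈ M, Y (g⁻¹ • e.2.1) ⊆ W := fun e he => by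
      obtain ⟨⟨-, h, -⟩, h'⟩ := hM e he
      rw [h'] at h
      have h : Y e.2.1 ⊆ g • W := h
      rwa [hY.smul_set, ← Set.subset_smul_set_iff]
    set L : List (V × A) := M.map fun e => (g⁻¹ • e.2.1, g⁻¹ * e.2.2 * g) with hL
    have hLS : ∀ e ∈ L, Y e.1 ⊆ W ∧ e.2 ∈ S e.1 := by
      intro e he
      obtain ⟨e', he', rfl⟩ := List.mem_map.1 he
      refine ⟨hsub e' he', ?_⟩
      simpa using hS.conj_mem _ _ (hM e' he').1.2.2 g⁻¹
    have hprod : (L.map Prod.snd).prod = g⁻¹ * labelledProd M * g := by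
      rw [hL, List.map_map]
      clear hM hne hxH hxc hsub hLS hL L
      induction M with
      | nil => simp
      | cons e M ih =>
        rw [List.map_cons, List.prod_cons, ih, labelledProd_cons]
        simp [mul_assoc]
    have h1 := hW.prod_ne_one L (by simpa [hL] using hne) hLS
    have hfix : (L.map Prod.snd).prod • W = W := by
      clear hprod h1
      generalize L = L at hLS
      induction L with
      | nil => simp
      | cons e L ih =>
        rw [List.map_cons, List.prod_cons, mul_smul, ih fun e' he' => hLS e' (by simp [he'])]
        have := hLS e (by simp)
        exact hmill.stab _ this.1 _ (hS.smul_eq _ _ this.2)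
    rw [hprod] at h1 hfix
    intro hdir
    have h2 := hdir.smul hY g⁻¹
    rw [Sum.smul_inl, inv_smul_smul] at h2
    have e1 : g⁻¹ • labelledProd M • c = (g⁻¹ * labelledProd M * g) • (g⁻¹ • c) := by
      simp [mul_smul]
    rw [e1] at h2
    refine not_dir_base_smul hY hmill ?_ hfix h1 h2
    rw [← e1]
    exact smul_mem_labelTree hY hmill (inv_mem hg) _ hxc
  · have hmem : labelledProd M ∈ S f := by
      refine hS.prod_mem (by simpa using hne) fun g hg => ?_
      obtain ⟨e, he, rfl⟩ := List.mem_map.1 hg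
      obtain ⟨⟨-, h, h'⟩, h''⟩ := hM e he
      rw [h''] at h
      rwa [show f = e.2.1 from h]
    refine not_near_smul hY hmill hb hc hcb (hS.smul_eq _ _ hmem) ?_ hxc
    intro h1
    rw [h1] at hmem
    exact hS.one_notMem f hmem

/-- Every factor rotates about the label carrying its member, and the product fixes the root, so
Hurwitz moves bring all factors to the root. Because each factor fixes its own member, equality of
all members with `v₀` can be read backwards through the moves. -/
theorem IsRotationMill.exists_base_list (hY : SmallCancellation A Y) {S : V → Set A}
    (hS : RotationFamily S) {v₀ : V} (hW : IsRotationMill Y S v₀ W) (L : List (V × A))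
    (hL : ∀ e ∈ L, Y e.1 ⊆ grown A Y W ∧ e.2 ∈ S e.1)
    (hprod : (L.map Prod.snd).prod • W = W) :
    ∃ L' : List (V × A), (∀ e ∈ L', Y e.1 ⊆ W ∧ e.2 ∈ S e.1) ∧ L'.length = L.length ∧
      (L'.map Prod.snd).prod = (L.map Prod.snd).prod ∧
      ((∀ e ∈ L', e.1 = v₀) → ∀ e ∈ L, e.1 = v₀) := by
  have hmill := hW.toIsMill
  classical
  have hex : ∀ v, ∃ b, Y v ⊆ grown A Y W → b ∈ labelTree A Y W ∧ BelongsTo Y v b := by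
    intro v
    by_cases hv : Y v ⊆ grown A Y W
    · obtain ⟨b, hb⟩ := exists_belongsTo_of_subset_grown hY hmill hv
      exact ⟨b, fun _ => hb⟩
    · exact ⟨.inr v, fun h => absurd h hv⟩
  choose β hβ using hex
  set K : List ((Set X ⊕ V) × V × A) := L.map fun e => (β e.1, e.1, e.2) with hK
  let p : Set X ⊕ V → V → A → Prop := fun b v g =>
    b ∈ labelTree A Y W ∧ BelongsTo Y v b ∧ g ∈ S v
  have hKp : ∀ e ∈ K, p e.1 e.2.1 e.2.2 := by
    intro e he
    obtain ⟨e', he', rfl⟩ := List.mem_map.1 he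
    obtain ⟨h1, h2⟩ := hβ e'.1 (hL e' he').1
    exact ⟨h1, h2, (hL e' he').2⟩
  have hKprod : labelledProd K = (L.map Prod.snd).prod := by
    rw [labelledProd, hK, List.map_map]; rfl
  have hpH : ∀ b v g, p b v g → g ∈ growGroup A Y W ∧ b ∈ labelTree A Y W ∧ g • b = b := by
    rintro b v g ⟨h1, h2, h3⟩
    have h4 := hS.smul_eq v g h3
    exact ⟨h2.mem_growGroup hY h1 h4, h1, h2.smul_eq hY hmill h1 h4⟩
  have hpc : ∀ b v g, p b v g → ∀ h ∈ growGroup A Y W, p (h • b) (h • v) (h * g * h⁻¹) := by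
    rintro b v g ⟨h1, h2, h3⟩ h hh
    exact ⟨smul_mem_labelTree hY hmill hh b h1, h2.smul hY h, hS.conj_mem v g h3 h⟩
  obtain ⟨K', hKK', hK'⟩ := exists_hurwitz_forall_eq_base (rankedPretree_labelTree hY hmill)
    (p := p) hpH hpc (fun b hb M hne hM c hc hcb => hW.not_dir_smul hY hS hb M hne hM hc hcb)
    hKp (by rw [hKprod, Sum.smul_inl, hprod])
  have hval : ∀ {K''}, Hurwitz K K'' → ∀ e ∈ K'', p e.1 e.2.1 e.2.2 := fun h =>
    Hurwitz.forall_mem (H := growGroup A Y W) (fun b v g h => (hpH b v g h).1) hpc h hKp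
  refine ⟨K'.map fun e => (e.2.1, e.2.2), ?_, ?_, ?_, ?_⟩
  · intro e he
    obtain ⟨e', he', rfl⟩ := List.mem_map.1 he
    obtain ⟨-, h2, h3⟩ := hval hKK' e' he'
    rw [hK' e' he'] at h2
    exact ⟨h2, h3⟩
  · rw [List.length_map, hKK'.length_eq, hK, List.length_map]
  · rw [← hKprod, ← hKK'.prod_eq, List.map_map]; rfl
  · intro h e he
    have := hKK'.forall_label_eq (v₀ := v₀) (fun e he => h (e.2.1, e.2.2)
      (List.mem_map.2 ⟨e, he, rfl⟩)) (fun K'' hK'' e he => hS.smul_eq _ _ (hval hK'' e he).2.2)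
    exact this (β e.1, e.1, e.2) (List.mem_map.2 ⟨e, he, rfl⟩)

theorem IsRotationMill.subset_grown : nbhd W ⊆ grown A Y W :=
  fun _ hp => ⟨_, base_mem_labelTree, hp⟩

theorem IsRotationMill.grown (hY : SmallCancellation A Y) {S : V → Set A}
    (hS : RotationFamily S) {v₀ : V} (hW : IsRotationMill Y S v₀ W) :
    IsRotationMill Y S v₀ (grown A Y W) := by
  have hmill := hW.toIsMill
  have hsub : W ⊆ _root_.grown A Y W := (subset_nbhd W).trans subset_grown
  refine ⟨⟨isConvex_grown hY hmill, hmill.nonempty.mono hsub, ?_, ?_⟩, hW.base_subset.trans hsub,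
    ?_, ?_⟩
  · intro v hv
    refine d_le_of_notMem_labelTree hY hmill (fun h => hv fun p hp => ⟨_, h, hp⟩)
      fun g hg h => hv fun p hp => ?_
    exact ⟨.inl (g • W), smul_mem_labelTree hY hmill hg (.inl W) base_mem_labelTree,
      subset_nbhd _ (h hp)⟩
  · intro v hv g hg
    obtain ⟨b, hb, hvb⟩ := exists_belongsTo_of_subset_grown hY hmill hv
    exact smul_grown hY hmill (hvb.mem_growGroup hY hb hg)
  · intro L hne hL h1
    obtain ⟨L', hL', hlen, hprod, -⟩ := hW.exists_base_list hY hS L hL (by rw [h1, one_smul])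
    refine hW.prod_ne_one L' ?_ hL' (by rw [hprod, h1])
    rw [← List.length_pos_iff] at hne ⊢
    omega
  · intro L hL hv₀
    obtain ⟨L', hL', -, hprod, h⟩ := hW.exists_base_list hY hS L hL
      (hmill.stab v₀ hW.base_subset _ hv₀)
    exact h (hW.eq_base_of_prod L' hL' (by rw [hprod, hv₀]))

/-- Each growth absorbs the neighbourhood of radius one, so finitely many growths reach any
prescribed member. -/
theorem IsRotationMill.exists_superset (hY : SmallCancellation A Y) {S : V → Set A}
    (hS : RotationFamily S) {v₀ : V} (hW : IsRotationMill Y S v₀ W) (v : V) :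
    ∃ W', IsRotationMill Y S v₀ W' ∧ W ⊆ W' ∧ Y v ⊆ W' := by
  obtain ⟨p, hp⟩ := hW.nonempty
  obtain ⟨q, hq⟩ := hY.nonempty v
  obtain ⟨n, hn⟩ : ∃ n, d p q ≤ n := ⟨_, le_rfl⟩
  induction n generalizing W p with
  | zero =>
    by_cases hv : Y v ⊆ W
    · exact ⟨W, hW, subset_rfl, hv⟩
    have he : Attached Y W v := ⟨hv, q, hq, p, hp, by rw [d_comm]; omega⟩
    exact ⟨_, hW.grown hY hS, (subset_nbhd W).trans subset_grown,
      fun x hx => ⟨_, he.mem_labelTree, hx⟩⟩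
  | succ n ih =>
    rcases Nat.eq_zero_or_pos (d p q) with h0 | h0
    · exact ih hW p hp (by omega)
    obtain ⟨z, hz1, hz2⟩ := exists_between p q 1 h0
    obtain ⟨W', h1, h2, h3⟩ := ih (hW.grown hY hS) z
      (subset_grown ⟨p, hp, by rw [d_comm]; omega⟩) (by omega)
    exact ⟨W', h1, ((subset_nbhd W).trans subset_grown).trans h2, h3⟩

/-- If a product of elements of a rotation family over members of a small cancellation family
stabilizes a member, then all members in it are equal to that one. -/
theorem RotationFamily.eq_of_prod_smul_eq (hY : SmallCancellation A Y) {S : V → Set A}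
    (hS : RotationFamily S) {v₀ : V} (L : List (V × A)) (hL : ∀ e ∈ L, e.2 ∈ S e.1)
    (h : (L.map Prod.snd).prod • v₀ = v₀) : ∀ e ∈ L, e.1 = v₀ := by
  have hex : ∀ K : List (V × A), ∃ W, IsRotationMill Y S v₀ W ∧ ∀ e ∈ K, Y e.1 ⊆ W := by
    intro K
    induction K with
    | nil => exact ⟨_, isRotationMill_base hY hS v₀, by simp⟩
    | cons e K ih =>
      obtain ⟨W, hW, hK⟩ := ih
      obtain ⟨W', hW', h1, h2⟩ := hW.exists_superset hY hS e.1
      refine ⟨W', hW', fun e' he' => ?_⟩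
      rcases List.mem_cons.1 he' with rfl | he'
      · exact h2
      · exact (hK e' he').trans h1
  obtain ⟨W, hW, hLW⟩ := hex L
  exact hW.eq_base_of_prod L (fun e he => ⟨hLW e he, hL e he⟩) h

end Windmill

/-- A subgroup whose cosets index a small cancellation family is multi-malnormal. -/
theorem SmallCancellation.isMultiMalnormal {A X : Type*} [Group A] [MulAction A X] [TreeMetric X]
    {C : Subgroup A} {Y : A ⧸ C → Set X} (hY : SmallCancellation A Y) : IsMultiMalnormal C := by
  intro P hP h1P n hn c a hc ha hmem
  have : NeZero n := ⟨by omega⟩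
  -- All representatives of the coset are allowed; normality of `P` in `C` lets products with
  -- different representatives be rewritten with one.
  let S : A ⧸ C → Set A := fun v => {g | ∃ x : A, ∃ p ∈ P, v = (x : A ⧸ C) ∧ g = x * p * x⁻¹}
  have hS : RotationFamily S := by
    refine ⟨?_, ?_, ?_, ?_⟩
    · rintro _ _ ⟨x, p, -, rfl, rfl⟩
      rw [MulAction.Quotient.smul_coe, smul_eq_mul, QuotientGroup.eq]
      simp
    · rintro _ _ ⟨x, p, hp, rfl, rfl⟩ h
      exact ⟨h * x, p, hp, rfl, by simp [mul_assoc]⟩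
    · rintro _ _ ⟨x, p, hp, rfl, rfl⟩ _ ⟨x', p', hp', h, rfl⟩
      rw [QuotientGroup.eq] at h
      set y : C := ⟨x⁻¹ * x', h⟩ with hy
      have hx' : x' = x * y := by simp [hy]
      refine ⟨x, p * (y * p' * y⁻¹), P.mul_mem hp ?_, rfl, ?_⟩
      · simpa using hP p' hp' y⁻¹
      · rw [hx']
        push_cast
        simp [mul_assoc]
    · rintro _ ⟨x, p, hp, rfl, h⟩
      have : (p : A) = 1 := by
        have h' : x * p * x⁻¹ = 1 := h.symm
        rwa [mul_inv_eq_one, mul_eq_left] at h'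
      rw [OneMemClass.coe_eq_one] at this
      exact h1P (this ▸ hp)
  have key := hS.eq_of_prod_smul_eq hY (v₀ := ((1 : A) : A ⧸ C))
    (List.ofFn fun i => ((((a i)⁻¹ : A) : A ⧸ C), (a i)⁻¹ * (c i : A) * a i)) (by
      intro e he
      obtain ⟨i, rfl⟩ := List.mem_ofFn.1 he
      exact ⟨(a i)⁻¹, c i, hc i, rfl, by simp⟩) (by
      rw [List.map_ofFn, MulAction.Quotient.smul_coe, smul_eq_mul, mul_one]
      symm
      rw [QuotientGroup.eq]
      simpa [Function.comp_def] using hmem)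
  -- One factor suffices: its coset being that of `1` already puts `a 0` into `C`.
  have h0 := key _ (List.mem_ofFn.2 ⟨0, rfl⟩)
  simp only at h0
  rw [QuotientGroup.eq] at h0
  exact ha 0 (by simpa using h0)

/-! ### Rooted trees given by lists of edge labels. -/

/-- The length of the longest common prefix of two lists. -/
noncomputable def List.commonPrefixLength {Λ : Type*} : List Λ → List Λ → ℕ
  | [], _ => 0
  | _ :: _, [] => 0
  | a :: l, b :: l' => open Classical in if a = b then l.commonPrefixLength l' + 1 else 0

namespace List

variable {Λ : Type*}

@[simp] theorem commonPrefixLength_nil_left (l : List Λ) : commonPrefixLength [] l = 0 := by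
  simp [commonPrefixLength]

@[simp] theorem commonPrefixLength_nil_right (l : List Λ) : commonPrefixLength l [] = 0 := by
  cases l <;> simp [commonPrefixLength]

@[simp] theorem commonPrefixLength_cons_self (a : Λ) (l l' : List Λ) :
    commonPrefixLength (a :: l) (a :: l') = commonPrefixLength l l' + 1 := by
  simp [commonPrefixLength]

theorem commonPrefixLength_cons_of_ne {a b : Λ} (h : a ≠ b) (l l' : List Λ) :
    commonPrefixLength (a :: l) (b :: l') = 0 := by
  simp [commonPrefixLength, h]

theorem commonPrefixLength_comm (l l' : List Λ) :
    commonPrefixLength l l' = commonPrefixLength l' l := by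
  induction l generalizing l' with
  | nil => simp
  | cons a l ih =>
    cases l' with
    | nil => simp
    | cons b l' =>
      simp only [commonPrefixLength, ih l']
      by_cases h : a = b
      · simp [h]
      · simp [h, Ne.symm h]

theorem commonPrefixLength_le_left (l l' : List Λ) : commonPrefixLength l l' ≤ l.length := by
  induction l generalizing l' with
  | nil => simp
  | cons a l ih =>
    cases l' with
    | nil => simp
    | cons b l' =>
      have := ih l'
      simp only [commonPrefixLength]
      split_ifs <;> grind

theorem commonPrefixLength_le_right (l l' : List Λ) : commonPrefixLength l l' ≤ l'.length :=
  commonPrefixLength_comm l l' ▸ commonPrefixLength_le_left l' l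

/-- This ultrametric inequality for Gromov products at the root yields both the triangle inequality
and the four-point condition. -/
theorem min_commonPrefixLength_le (l₁ l₂ l₃ : List Λ) :
    min (commonPrefixLength l₁ l₂) (commonPrefixLength l₂ l₃) ≤ commonPrefixLength l₁ l₃ := by
  induction l₁ generalizing l₂ l₃ with
  | nil => simp
  | cons a l ih =>
    cases l₂ with
    | nil => simp
    | cons b l₂ =>
      cases l₃ with
      | nil => simp
      | cons c l₃ =>
        have := ih l₂ l₃
        simp only [commonPrefixLength]
        split_ifs <;> first | omega | simp_all

theorem commonPrefixLength_take (n : ℕ) (l l' : List Λ) :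
    commonPrefixLength (l.take n) l' = min n (commonPrefixLength l l') := by
  induction l generalizing l' n with
  | nil => simp
  | cons a l ih =>
    cases n with
    | zero => simp
    | succ n =>
      cases l' with
      | nil => simp
      | cons b l' =>
        simp only [commonPrefixLength, take_succ_cons, ih]
        split_ifs <;> omega

@[simp] theorem commonPrefixLength_self (l : List Λ) : commonPrefixLength l l = l.length := by
  induction l with
  | nil => simp
  | cons a l ih => simp [ih]

theorem take_commonPrefixLength (l l' : List Λ) :
    l.take (commonPrefixLength l l') = l'.take (commonPrefixLength l l') := by
  induction l generalizing l' with
  | nil => simp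
  | cons a l ih =>
    cases l' with
    | nil => simp
    | cons b l' =>
      have := ih l'
      simp only [commonPrefixLength]
      split_ifs with h
      · simp [h, this]
      · simp

end List

section Labels

variable {X Λ : Type*} (L : X → List Λ)

theorem exists_label_eq_take (hL : ∀ x, L x ≠ [] → ∃ y u, L x = L y ++ [u]) (x : X) (n : ℕ) :
    ∃ y, L y = (L x).take n := by
  induction hk : (L x).length using Nat.strong_induction_on generalizing x with
  | _ k ih =>
    by_cases h : n < (L x).length
    · obtain ⟨y, u, hy⟩ := hL x (by rintro h0; simp [h0] at h)
      obtain ⟨z, hz⟩ := ih (L y).length (by rw [← hk, hy]; simp) y rfl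
      refine ⟨z, ?_⟩
      rw [hz, hy, List.take_append_of_le_length]
      rw [hy] at h
      simp at h
      omega
    · exact ⟨x, by rw [List.take_of_length_le (by omega)]⟩

/-- The tree-like distance of a rooted tree in which every node is labelled by the list of edge
labels on the way from the root. -/
noncomputable abbrev TreeMetric.ofLabels (hL : ∀ x, L x ≠ [] → ∃ y u, L x = L y ++ [u]) :
    TreeMetric X where
  d x y := (L x).length + (L y).length - 2 * (L x).commonPrefixLength (L y)
  d_self x := by simp; omega
  d_comm x y := by rw [List.commonPrefixLength_comm]; omega
  d_triangle x y z := by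
    have h1 := List.min_commonPrefixLength_le (L x) (L y) (L z)
    have h2 := List.commonPrefixLength_le_left (L y) (L z)
    have h3 := List.commonPrefixLength_le_right (L x) (L y)
    have h4 := List.commonPrefixLength_le_left (L x) (L y)
    have h5 := List.commonPrefixLength_le_right (L y) (L z)
    omega
  four_point x y z w := by
    have a1 := List.commonPrefixLength_le_left (L x) (L y)
    have a2 := List.commonPrefixLength_le_right (L x) (L y)
    have b1 := List.commonPrefixLength_le_left (L z) (L w)
    have b2 := List.commonPrefixLength_le_right (L z) (L w)
    have c1 := List.commonPrefixLength_le_left (L x) (L z)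
    have c2 := List.commonPrefixLength_le_right (L x) (L z)
    have d1 := List.commonPrefixLength_le_left (L y) (L w)
    have d2 := List.commonPrefixLength_le_right (L y) (L w)
    have e1 := List.commonPrefixLength_le_left (L x) (L w)
    have e2 := List.commonPrefixLength_le_right (L x) (L w)
    have f1 := List.commonPrefixLength_le_left (L y) (L z)
    have f2 := List.commonPrefixLength_le_right (L y) (L z)
    have h1 := List.min_commonPrefixLength_le (L x) (L z) (L y)
    have h2 := List.min_commonPrefixLength_le (L x) (L w) (L y)
    have h3 := List.min_commonPrefixLength_le (L z) (L x) (L w)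
    have h4 := List.min_commonPrefixLength_le (L z) (L y) (L w)
    rw [List.commonPrefixLength_comm (L z) (L y)] at h1 h4
    rw [List.commonPrefixLength_comm (L w) (L y)] at h2
    rw [List.commonPrefixLength_comm (L z) (L x)] at h3
    omega
  exists_between x y n hn := by
    have a1 := List.commonPrefixLength_le_left (L x) (L y)
    have a2 := List.commonPrefixLength_le_right (L x) (L y)
    by_cases h : n ≤ (L x).length - (L x).commonPrefixLength (L y)
    · obtain ⟨z, hz⟩ := exists_label_eq_take L hL x ((L x).length - n)
      refine ⟨z, ?_⟩
      rw [hz, List.commonPrefixLength_comm (L x) (List.take _ _), List.commonPrefixLength_take,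
        List.commonPrefixLength_take, List.commonPrefixLength_self, List.length_take]
      omega
    · obtain ⟨z, hz⟩ := exists_label_eq_take L hL y
        ((L x).commonPrefixLength (L y) +
          (n - ((L x).length - (L x).commonPrefixLength (L y))))
      refine ⟨z, ?_⟩
      rw [hz, List.commonPrefixLength_comm (L x) (List.take _ _), List.commonPrefixLength_take,
        List.commonPrefixLength_take, List.commonPrefixLength_self, List.length_take,
        List.commonPrefixLength_comm (L y)]
      omega
  even_perimeter x y z := by
    have a1 := List.commonPrefixLength_le_left (L x) (L y)
    have a2 := List.commonPrefixLength_le_right (L x) (L y)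
    have b1 := List.commonPrefixLength_le_left (L x) (L z)
    have b2 := List.commonPrefixLength_le_right (L x) (L z)
    have c1 := List.commonPrefixLength_le_left (L y) (L z)
    have c2 := List.commonPrefixLength_le_right (L y) (L z)
    omega

end Labels

/-- Geodesics consist of unit steps, so a map is nonexpanding once it is so on pairs at distance 0
or 1. -/
theorem TreeMetric.d_le_of_steps {X : Type*} [TreeMetric X] (f : X → X)
    (h0 : ∀ x y, d x y = 0 → d (f x) (f y) = 0) (h1 : ∀ x y, d x y = 1 → d (f x) (f y) ≤ 1)
    (x y : X) : d (f x) (f y) ≤ d x y := by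
  induction hn : d x y generalizing y with
  | zero => exact (h0 x y hn).le
  | succ n ih =>
    obtain ⟨z, hz1, hz2⟩ := exists_between x y n (by omega)
    have := ih z hz1
    have := h1 z y (by omega)
    have := d_triangle (f x) (f z) (f y)
    omega

/-! ### The Bass–Serre tree of the free group. -/

/-- The points of the Bass–Serre tree of the free group as the free product of the cyclic groups
generated by its free generators. The point `(g, some t)` is the vertex of the coset of `g` modulo
the powers of the generator `t`, and `(g, none)` is the central vertex attached to `g`. -/
def SyllableTree (ι : Type*) : Type _ := FreeGroup ι × Option ι

namespace SyllableTree

open Monoid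

variable {ι : Type*}

/-- The central vertex attached to a group element. -/
def center (g : FreeGroup ι) : SyllableTree ι := (g, none)

/-- The vertex of a coset of a cyclic factor. -/
def vertex (t : ι) (g : FreeGroup ι) : SyllableTree ι := (g, some t)

instance : MulAction (FreeGroup ι) (SyllableTree ι) where
  smul g x := (g * x.1, x.2)
  one_smul _ := Prod.ext (one_mul _) rfl
  mul_smul _ _ _ := Prod.ext (mul_assoc _ _ _) rfl

@[simp] theorem smul_center (g h : FreeGroup ι) : g • center h = center (g * h) := rfl

@[simp] theorem smul_vertex (t : ι) (g h : FreeGroup ι) : g • vertex t h = vertex t (g * h) := rfl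

theorem cases (x : SyllableTree ι) : (∃ g, x = center g) ∨ ∃ t g, x = vertex t g := by
  rcases x with ⟨g, _ | t⟩
  · exact Or.inl ⟨g, rfl⟩
  · exact Or.inr ⟨t, g, rfl⟩

/-- The free group is the free product of infinite cyclic groups. -/
def toCoprod : FreeGroup ι ≃* CoprodI fun _ : ι => Multiplicative ℤ :=
  MonoidHom.toMulEquiv
    (FreeGroup.lift fun t => CoprodI.of (i := t) (Multiplicative.ofAdd 1))
    (CoprodI.lift fun t => zpowersHom _ (FreeGroup.of t))
    (by ext t; simp)
    (by ext t; simp)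

theorem toCoprod_of_zpow (t : ι) (n : ℤ) :
    toCoprod (FreeGroup.of t ^ n) = CoprodI.of (i := t) (Multiplicative.ofAdd n) := by
  rw [map_zpow]
  have : toCoprod (FreeGroup.of t) =
      CoprodI.of (M := fun _ : ι => Multiplicative ℤ) (i := t) (Multiplicative.ofAdd 1) := by
    simp [toCoprod]
  rw [this, ← map_zpow, ← ofAdd_zsmul]
  simp

variable [DecidableEq ι]

/-- The normal form of the inverse of a group element. -/
def invWord (g : FreeGroup ι) : CoprodI.Word fun _ : ι => Multiplicative ℤ :=
  CoprodI.Word.equiv (toCoprod g⁻¹)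

theorem prod_invWord (g : FreeGroup ι) : (invWord g).prod = toCoprod g⁻¹ :=
  CoprodI.Word.equiv.symm_apply_apply _

theorem invWord_eq_iff (g : FreeGroup ι) (w : CoprodI.Word fun _ : ι => Multiplicative ℤ) :
    invWord g = w ↔ toCoprod g⁻¹ = w.prod := by
  rw [invWord, ← Equiv.eq_symm_apply]
  rfl

theorem invWord_injective : Function.Injective (invWord (ι := ι)) := fun g h e => by
  simpa [invWord] using e

/-- Inversion turns right multiplication, which moves within a coset, into the left action on normal
forms, which changes only the head. -/
theorem invWord_mul_zpow (g : FreeGroup ι) (t : ι) (n : ℤ) :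
    invWord (g * FreeGroup.of t ^ n) =
      CoprodI.of (M := fun _ : ι => Multiplicative ℤ) (i := t) (Multiplicative.ofAdd (-n)) •
        invWord g := by
  rw [invWord_eq_iff, CoprodI.Word.prod_smul, prod_invWord, mul_inv_rev, map_mul, ← zpow_neg,
    toCoprod_of_zpow]

/-- The labels on the path that spells a normal form. -/
def path (l : List (Σ _ : ι, Multiplicative ℤ)) : List (ι ⊕ Σ _ : ι, Multiplicative ℤ) :=
  l.reverse.flatMap fun e => [Sum.inl e.1, Sum.inr e]

@[simp] theorem path_nil : path ([] : List (Σ _ : ι, Multiplicative ℤ)) = [] := rfl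

theorem path_cons (e : Σ _ : ι, Multiplicative ℤ) (l : List (Σ _ : ι, Multiplicative ℤ)) :
    path (e :: l) = path l ++ [Sum.inl e.1, Sum.inr e] := by
  simp [path]

theorem path_injective : Function.Injective (path (ι := ι)) := by
  intro l
  induction l with
  | nil =>
    intro l' h
    cases l' with
    | nil => rfl
    | cons e l' => simp [path_cons] at h
  | cons e l ih =>
    intro l' h
    cases l' with
    | nil => simp [path_cons] at h
    | cons e' l' =>
      rw [path_cons, path_cons] at h
      obtain ⟨h1, h2⟩ := List.append_inj' h rfl
      simp at h2
      rw [ih h1, h2.2]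

/-- The labels on the path from the central vertex of `1` to a vertex. -/
def label : SyllableTree ι → List (ι ⊕ Σ _ : ι, Multiplicative ℤ)
  | (g, none) => path (invWord g).toList
  | (g, some t) => path (CoprodI.Word.equivPair t (invWord g)).tail.toList ++ [Sum.inl t]

theorem label_center (g : FreeGroup ι) : label (center g) = path (invWord g).toList := rfl

theorem label_vertex (t : ι) (g : FreeGroup ι) : label (vertex t g) =
    path (CoprodI.Word.equivPair t (invWord g)).tail.toList ++ [Sum.inl t] := rfl

@[simp] theorem label_center_one : label (center (1 : FreeGroup ι)) = [] := by
  have : invWord (1 : FreeGroup ι) = CoprodI.Word.empty := by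
    rw [invWord_eq_iff]
    simp
  rw [label_center, this]
  rfl

theorem label_vertex_mul_zpow (t : ι) (g : FreeGroup ι) (n : ℤ) :
    label (vertex t (g * FreeGroup.of t ^ n)) = label (vertex t g) := by
  rw [label_vertex, label_vertex, invWord_mul_zpow, CoprodI.Word.equivPair_smul_same]

theorem label_step (t : ι) (g : FreeGroup ι) :
    label (vertex t g) = label (center g) ++ [Sum.inl t] ∨
      ∃ u, label (center g) = label (vertex t g) ++ [u] := by
  rw [label_center, label_vertex]
  have h : CoprodI.Word.rcons (CoprodI.Word.equivPair t (invWord g)) = invWord g :=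
    (CoprodI.Word.equivPair t).symm_apply_apply _
  rw [CoprodI.Word.rcons] at h
  split_ifs at h with h1
  · left
    rw [h]
  · right
    nth_rw 1 [← h]
    exact ⟨_, by rw [CoprodI.Word.cons_toList, path_cons, List.append_assoc]; rfl⟩

theorem exists_label_center_parent (g : FreeGroup ι) (hg : label (center g) ≠ []) :
    ∃ t u, label (center g) = label (vertex t g) ++ [u] := by
  rw [label_center] at hg ⊢
  cases hw : invWord g using CoprodI.Word.consRecOn with
  | empty => simp [hw] at hg
  | cons t m w h1 h2 =>
    refine ⟨t, Sum.inr ⟨t, m⟩, ?_⟩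
    rw [label_vertex, hw, CoprodI.Word.cons_eq_smul, CoprodI.Word.equivPair_smul_same,
      ← CoprodI.Word.cons_eq_smul (h1 := h1) (h2 := h2),
      CoprodI.Word.equivPair_eq_of_fstIdx_ne h1, CoprodI.Word.cons_toList, path_cons]
    simp

theorem exists_label_vertex_parent (t : ι) (g : FreeGroup ι) :
    ∃ n : ℤ, label (vertex t g) = label (center (g * FreeGroup.of t ^ n)) ++ [Sum.inl t] := by
  -- The head is the leading `t`-syllable of `g⁻¹`, possibly trivial; this power cancels the last
  -- `t`-syllable of `g`.
  refine ⟨Multiplicative.toAdd (CoprodI.Word.equivPair t (invWord g)).head, ?_⟩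
  rw [label_vertex, label_center, invWord_mul_zpow, CoprodI.Word.equivPair_tail_eq_inv_smul,
    ofAdd_neg, ofAdd_toAdd, map_inv]

theorem label_parent (x : SyllableTree ι) (hx : label x ≠ []) :
    ∃ y u, label x = label y ++ [u] := by
  rcases cases x with ⟨g, rfl⟩ | ⟨t, g, rfl⟩
  · obtain ⟨t, u, h⟩ := exists_label_center_parent g hx
    exact ⟨_, u, h⟩
  · obtain ⟨n, h⟩ := exists_label_vertex_parent t g
    exact ⟨_, _, h⟩

theorem label_center_inj {g h : FreeGroup ι} (e : label (center g) = label (center h)) : g = h :=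
  invWord_injective (CoprodI.Word.ext (path_injective e))

theorem label_center_ne_vertex (g h : FreeGroup ι) (t : ι) :
    label (center g) ≠ label (vertex t h) := by
  intro e
  by_cases h0 : label (center g) = []
  · rw [h0, label_vertex] at e
    simp at e
  rw [label_center, label_vertex] at e
  rw [label_center] at h0
  rcases hl : (invWord g).toList with _ | ⟨a, l⟩
  · simp [hl] at h0
  · rw [hl, path_cons] at e
    have := congrArg List.getLast? e
    simp at this

theorem label_vertex_inj {t t' : ι} {g h : FreeGroup ι}
    (e : label (vertex t g) = label (vertex t' h)) :
    t = t' ∧ ∃ n : ℤ, h = g * FreeGroup.of t ^ n := by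
  obtain ⟨n, hn⟩ := exists_label_vertex_parent t g
  obtain ⟨n', hn'⟩ := exists_label_vertex_parent t' h
  rw [hn, hn'] at e
  obtain ⟨h1, h2⟩ := List.append_inj' e rfl
  have h3 := label_center_inj h1
  simp at h2
  subst h2
  refine ⟨rfl, n - n', ?_⟩
  rw [zpow_sub, ← mul_assoc, h3]
  simp

noncomputable instance : TreeMetric (SyllableTree ι) := TreeMetric.ofLabels label label_parent

theorem d_def (x y : SyllableTree ι) : d x y = (label x).length + (label y).length -
    2 * (label x).commonPrefixLength (label y) := rfl

theorem d_eq_zero_iff {x y : SyllableTree ι} : d x y = 0 ↔ label x = label y := by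
  constructor
  · intro h
    rw [d_def] at h
    have h1 := List.commonPrefixLength_le_left (label x) (label y)
    have h2 := List.commonPrefixLength_le_right (label x) (label y)
    have := List.take_commonPrefixLength (label x) (label y)
    rwa [List.take_of_length_le (by omega), List.take_of_length_le (by omega)] at this
  · intro h
    rw [d_def, h, List.commonPrefixLength_self]
    omega

theorem d_eq_of_d_eq_zero {x x' : SyllableTree ι} (h : d x x' = 0) (y : SyllableTree ι) :
    d x y = d x' y := by
  rw [d_def, d_def, d_eq_zero_iff.1 h]

theorem d_eq_one_of_label {x y : SyllableTree ι} {u : ι ⊕ Σ _ : ι, Multiplicative ℤ}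
    (h : label y = label x ++ [u]) : d x y = 1 := by
  have : label x = (label y).take (label x).length := by simp [h]
  have h2 : (label x).commonPrefixLength (label y) = (label x).length := by
    conv_lhs => rw [this]
    rw [List.commonPrefixLength_take, List.commonPrefixLength_self, h]
    simp
  rw [d_def, h2, h]
  simp
  omega

theorem label_of_d_eq_one {x y : SyllableTree ι} (hd : d x y = 1) :
    (∃ u, label y = label x ++ [u]) ∨ ∃ u, label x = label y ++ [u] := by
  rw [d_def] at hd
  have h1 := List.commonPrefixLength_le_left (label x) (label y)
  have h2 := List.commonPrefixLength_le_right (label x) (label y)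
  have h3 := List.take_commonPrefixLength (label x) (label y)
  by_cases h : (label x).length < (label y).length
  · left
    rw [List.take_of_length_le (by omega)] at h3
    have h4 := List.take_append_drop ((label x).commonPrefixLength (label y)) (label y)
    rw [← h3] at h4
    obtain ⟨u, hu⟩ := List.length_eq_one_iff.1
      (show ((label y).drop ((label x).commonPrefixLength (label y))).length = 1 by
        rw [List.length_drop]; omega)
    exact ⟨u, by rw [← h4, hu]⟩
  · right
    rw [List.take_of_length_le (l := label y) (by omega)] at h3
    have h4 := List.take_append_drop ((label x).commonPrefixLength (label y)) (label x)
    rw [h3] at h4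
    obtain ⟨u, hu⟩ := List.length_eq_one_iff.1
      (show ((label x).drop ((label x).commonPrefixLength (label y))).length = 1 by
        rw [List.length_drop]; omega)
    exact ⟨u, by rw [← h4, hu]⟩

theorem d_center_vertex (t : ι) (g : FreeGroup ι) : d (center g) (vertex t g) = 1 := by
  rcases label_step t g with h | ⟨u, h⟩
  · exact d_eq_one_of_label h
  · rw [d_comm]
    exact d_eq_one_of_label h

theorem d_vertex_mul_zpow (t : ι) (g : FreeGroup ι) (n : ℤ) :
    d (vertex t g) (vertex t (g * FreeGroup.of t ^ n)) = 0 :=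
  d_eq_zero_iff.2 (label_vertex_mul_zpow t g n).symm

theorem smul_d_eq_zero (g : FreeGroup ι) {x y : SyllableTree ι} (h : d x y = 0) :
    d (g • x) (g • y) = 0 := by
  rw [d_eq_zero_iff] at h
  rcases cases x with ⟨a, rfl⟩ | ⟨t, a, rfl⟩ <;> rcases cases y with ⟨b, rfl⟩ | ⟨t', b, rfl⟩
  · rw [label_center_inj h, d_self]
  · exact absurd h (label_center_ne_vertex a b t')
  · exact absurd h.symm (label_center_ne_vertex b a t)
  · obtain ⟨rfl, n, rfl⟩ := label_vertex_inj h
    rw [smul_vertex, smul_vertex, ← mul_assoc]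
    exact d_vertex_mul_zpow t _ n

theorem exists_of_d_eq_one {x y : SyllableTree ι} (h : d x y = 1) :
    ∃ t g, d x (center g) = 0 ∧ d y (vertex t g) = 0 ∨ d y (center g) = 0 ∧
      d x (vertex t g) = 0 := by
  wlog hl : ∃ u, label y = label x ++ [u] generalizing x y
  · obtain ⟨t, g, h'⟩ := this (x := y) (y := x) (by rwa [d_comm])
      ((label_of_d_eq_one h).resolve_left hl)
    exact ⟨t, g, h'.symm⟩
  obtain ⟨u, hu⟩ := hl
  rcases cases y with ⟨b, rfl⟩ | ⟨t, b, rfl⟩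
  · obtain ⟨t, v, hv⟩ := exists_label_center_parent b (by simp [hu])
    rw [hu] at hv
    exact ⟨t, b, Or.inr ⟨d_self _, d_eq_zero_iff.2 (List.append_inj' hv rfl).1⟩⟩
  · obtain ⟨n, hn⟩ := exists_label_vertex_parent t b
    rw [hu] at hn
    exact ⟨t, _, Or.inl ⟨d_eq_zero_iff.2 (List.append_inj' hn rfl).1, d_vertex_mul_zpow t b n⟩⟩

theorem smul_d_eq_one (g : FreeGroup ι) {x y : SyllableTree ι} (h : d x y = 1) :
    d (g • x) (g • y) = 1 := by
  obtain ⟨t, a, ⟨h1, h2⟩ | ⟨h1, h2⟩⟩ := exists_of_d_eq_one h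
  · rw [d_eq_of_d_eq_zero (smul_d_eq_zero g h1), d_comm, d_eq_of_d_eq_zero (smul_d_eq_zero g h2),
      d_comm]
    exact d_center_vertex t _
  · rw [d_eq_of_d_eq_zero (smul_d_eq_zero g h2), d_comm, d_eq_of_d_eq_zero (smul_d_eq_zero g h1)]
    exact d_center_vertex t _

/-- The labels depend on the root, but adjacency is described by cosets and is invariant. Hence `g`
and `g⁻¹` are both nonexpanding. -/
theorem d_smul_smul (g : FreeGroup ι) (x y : SyllableTree ι) : d (g • x) (g • y) = d x y := by
  have key : ∀ (g : FreeGroup ι) (x y : SyllableTree ι), d (g • x) (g • y) ≤ d x y := fun g =>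
    d_le_of_steps (g • ·) (fun x y h => smul_d_eq_zero g h) fun x y h => (smul_d_eq_one g h).le
  refine le_antisymm (key g x y) ?_
  simpa using key g⁻¹ (g • x) (g • y)

theorem exists_zpow_of_d_eq_one {t : ι} {g h : FreeGroup ι} (hd : d (center g) (vertex t h) = 1) :
    ∃ n : ℤ, h = g * FreeGroup.of t ^ n := by
  obtain ⟨t', a, ⟨h1, h2⟩ | ⟨h1, h2⟩⟩ := exists_of_d_eq_one hd
  · rw [d_eq_zero_iff] at h1 h2
    obtain ⟨rfl, n, rfl⟩ := label_vertex_inj h2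
    rw [label_center_inj h1]
    exact ⟨-n, by simp⟩
  · rw [d_eq_zero_iff] at h1
    exact absurd h1.symm (label_center_ne_vertex _ _ _)

theorem label_center_prod (l : List (Σ _ : ι, ℤ)) (h0 : ∀ e ∈ l, e.2 ≠ 0)
    (hl : l.IsChain fun e e' => e.1 ≠ e'.1) :
    label (center (l.map fun e => FreeGroup.of e.1 ^ e.2).prod) =
      l.flatMap fun e => [Sum.inl e.1, Sum.inr ⟨e.1, Multiplicative.ofAdd (-e.2)⟩] := by
  let w : CoprodI.Word fun _ : ι => Multiplicative ℤ :=
    { toList := (l.map fun e => ⟨e.1, Multiplicative.ofAdd (-e.2)⟩).reverse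
      ne_one := by
        intro e he
        simp only [List.mem_reverse, List.mem_map] at he
        obtain ⟨e, he, rfl⟩ := he
        simpa using h0 e he
      chain_ne := by
        rw [List.isChain_reverse, List.isChain_map]
        exact hl.imp fun a b h => Ne.symm h }
  have hw : invWord (l.map fun e => FreeGroup.of e.1 ^ e.2).prod = w := by
    rw [invWord_eq_iff, List.prod_inv_reverse, map_list_prod, CoprodI.Word.prod]
    simp only [w, List.map_reverse, List.map_map]
    congr 2
    refine List.map_congr_left fun e _ => ?_
    simp only [Function.comp]
    rw [← zpow_neg, toCoprod_of_zpow]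
  rw [label_center, hw, path]
  simp [w, List.flatMap_map]

end SyllableTree

open SyllableTree

/-! ### Displacement of reduced words in letters with short overlaps. -/

section Displacement

variable {A X : Type*} [Group A] [MulAction A X] [TreeMetric X]

theorem TreeMetric.d_pow_smul_le (hA : ∀ (g : A) (x y : X), d (g • x) (g • y) = d x y) (g : A)
    (p : X) (n : ℕ) : d p (g ^ n • p) ≤ n * d p (g • p) := by
  induction n with
  | zero => simp [d_self]
  | succ n ih =>
    have h1 := d_triangle p (g ^ n • p) (g ^ (n + 1) • p)
    rw [pow_succ, mul_smul, hA] at h1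
    rw [pow_succ, mul_smul]
    linarith

theorem TreeMetric.le_d_smul_of_stable (hA : ∀ (g : A) (x y : X), d (g • x) (g • y) = d x y)
    (g : A) (o : X) (K : ℕ) (h : ∀ n : ℕ, n * K ≤ d o (g ^ n • o)) (p : X) :
    K ≤ d p (g • p) := by
  by_contra! hlt
  -- Replacing `o` by `p` costs at most `2 * d o p` in total, less than a deficit of one per step
  -- over this many steps.
  have h1 := h (2 * d o p + 1)
  have h2 := d_pow_smul_le hA g p (2 * d o p + 1)
  have h3 := d_triangle o p (g ^ (2 * d o p + 1) • o)
  have h4 := d_triangle p (g ^ (2 * d o p + 1) • p) (g ^ (2 * d o p + 1) • o)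
  rw [hA, d_comm p o] at h4
  nlinarith

theorem FreeGroup.lift_mk_cons {α G : Type*} [Group G] (f : α → G) (e : α × Bool)
    (l : List (α × Bool)) :
    FreeGroup.lift f (FreeGroup.mk (e :: l)) =
      FreeGroup.lift f (FreeGroup.mk [e]) * FreeGroup.lift f (FreeGroup.mk l) := by
  rw [← _root_.map_mul, FreeGroup.mul_mk]
  rfl

theorem FreeGroup.lift_mk_singleton_not {α G : Type*} [Group G] (f : α → G) (e : α × Bool) :
    FreeGroup.lift f (FreeGroup.mk [(e.1, !e.2)]) = (FreeGroup.lift f (FreeGroup.mk [e]))⁻¹ := by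
  rw [← _root_.map_inv]
  simp [FreeGroup.inv_mk, FreeGroup.invRev]

/-- Words in elements that have large translation length and small overlaps move the base point
far. -/
theorem FreeGroup.IsReduced.le_d_smul {α : Type*}
    (hA : ∀ (g : A) (x y : X), d (g • x) (g • y) = d x y)
    (f : α → A) (o : X) (N : ℕ) (hN : 3 ≤ N)
    (hlen : ∀ e : α × Bool, d o (FreeGroup.lift f (FreeGroup.mk [e]) • o) = N)
    (hover : ∀ e e' : α × Bool, e ≠ e' → 2 * N ≤
      d (FreeGroup.lift f (FreeGroup.mk [e]) • o) (FreeGroup.lift f (FreeGroup.mk [e']) • o) + 2)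
    (l : List (α × Bool)) (hl : FreeGroup.IsReduced l) :
    l.length * (N - 2) ≤ d o (FreeGroup.lift f (FreeGroup.mk l) • o) := by
  -- The second inequality says that the geodesic from `o` to its image shares at least `N - 1`
  -- steps with the one belonging to the first letter. This exceeds 1, the overlap allowed for
  -- different letters, because `N ≥ 3`.
  suffices key : ∀ e l, FreeGroup.IsReduced (e :: l) →
      (l.length + 1) * (N - 2) ≤ d o (FreeGroup.lift f (FreeGroup.mk (e :: l)) • o) ∧
      N + d (FreeGroup.lift f (FreeGroup.mk (e :: l)) • o) (FreeGroup.lift f (FreeGroup.mk [e]) • o)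
        ≤ d o (FreeGroup.lift f (FreeGroup.mk (e :: l)) • o) + 2 by
    cases l with
    | nil => simp
    | cons e l => exact (key e l hl).1
  intro e l
  induction l generalizing e with
  | nil =>
    intro _
    rw [hlen, d_self]
    simp
  | cons f' l ih =>
    intro hr
    rw [FreeGroup.IsReduced, List.isChain_cons_cons] at hr
    obtain ⟨ih1, ih2⟩ := ih f' hr.2
    rw [FreeGroup.lift_mk_cons f e]
    set x := FreeGroup.lift f (FreeGroup.mk [e]) with hx
    set y := FreeGroup.lift f (FreeGroup.mk (f' :: l)) with hy
    have hxi : FreeGroup.lift f (FreeGroup.mk [(e.1, !e.2)]) = x⁻¹ :=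
      FreeGroup.lift_mk_singleton_not f e
    have h1 : d o ((x * y) • o) = d (x⁻¹ • o) (y • o) := by
      rw [← hA x⁻¹ o]
      simp [mul_smul]
    have h2 : d ((x * y) • o) (x • o) = d o (y • o) := by
      rw [mul_smul, hA, d_comm]
    have h3 := hlen (e.1, !e.2)
    have h4 := hover (e.1, !e.2) f' (by
      rintro rfl
      simpa using hr.1 rfl)
    have h5 := hlen f'
    rw [hxi] at h3 h4
    -- From `o`, the paths of `x⁻¹` and `f'` part after at most one step, while the path of `y`
    -- follows `f'` longer. So `x⁻¹` and `y` also part after at most one step, which bounds the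
    -- cancellation in `x * y`.
    have h6 := four_point (x⁻¹ • o) (FreeGroup.lift f (FreeGroup.mk [f']) • o) (y • o) o
    have c1 := d_comm (x⁻¹ • o) o
    have c2 := d_comm (y • o) o
    have c3 := d_comm (FreeGroup.lift f (FreeGroup.mk [f']) • o) o
    have c4 := d_comm (FreeGroup.lift f (FreeGroup.mk [f']) • o) (y • o)
    rw [h1, h2, List.length_cons, add_mul _ 1]
    omega

/-- After conjugation the word is cyclically reduced, so its powers are reduced and move `o`
linearly far. Linear growth bounds the displacement of every point. -/
theorem FreeGroup.le_d_smul_of_ne_one {α : Type*}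
    (hA : ∀ (g : A) (x y : X), d (g • x) (g • y) = d x y)
    (f : α → A) (o : X) (N : ℕ) (hN : 3 ≤ N)
    (hlen : ∀ e : α × Bool, d o (FreeGroup.lift f (FreeGroup.mk [e]) • o) = N)
    (hover : ∀ e e' : α × Bool, e ≠ e' → 2 * N ≤
      d (FreeGroup.lift f (FreeGroup.mk [e]) • o) (FreeGroup.lift f (FreeGroup.mk [e']) • o) + 2)
    (w : FreeGroup α) (hw : w ≠ 1) (p : X) : N - 2 ≤ d p (FreeGroup.lift f w • p) := by
  classical
  set r := FreeGroup.reduceCyclically w.toWord with hr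
  set u := FreeGroup.reduceCyclically.conjugator w.toWord with hu
  have hconj : FreeGroup.mk u * FreeGroup.mk r * (FreeGroup.mk u)⁻¹ = w := by
    have := FreeGroup.reduceCyclically.conj_conjugator_reduceCyclically w.toWord
    rw [FreeGroup.inv_mk, FreeGroup.mul_mk, FreeGroup.mul_mk, hu, hr, this, FreeGroup.mk_toWord]
  have hcr : FreeGroup.IsCyclicallyReduced r :=
    FreeGroup.reduceCyclically.isCyclicallyReduced FreeGroup.isReduced_toWord
  have hne : r ≠ [] := by
    intro h
    apply hw
    rw [← hconj, h, ← FreeGroup.one_eq_mk, mul_one, mul_inv_cancel]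
  have key := le_d_smul_of_stable hA (FreeGroup.lift f (FreeGroup.mk r)) o (N - 2) (fun n => by
    rw [← map_pow, FreeGroup.pow_mk]
    have h1 := FreeGroup.IsReduced.le_d_smul hA f o N hN hlen hover _
      (hcr.flatten_replicate n).isReduced
    refine le_trans ?_ h1
    have h2 : 1 ≤ r.length := List.length_pos_iff.2 hne
    rw [List.length_flatten]
    simp
    exact Nat.mul_le_mul_right _ (Nat.le_mul_of_pos_right n h2))
    ((FreeGroup.lift f (FreeGroup.mk u))⁻¹ • p)
  rw [← hA (FreeGroup.lift f (FreeGroup.mk u)), smul_inv_smul] at key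
  rwa [← hconj, _root_.map_mul, _root_.map_mul, _root_.map_inv, mul_smul, mul_smul]

end Displacement

/-! ### States on lines with pairwise distinct gaps. -/

theorem exists_perm_comp_eq {P Ω : Type*} [Finite P] [Infinite Ω] (f g : P → Ω)
    (hf : Function.Injective f) (hg : Function.Injective g) :
    ∃ φ : Equiv.Perm Ω, ∀ p, φ (f p) = g p := by
  let F : Set.range f ↪ Ω := ⟨fun x => g ((Equiv.ofInjective f hf).symm x),
    hg.comp (Equiv.ofInjective f hf).symm.injective⟩
  -- A finite partial injection of an infinite set extends to a permutation.
  obtain ⟨φ, hφ⟩ := Cardinal.extend_function_of_lt F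
    ((Cardinal.lt_aleph0_of_finite _).trans_le (Cardinal.aleph0_le_mk Ω)) ⟨Equiv.refl Ω⟩
  refine ⟨φ, fun p => ?_⟩
  have := hφ ⟨f p, p, rfl⟩
  rw [this]
  exact congrArg g (Equiv.ofInjective_symm_apply hf p)

/-- The position of a state on the union of the lines indexed by `O`: a state `Sum.inl o` is the
origin of the line `o`, a state `Sum.inr e` lies on the line `ℓ e` at the coordinate `K e`. -/
def linePosition {O E : Type*} (ℓ : E → O) (K : E → ℤ) : O ⊕ E → O × ℤ
  | Sum.inl o => (o, 0)
  | Sum.inr e => (ℓ e, K e)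

/-- The distances between the states on the lines are pairwise distinct. -/
structure DistinctGaps {O E : Type*} (ℓ : E → O) (K : E → ℤ) : Prop where
  ne_zero : ∀ e, K e ≠ 0
  inj : ∀ e e', |K e| = |K e'| → e = e'
  gap_ne : ∀ e e' f, e ≠ e' → ℓ e = ℓ e' → |K e - K e'| ≠ |K f|
  gap_inj : ∀ e e' f f', e ≠ e' → f ≠ f' → ℓ e = ℓ e' → ℓ f = ℓ f' →
    |K e - K e'| = |K f - K f'| → e = f ∧ e' = f' ∨ e = f' ∧ e' = f

namespace DistinctGaps

variable {O E : Type*} {ℓ : E → O} {K : E → ℤ}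

theorem injective (h : DistinctGaps ℓ K) : Function.Injective (linePosition ℓ K) := by
  rintro (o | e) (o' | e') he <;> simp only [linePosition, Prod.mk.injEq] at he
  · rw [he.1]
  · exact absurd he.2.symm (h.ne_zero e')
  · exact absurd he.2 (h.ne_zero e)
  · rw [h.inj e e' (by rw [he.2])]

/-- A gap from or to an origin is some `K e` up to sign; any other gap is a difference of two
coordinates on one line. Distinct absolute values identify the pair of states, and the sign of `n`
its order. -/
theorem eq_of_gap_eq (h : DistinctGaps ℓ K) {p q p' q' : O ⊕ E} {n : ℤ} (hn : n ≠ 0)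
    (h1 : linePosition ℓ K q = ((linePosition ℓ K p).1, (linePosition ℓ K p).2 + n))
    (h2 : linePosition ℓ K q' = ((linePosition ℓ K p').1, (linePosition ℓ K p').2 + n)) :
    p = p' := by
  have hne : ∀ e e' f : E, ℓ e = ℓ e' → K e = K e' + n → |n| ≠ |K f| := by
    intro e e' f hl he h'
    refine h.gap_ne e e' f ?_ hl (by rw [he]; simpa using h')
    rintro rfl
    omega
  have hab : ∀ e f : E, |K e| = |K f| → e = f := h.inj
  have h0 := h.ne_zero
  rcases p with o | e <;> rcases q with o₁ | e₁ <;> rcases p' with o' | e' <;>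
    rcases q' with o₁' | e₁' <;> simp only [linePosition, Prod.mk.injEq] at h1 h2
  case inl.inr.inl.inr =>
    have := hab e₁ e₁' (by rw [h1.2, h2.2])
    rw [← h1.1, ← h2.1, this]
  case inr.inl.inr.inl =>
    rw [hab e e' (by congr 1; omega)]
  case inr.inr.inr.inr =>
    have hd : ∀ a b : E, K a = K b + n → a ≠ b := by
      rintro a b hab rfl
      omega
    have := h.gap_inj e₁ e e₁' e' (hd _ _ h1.2) (hd _ _ h2.2) h1.1 h2.1
      (by rw [h1.2, h2.2]; simp)
    rcases this with ⟨-, rfl⟩ | ⟨rfl, rfl⟩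
    · rfl
    · omega
  case inl.inr.inr.inl =>
    have := hab e₁ e' (by rw [h1.2, ← abs_neg (K e')]; congr 1; omega)
    subst this
    exact absurd (h0 e₁) (by omega)
  case inr.inl.inl.inr =>
    have := hab e e₁' (by rw [h2.2, ← abs_neg (K e)]; congr 1; omega)
    subst this
    exact absurd (h0 e) (by omega)
  case inl.inr.inr.inr => exact absurd (by rw [h1.2]; simp) (hne e₁' e' e₁ h2.1 h2.2)
  case inr.inr.inl.inr => exact absurd (by rw [h2.2]; simp) (hne e₁ e e₁' h1.1 h1.2)
  case inr.inl.inr.inr =>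
    exact absurd (by rw [← abs_neg (K e)]; congr 1; omega) (hne e₁' e' e h2.1 h2.2)
  case inr.inr.inr.inl =>
    exact absurd (by rw [← abs_neg (K e')]; congr 1; omega) (hne e₁ e e' h1.1 h1.2)
  all_goals omega

end DistinctGaps

/-- A family of exponents with the cardinality of absolute values and of differences in a
distinguished column as large as possible has distinct gaps. -/
theorem injective_of_ncard {m s : ℕ} (K : Fin m → Fin s → ℤ) (j₀ : Fin s)
    (h : ({x : ℤ | ∃ i j, x = |K i j|} ∪
      {x : ℤ | ∃ (i i' : Fin m) (j : Fin s), i < i' ∧ j = j₀ ∧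
        x = |K i j - K i' j|}).ncard = s * m + m.choose 2) :
    Function.Injective (Sum.elim (fun e : Fin m × Fin s => |K e.1 e.2|)
      fun p : {p : Fin m × Fin m // p.1 < p.2} => |K p.1.1 j₀ - K p.1.2 j₀|) := by
  set f := Sum.elim (fun e : Fin m × Fin s => |K e.1 e.2|)
      fun p : {p : Fin m × Fin m // p.1 < p.2} => |K p.1.1 j₀ - K p.1.2 j₀| with hf
  have h1 : ({x : ℤ | ∃ i j, x = |K i j|} ∪
      {x : ℤ | ∃ (i i' : Fin m) (j : Fin s), i < i' ∧ j = j₀ ∧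
        x = |K i j - K i' j|}) = Set.range f := by
    ext x
    constructor
    · rintro (⟨i, j, rfl⟩ | ⟨i, i', j, hi, rfl, rfl⟩)
      · exact ⟨Sum.inl (i, j), rfl⟩
      · exact ⟨Sum.inr ⟨(i, i'), hi⟩, rfl⟩
    · rintro ⟨⟨i, j⟩ | ⟨⟨i, i'⟩, hi⟩, rfl⟩
      · exact Or.inl ⟨i, j, rfl⟩
      · exact Or.inr ⟨i, i', j₀, hi, rfl, rfl⟩
  have h2 : Fintype.card {p : Fin m × Fin m // p.1 < p.2} = m.choose 2 := by
    rw [Fintype.card_subtype, Fintype.card_product_filter_lt, Fintype.card_fin]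
  have h3 : (Finset.univ.image f).card =
      (Finset.univ : Finset ((Fin m × Fin s) ⊕ {p : Fin m × Fin m // p.1 < p.2})).card := by
    rw [h1, ← Set.image_univ, ← Finset.coe_univ, ← Finset.coe_image, Set.ncard_coe_finset] at h
    rw [h, Finset.card_univ, Fintype.card_sum, h2]
    simp [mul_comm]
  have h4 := Finset.card_image_iff.1 h3
  rwa [Finset.coe_univ, Set.injOn_univ] at h4

theorem DistinctGaps.of_ncard {m s : ℕ} {O : Type*} (K : Fin m → Fin s → ℤ) (j₀ : Fin s)
    (h0 : ∀ i j, K i j ≠ 0)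
    (h : ({x : ℤ | ∃ i j, x = |K i j|} ∪
      {x : ℤ | ∃ (i i' : Fin m) (j : Fin s), i < i' ∧ j = j₀ ∧
        x = |K i j - K i' j|}).ncard = s * m + m.choose 2)
    (ℓ : Fin m × Fin s → O)
    (hℓ : ∀ e e', e ≠ e' → ℓ e = ℓ e' → e.2 = j₀ ∧ e'.2 = j₀) :
    DistinctGaps ℓ fun e => K e.1 e.2 := by
  have hinj := injective_of_ncard K j₀ h
  have hpair : ∀ e e', e ≠ e' → ℓ e = ℓ e' → ∃ p : {p : Fin m × Fin m // p.1 < p.2},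
      |K e.1 e.2 - K e'.1 e'.2| = |K p.1.1 j₀ - K p.1.2 j₀| ∧
      (e = (p.1.1, j₀) ∧ e' = (p.1.2, j₀) ∨ e = (p.1.2, j₀) ∧ e' = (p.1.1, j₀)) := by
    rintro ⟨i, j⟩ ⟨i', j'⟩ hne hl
    obtain ⟨rfl, rfl⟩ := hℓ _ _ hne hl
    rcases lt_trichotomy i i' with hi | rfl | hi
    · exact ⟨⟨(i, i'), hi⟩, rfl, Or.inl ⟨rfl, rfl⟩⟩
    · exact absurd rfl hne
    · exact ⟨⟨(i', i), hi⟩, abs_sub_comm _ _, Or.inr ⟨rfl, rfl⟩⟩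
  refine ⟨fun e => h0 _ _, fun e e' he => ?_, fun e e' f hne hl he => ?_,
    fun e e' f f' hne hne' hl hl' he => ?_⟩
  · exact Sum.inl_injective (hinj he)
  · obtain ⟨p, hp, -⟩ := hpair e e' hne hl
    rw [hp] at he
    cases @hinj (Sum.inr p) (Sum.inl f) he
  · obtain ⟨p, hp, hp'⟩ := hpair e e' hne hl
    obtain ⟨q, hq, hq'⟩ := hpair f f' hne' hl'
    rw [hp, hq] at he
    obtain rfl := Sum.inr_injective (@hinj (Sum.inr p) (Sum.inr q) he)
    rcases hp' with ⟨rfl, rfl⟩ | ⟨rfl, rfl⟩ <;> rcases hq' with ⟨rfl, rfl⟩ | ⟨rfl, rfl⟩ <;> simp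

theorem DistinctGaps.neg {O E : Type*} {ℓ : E → O} {K : E → ℤ} (h : DistinctGaps ℓ K) :
    DistinctGaps ℓ fun e => -K e where
  ne_zero e := neg_ne_zero.2 (h.ne_zero e)
  inj e e' he := h.inj e e' (by simpa only [abs_neg] using he)
  gap_ne e e' f hne hl := by
    rw [abs_neg, neg_sub_neg, abs_sub_comm]
    exact h.gap_ne e e' f hne hl
  gap_inj e e' f f' hne hne' hl hl' := by
    rw [neg_sub_neg, neg_sub_neg, abs_sub_comm, abs_sub_comm (K f')]
    exact h.gap_inj e e' f f' hne hne' hl hl'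

/-- The translation by one along all lines. -/
def lineShift (O : Type*) : Equiv.Perm (O × ℤ) :=
  Equiv.prodCongr (Equiv.refl O) (Equiv.addRight 1)

theorem lineShift_zpow {O : Type*} (n : ℤ) (x : O × ℤ) : (lineShift O ^ n) x = (x.1, x.2 + n) := by
  have h1 : ∀ x : O × ℤ, lineShift O x = (x.1, x.2 + 1) := fun _ => rfl
  have h2 : ∀ x : O × ℤ, (lineShift O)⁻¹ x = (x.1, x.2 - 1) := fun x => by
    rw [Equiv.Perm.inv_eq_iff_eq, h1]
    simp
  induction n generalizing x with
  | zero => simp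
  | succ n ih =>
    rw [zpow_add_one, Equiv.Perm.mul_apply, ih, h1]
    simp only [Prod.mk.injEq, true_and]
    ring
  | pred n ih =>
    rw [zpow_sub_one, Equiv.Perm.mul_apply, ih, h2]
    simp only [Prod.mk.injEq, true_and]
    ring

/-! ### The states of the words and the recognition of the subgroup. -/

section Words

variable {m s : ℕ} (k : Fin 2 → Fin m → Fin s → ℤ)

/-- The product of the first `j` pairs of syllables of a word. -/
def initialProd (i : Fin m) (j : ℕ) : FreeGroup (Fin 2) :=
  ((List.ofFn fun j : Fin s =>
    FreeGroup.of (0 : Fin 2) ^ k 0 i j * FreeGroup.of (1 : Fin 2) ^ k 1 i j).take j).prod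

theorem initialProd_zero (i : Fin m) : initialProd k i 0 = 1 := by simp [initialProd]

theorem initialProd_succ (i : Fin m) (j : Fin s) : initialProd k i (j + 1) =
    initialProd k i j * FreeGroup.of 0 ^ k 0 i j * FreeGroup.of 1 ^ k 1 i j := by
  rw [initialProd, List.prod_take_succ _ _ (by simp), initialProd, mul_assoc]
  simp

theorem initialProd_self (i : Fin m) : initialProd k i s = alphaWord k i := by
  rw [initialProd, List.take_of_length_le (by simp), alphaWord]

theorem alphaWord_mem (i : Fin m) : alphaWord k i ∈ subgroupC k :=
  Subgroup.subset_closure ⟨i, rfl⟩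

variable (m s) in
/-- The vertices of the graph of the words: the states `Sum.inl (some (i, j))` and `Sum.inr (i, j)`
are reached in the `i`-th word before and after the `j`-th syllable of the first generator. -/
abbrev WordState : Type := Option (Fin m × Fin s) ⊕ Fin m × Fin s

/-- The state reached after `j` pairs of syllables. -/
def anchor (i : Fin m) (j : ℕ) : Option (Fin m × Fin s) :=
  if h : 0 < j ∧ j < s then some (i, ⟨j, h.2⟩) else none

/-- The element spelled on the way to a state. -/
def stateRep : WordState m s → FreeGroup (Fin 2)
  | Sum.inl none => 1
  | Sum.inl (some e) => initialProd k e.1 e.2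
  | Sum.inr e => initialProd k e.1 e.2 * FreeGroup.of 0 ^ k 0 e.1 e.2

theorem stateRep_anchor (i : Fin m) (j : ℕ) (hj : j < s) :
    stateRep k (Sum.inl (anchor i j)) = initialProd k i j := by
  rw [anchor]
  split_ifs with h
  · rfl
  · obtain rfl : j = 0 := by omega
    rw [initialProd_zero]
    rfl

/-- The elements spelled by the initial segments of products of the words. -/
def spelled : Set (FreeGroup (Fin 2)) := {g | ∃ c ∈ subgroupC k, ∃ q, g = c * stateRep k q}

theorem initialProd_mem_spelled {c : FreeGroup (Fin 2)} (hc : c ∈ subgroupC k) (i : Fin m) (j : ℕ)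
    (hj : j ≤ s) : c * initialProd k i j ∈ spelled k := by
  rcases hj.lt_or_eq with hj | rfl
  · exact ⟨c, hc, _, by rw [stateRep_anchor k i j hj]⟩
  · exact ⟨c * alphaWord k i, mul_mem hc (alphaWord_mem k i), Sum.inl none, by
      rw [initialProd_self]; simp [stateRep]⟩

theorem mul_mem_spelled {c g : FreeGroup (Fin 2)} (hc : c ∈ subgroupC k) (hg : g ∈ spelled k) :
    c * g ∈ spelled k := by
  obtain ⟨c', hc', q, rfl⟩ := hg
  exact ⟨c * c', mul_mem hc hc', q, by rw [mul_assoc]⟩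

theorem mem_spelled_of_mem {c : FreeGroup (Fin 2)} (hc : c ∈ subgroupC k) : c ∈ spelled k :=
  ⟨c, hc, Sum.inl none, by simp [stateRep]⟩

variable {k}

namespace AdmissibleExponents

/-- All words start at `none`, so only that line carries several states besides its origin: those
after the first syllables. Their differences are exactly the ones in condition (A). -/
theorem distinctGaps_first (hk : AdmissibleExponents m s k) :
    DistinctGaps (fun e : Fin m × Fin s => anchor (s := s) e.1 e.2) fun e => k 0 e.1 e.2 := by
  have hs := hk.ten_le
  have hj : ∀ j : Fin s, (j : ℕ) = 0 ↔ j = ⟨0, by omega⟩ := fun j => by rw [Fin.ext_iff]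
  have hc := hk.card_first
  simp only [hj] at hc
  refine DistinctGaps.of_ncard (k 0) ⟨0, by omega⟩ (hk.ne_zero 0) hc _ ?_
  rintro ⟨i, j⟩ ⟨i', j'⟩ hne h
  simp only [← hj]
  simp only [anchor] at h
  by_contra h0
  split_ifs at h with h1 h2
  · simp only [Option.some.injEq] at h
    exact hne h
  · have := j.2
    have := j'.2
    omega

/-- Each syllable of the second generator ends at an anchor, so its starting state has the negated
exponent as coordinate. All words end at `none`, which makes the last column the distinguished one.
-/
theorem distinctGaps_second (hk : AdmissibleExponents m s k) :
    DistinctGaps (fun e : Fin m × Fin s => anchor (s := s) e.1 (e.2 + 1))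
      fun e => -k 1 e.1 e.2 := by
  have hs := hk.ten_le
  have hj : ∀ j : Fin s, (j : ℕ) + 1 = s ↔ j = ⟨s - 1, by omega⟩ := fun j => by
    rw [Fin.ext_iff]
    simp only
    omega
  have hc := hk.card_second
  simp only [hj] at hc
  refine (DistinctGaps.of_ncard (k 1) ⟨s - 1, by omega⟩ (hk.ne_zero 1) hc _ ?_).neg
  rintro ⟨i, j⟩ ⟨i', j'⟩ hne h
  simp only [← hj]
  simp only [anchor] at h
  by_contra h0
  split_ifs at h with h1 h2
  · simp only [Option.some.injEq, Prod.mk.injEq, Fin.mk.injEq] at h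
    refine hne (Prod.ext h.1 (Fin.ext ?_))
    simp only
    omega
  · have := j.2
    have := j'.2
    omega

/-- There is a map on the free group, invariant under the subgroup, that tells the states of the
elements apart and on which the generators act by translations of lines. -/
theorem exists_stateMap (hk : AdmissibleExponents m s k) :
    ∃ (σ : FreeGroup (Fin 2) → Option (Fin m × Fin s) × ℤ)
      (φ : Equiv.Perm (Option (Fin m × Fin s) × ℤ)),
      (∀ c ∈ subgroupC k, ∀ g, σ (c * g) = σ g) ∧
      (∀ g n, σ (g * FreeGroup.of 0 ^ n) = ((σ g).1, (σ g).2 + n)) ∧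
      (∀ g n, φ (σ (g * FreeGroup.of 1 ^ n)) = ((φ (σ g)).1, (φ (σ g)).2 + n)) ∧
      (∀ q, φ (linePosition (fun e : Fin m × Fin s => anchor (s := s) e.1 e.2)
          (fun e => k 0 e.1 e.2) q) =
        linePosition (fun e : Fin m × Fin s => anchor (s := s) e.1 (e.2 + 1))
          (fun e => -k 1 e.1 e.2) q) ∧
      (∀ i j, j ≤ s → σ (initialProd k i j) = (anchor i j, 0)) := by
  obtain ⟨φ, hφ⟩ := exists_perm_comp_eq _ _ hk.distinctGaps_first.injective
    hk.distinctGaps_second.injective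
  -- The permutation `φ` glues the two systems of lines at the states. Since `σ` evaluates `ρ` at
  -- `g⁻¹`, the generators go to inverse translations, so that appending `t ^ n` shifts by `n`.
  let ρ : FreeGroup (Fin 2) →* Equiv.Perm (Option (Fin m × Fin s) × ℤ) :=
    FreeGroup.lift ![(lineShift _)⁻¹, φ⁻¹ * (lineShift _)⁻¹ * φ]
  let σ : FreeGroup (Fin 2) → Option (Fin m × Fin s) × ℤ := fun g => ρ g⁻¹ (none, 0)
  have h0 : ∀ g n, σ (g * FreeGroup.of 0 ^ n) = ((σ g).1, (σ g).2 + n) := by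
    intro g n
    have : ρ (FreeGroup.of 0) = (lineShift _)⁻¹ := by simp [ρ]
    simp only [σ]
    rw [mul_inv_rev, map_mul, map_inv, map_zpow, this, inv_zpow, inv_inv, Equiv.Perm.mul_apply,
      lineShift_zpow]
  have h1 : ∀ g n, φ (σ (g * FreeGroup.of 1 ^ n)) = ((φ (σ g)).1, (φ (σ g)).2 + n) := by
    intro g n
    have : ρ (FreeGroup.of 1) = φ⁻¹ * (lineShift _)⁻¹ * φ⁻¹⁻¹ := by simp [ρ]
    simp only [σ]
    rw [mul_inv_rev, map_mul, map_inv, map_zpow, this, conj_zpow, inv_zpow, mul_inv_rev,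
      mul_inv_rev, inv_inv, inv_inv, Equiv.Perm.mul_apply, Equiv.Perm.mul_apply,
      Equiv.Perm.mul_apply, ← Equiv.Perm.mul_apply φ, mul_inv_cancel, Equiv.Perm.one_apply,
      lineShift_zpow, inv_inv]
  have h2 : ∀ i j, j ≤ s → σ (initialProd k i j) = (anchor i j, 0) := by
    intro i j hj
    induction j with
    | zero =>
      simp only [σ]
      rw [initialProd_zero, inv_one, map_one, Equiv.Perm.one_apply]
      simp [anchor]
    | succ j ih =>
      have := initialProd_succ k i ⟨j, hj⟩
      simp only at this
      rw [this]
      have e1 := h0 (initialProd k i j) (k 0 i ⟨j, hj⟩)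
      rw [ih (by omega)] at e1
      have e2 := hφ (Sum.inr (i, ⟨j, hj⟩))
      have e3 := hφ (Sum.inl (anchor i (j + 1)))
      simp only [linePosition] at e2 e3
      apply φ.injective
      rw [h1, e1, e3, zero_add, e2]
      simp
  refine ⟨σ, φ, fun c hc g => ?_, h0, h1, hφ, h2⟩
  -- Every word is a loop, as `anchor i s` is `none`; so the subgroup fixes the base point.
  have h3 : subgroupC k ≤ Subgroup.comap ρ (MulAction.stabilizer
      (Equiv.Perm (Option (Fin m × Fin s) × ℤ)) ((none, 0) : Option (Fin m × Fin s) × ℤ)) := by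
    refine (Subgroup.closure_le _).2 ?_
    rintro _ ⟨i, rfl⟩
    have h4 := h2 i s le_rfl
    rw [initialProd_self] at h4
    rw [SetLike.mem_coe, ← inv_mem_iff, Subgroup.mem_comap, MulAction.mem_stabilizer_iff]
    refine h4.trans ?_
    simp [anchor]
  have h4 := h3 (inv_mem hc)
  rw [Subgroup.mem_comap, MulAction.mem_stabilizer_iff] at h4
  simp only [σ]
  rw [mul_inv_rev, map_mul, Equiv.Perm.mul_apply]
  exact congrArg _ h4

/-- An element that maps one turn between initial segments to another one lies in the subgroup. -/
theorem mem_of_turn (hk : AdmissibleExponents m s k) (t : Fin 2) (n : ℤ) (hn : n ≠ 0)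
    (g h : FreeGroup (Fin 2)) (h1 : g ∈ spelled k) (h2 : g * FreeGroup.of t ^ n ∈ spelled k)
    (h3 : h * g ∈ spelled k) (h4 : h * g * FreeGroup.of t ^ n ∈ spelled k) : h ∈ subgroupC k := by
  obtain ⟨σ, φ, hC, hA, hB, hφ, hP⟩ := hk.exists_stateMap
  have hstate : ∀ g ∈ spelled k, ∃ c ∈ subgroupC k, ∃ q, g = c * stateRep k q ∧
      σ g = linePosition (fun e : Fin m × Fin s => anchor (s := s) e.1 e.2)
          (fun e => k 0 e.1 e.2) q := by
    rintro _ ⟨c, hc, q, rfl⟩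
    rcases q with (_ | ⟨i, j⟩) | ⟨i, j⟩
    · refine ⟨c, hc, _, rfl, ?_⟩
      rw [hC c hc]
      have hm := hk.eight_le
      have := hP ⟨0, by omega⟩ 0 (Nat.zero_le _)
      rw [initialProd_zero] at this
      simpa [stateRep, linePosition, anchor] using this
    -- For `j = 0` the states `some (i, 0)` and `none` spell the same element; `anchor` selects
    -- `none`, where `σ` takes its value.
    · refine ⟨c, hc, Sum.inl (anchor i j), ?_, ?_⟩
      · rw [stateRep_anchor k i j j.2]
        rfl
      · rw [hC c hc]
        exact hP i j j.2.le
    · refine ⟨c, hc, _, rfl, ?_⟩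
      rw [hC c hc, stateRep, hA, hP i j j.2.le]
      simp [linePosition]
  obtain ⟨c, hc, p, hg, hp⟩ := hstate _ h1
  obtain ⟨-, -, q, -, hq⟩ := hstate _ h2
  obtain ⟨c', hc', p', hg', hp'⟩ := hstate _ h3
  obtain ⟨-, -, q', -, hq'⟩ := hstate _ h4
  -- Both turns have the gap `n` on lines of the same generator, so they start in the same state;
  -- then `g` and `h * g` differ by elements of the subgroup.
  have hpp : p = p' := by
    fin_cases t
    · refine hk.distinctGaps_first.eq_of_gap_eq (q := q) (q' := q') hn ?_ ?_
      · rw [← hp, ← hq, ← hA]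
        rfl
      · rw [← hp', ← hq', ← hA]
        rfl
    · refine hk.distinctGaps_second.eq_of_gap_eq (q := q) (q' := q') hn ?_ ?_
      · rw [← hφ, ← hφ, ← hp, ← hq, ← hB]
        rfl
      · rw [← hφ, ← hφ, ← hp', ← hq', ← hB]
        rfl
  subst hpp
  have : h = c' * c⁻¹ := by
    rw [hg] at hg'
    rw [← mul_assoc] at hg'
    rw [← mul_right_cancel hg']
    simp
  rw [this]
  exact mul_mem hc' (inv_mem hc)

end AdmissibleExponents

end Words

/-! ### Paths spelled by the generators of the subgroup. -/

section Letters

/-- The syllables of a product of pairs of powers. -/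
def pairSyllables (l : List (ℤ × ℤ)) : List (Σ _ : Fin 2, ℤ) :=
  l.flatMap fun p => [⟨0, p.1⟩, ⟨1, p.2⟩]

theorem isChain_pairSyllables (l : List (ℤ × ℤ)) :
    (pairSyllables l).IsChain fun e e' => e.1 ≠ e'.1 := by
  have key : ∀ (l : List (ℤ × ℤ)) (x : ℤ),
      ((⟨1, x⟩ : Σ _ : Fin 2, ℤ) :: pairSyllables l).IsChain fun e e' => e.1 ≠ e'.1 := by
    intro l
    induction l with
    | nil => simp [pairSyllables]
    | cons p l ih =>
      intro x
      have := ih p.2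
      simp only [pairSyllables, List.flatMap_cons, List.cons_append, List.nil_append,
        List.isChain_cons_cons] at this ⊢
      exact ⟨by simp, by simp, this⟩
  exact (key l 0).tail

theorem prod_pairSyllables (l : List (ℤ × ℤ)) :
    ((pairSyllables l).map fun e => FreeGroup.of e.1 ^ e.2).prod =
      (l.map fun p => FreeGroup.of (0 : Fin 2) ^ p.1 * FreeGroup.of (1 : Fin 2) ^ p.2).prod := by
  induction l with
  | nil => rfl
  | cons p l ih =>
    rw [List.map_cons, List.prod_cons, ← ih]
    simp [pairSyllables, mul_assoc]

theorem length_pairSyllables (l : List (ℤ × ℤ)) : (pairSyllables l).length = 2 * l.length := by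
  simp [pairSyllables, mul_comm]

theorem ne_zero_of_mem_pairSyllables {l : List (ℤ × ℤ)} (h : ∀ p ∈ l, p.1 ≠ 0 ∧ p.2 ≠ 0) :
    ∀ e ∈ pairSyllables l, e.2 ≠ 0 := by
  intro e he
  simp only [pairSyllables, List.mem_flatMap] at he
  obtain ⟨p, hp, he⟩ := he
  have := h p hp
  simp only [List.mem_cons, List.not_mem_nil, or_false] at he
  rcases he with rfl | rfl
  · exact this.1
  · exact this.2

theorem head?_pairSyllables {l : List (ℤ × ℤ)} {p : ℤ × ℤ} (h : l.head? = some p) :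
    (pairSyllables l).head? = some ⟨0, p.1⟩ := by
  cases l with
  | nil => simp at h
  | cons q l =>
    simp at h
    simp [pairSyllables, h]

theorem getLast?_pairSyllables {l : List (ℤ × ℤ)} {p : ℤ × ℤ} (h : l.getLast? = some p) :
    (pairSyllables l).getLast? = some ⟨1, p.2⟩ := by
  obtain ⟨l', rfl⟩ := List.getLast?_eq_some_iff.1 h
  simp [pairSyllables]

/-- The syllables of the inverse. -/
def invSyllables (l : List (Σ _ : Fin 2, ℤ)) : List (Σ _ : Fin 2, ℤ) :=
  (l.map fun e => ⟨e.1, -e.2⟩).reverse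

theorem prod_invSyllables (l : List (Σ _ : Fin 2, ℤ)) :
    ((invSyllables l).map fun e => FreeGroup.of e.1 ^ e.2).prod =
      (l.map fun e => FreeGroup.of e.1 ^ e.2).prod⁻¹ := by
  rw [List.prod_inv_reverse]
  simp [invSyllables, Function.comp_def]

variable {m s : ℕ} (k : Fin 2 → Fin m → Fin s → ℤ)

/-- The syllables of a generator of the subgroup or of its inverse. -/
def letterSyllables (e : Fin m × Bool) : List (Σ _ : Fin 2, ℤ) :=
  bif e.2 then pairSyllables (List.ofFn fun j => (k 0 e.1 j, k 1 e.1 j))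
  else invSyllables (pairSyllables (List.ofFn fun j => (k 0 e.1 j, k 1 e.1 j)))

theorem prod_letterSyllables (e : Fin m × Bool) :
    ((letterSyllables k e).map fun e => FreeGroup.of e.1 ^ e.2).prod =
      FreeGroup.lift (alphaWord k) (FreeGroup.mk [e]) := by
  have h : ((pairSyllables (List.ofFn fun j => (k 0 e.1 j, k 1 e.1 j))).map fun e =>
      FreeGroup.of e.1 ^ e.2).prod = alphaWord k e.1 := by
    rw [prod_pairSyllables, List.map_ofFn, alphaWord]
    rfl
  obtain ⟨i, _ | _⟩ := e <;> simp only [letterSyllables, cond_true, cond_false]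
  · rw [prod_invSyllables, h]
    simp
  · rw [h]
    simp

variable {k}

namespace AdmissibleExponents

theorem label_letter (hk : AdmissibleExponents m s k) (e : Fin m × Bool) :
    label (center (FreeGroup.lift (alphaWord k) (FreeGroup.mk [e]))) =
      (letterSyllables k e).flatMap fun e =>
        [Sum.inl e.1, Sum.inr ⟨e.1, Multiplicative.ofAdd (-e.2)⟩] := by
  have h0 : ∀ e' ∈ pairSyllables (List.ofFn fun j => (k 0 e.1 j, k 1 e.1 j)), e'.2 ≠ 0 := by
    refine ne_zero_of_mem_pairSyllables fun p hp => ?_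
    obtain ⟨j, rfl⟩ := List.mem_ofFn.1 hp
    exact ⟨hk.ne_zero _ _ _, hk.ne_zero _ _ _⟩
  rw [← prod_letterSyllables]
  apply label_center_prod
  · obtain ⟨i, _ | _⟩ := e <;> simp only [letterSyllables, cond_true, cond_false]
    · intro e he
      simp only [invSyllables, List.mem_reverse, List.mem_map] at he
      obtain ⟨e, he, rfl⟩ := he
      simpa using h0 e he
    · exact h0
  · obtain ⟨i, _ | _⟩ := e <;> simp only [letterSyllables, cond_true, cond_false]
    · rw [invSyllables, List.isChain_reverse, List.isChain_map]
      exact (isChain_pairSyllables _).imp fun a b h => Ne.symm h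
    · exact isChain_pairSyllables _

theorem d_center_one (g : FreeGroup (Fin 2)) :
    d (center 1) (center g) = (label (center g)).length := by
  rw [d_def, label_center_one]
  simp

theorem d_letter (hk : AdmissibleExponents m s k) (e : Fin m × Bool) :
    d (center 1) (FreeGroup.lift (alphaWord k) (FreeGroup.mk [e]) • center (1 : FreeGroup (Fin 2))) =
      4 * s := by
  rw [smul_center, mul_one, d_center_one, hk.label_letter]
  have : (letterSyllables k e).length = 2 * s := by
    obtain ⟨i, _ | _⟩ := e <;>
      simp [letterSyllables, invSyllables, length_pairSyllables]
  simp [this]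
  omega

/-- A generator starts with a power of `a` and an inverse with a power of `b`; within each kind the
exponents have distinct absolute values. -/
theorem exists_head?_letterSyllables (hk : AdmissibleExponents m s k) :
    ∃ x : Fin m × Bool → Σ _ : Fin 2, ℤ, Function.Injective x ∧
      ∀ e, (letterSyllables k e).head? = some (x e) := by
  have hs := hk.ten_le
  refine ⟨fun e => bif e.2 then ⟨0, k 0 e.1 ⟨0, by omega⟩⟩ else ⟨1, -k 1 e.1 ⟨s - 1, by omega⟩⟩,
    ?_, ?_⟩
  · rintro ⟨i, _ | _⟩ ⟨i', _ | _⟩ h <;> simp at h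
    · have := hk.distinctGaps_second.inj (i, ⟨s - 1, by omega⟩) (i', ⟨s - 1, by omega⟩)
        (by simp only [h])
      simp at this
      rw [this]
    · have := hk.distinctGaps_first.inj (i, ⟨0, by omega⟩) (i', ⟨0, by omega⟩)
        (by simp only [h])
      simp at this
      rw [this]
  · rintro ⟨i, _ | _⟩
    · simp only [letterSyllables, cond_false, invSyllables, List.head?_reverse]
      rw [List.getLast?_map, getLast?_pairSyllables (p := (k 0 i ⟨s - 1, by omega⟩,
        k 1 i ⟨s - 1, by omega⟩))]
      · rfl
      · rw [List.getLast?_eq_getElem?]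
        simp
        omega
    · simp only [letterSyllables, cond_true]
      rw [head?_pairSyllables (p := (k 0 i ⟨0, by omega⟩, k 1 i ⟨0, by omega⟩))]
      rw [List.head?_eq_getElem?]
      simp
      omega

/-- The first syllables of two different letters differ, so their paths share at most the edge to
the vertex of a common generator. -/
theorem le_d_letter_letter (hk : AdmissibleExponents m s k) (e e' : Fin m × Bool) (he : e ≠ e') :
    2 * (4 * s) ≤
      d (FreeGroup.lift (alphaWord k) (FreeGroup.mk [e]) • center (1 : FreeGroup (Fin 2)))
      (FreeGroup.lift (alphaWord k) (FreeGroup.mk [e']) • center (1 : FreeGroup (Fin 2))) + 2 := by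
  have h1 := hk.d_letter e
  have h2 := hk.d_letter e'
  obtain ⟨x, hx, hhead⟩ := hk.exists_head?_letterSyllables
  rw [smul_center, mul_one, d_center_one] at h1 h2
  rw [smul_center, smul_center, mul_one, mul_one, d_def, h1, h2]
  have h3 : (label (center (FreeGroup.lift (alphaWord k) (FreeGroup.mk [e])))).commonPrefixLength
      (label (center (FreeGroup.lift (alphaWord k) (FreeGroup.mk [e'])))) ≤ 1 := by
    rw [hk.label_letter, hk.label_letter]
    obtain ⟨l, hl⟩ := List.head?_eq_some_iff.1 (hhead e)
    obtain ⟨l', hl'⟩ := List.head?_eq_some_iff.1 (hhead e')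
    rw [hl, hl']
    simp only [List.flatMap_cons, List.cons_append, List.nil_append]
    by_cases h : (x e).1 = (x e').1
    · rw [h, List.commonPrefixLength_cons_self, List.commonPrefixLength_cons_of_ne]
      intro h'
      apply hx.ne he
      simp only [Sum.inr.injEq, Sigma.mk.injEq, heq_eq_eq, true_and] at h'
      refine Sigma.ext h (heq_of_eq ?_)
      simpa using h'
    · rw [List.commonPrefixLength_cons_of_ne]
      · omega
      · simpa using h
  omega

theorem le_d_smul (hk : AdmissibleExponents m s k) (c : FreeGroup (Fin 2)) (hc : c ∈ subgroupC k)
    (h1 : c ≠ 1) (p : SyllableTree (Fin 2)) : 4 * s - 2 ≤ d p (c • p) := by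
  have hs := hk.ten_le
  rw [subgroupC, ← FreeGroup.range_lift_eq_closure] at hc
  obtain ⟨w, rfl⟩ := hc
  exact FreeGroup.le_d_smul_of_ne_one d_smul_smul (alphaWord k) (center 1) (4 * s) (by omega)
    hk.d_letter hk.le_d_letter_letter w (by rintro rfl; simp at h1) p

end AdmissibleExponents

end Letters

/-! ### Translates of the hull as a small cancellation family. -/

section Hull

variable {m s : ℕ} (k : Fin 2 → Fin m → Fin s → ℤ)

/-- The subtree spanned by the central vertices of the elements of the subgroup. -/
def hull : Set (SyllableTree (Fin 2)) :=
  {x | (∃ g ∈ spelled k, x = center g) ∨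
    ∃ t g, ∃ n : ℤ, g * FreeGroup.of t ^ n ∈ spelled k ∧ x = vertex t g}

theorem center_mem_hull {g : FreeGroup (Fin 2)} : center g ∈ hull k ↔ g ∈ spelled k := by
  constructor
  · rintro (⟨g', h, e⟩ | ⟨t, g', n, h, e⟩)
    · rwa [show g = g' from congrArg Prod.fst e]
    · exact absurd (congrArg Prod.snd e) (by simp [center, vertex])
  · exact fun h => Or.inl ⟨g, h, rfl⟩

theorem vertex_mem_hull {t : Fin 2} {g : FreeGroup (Fin 2)} {n : ℤ}
    (h : g * FreeGroup.of t ^ n ∈ spelled k) : vertex t g ∈ hull k :=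
  Or.inr ⟨t, g, n, h, rfl⟩

theorem mem_hull_of_d_eq_zero {p q : SyllableTree (Fin 2)} (hp : p ∈ hull k) (h : d p q = 0) :
    q ∈ hull k := by
  rw [d_eq_zero_iff] at h
  rcases hp with ⟨g, hg, rfl⟩ | ⟨t, g, n, hg, rfl⟩ <;>
    rcases q.cases with ⟨g', rfl⟩ | ⟨t', g', rfl⟩
  · rwa [← label_center_inj h, center_mem_hull]
  · exact absurd h (label_center_ne_vertex _ _ _)
  · exact absurd h.symm (label_center_ne_vertex _ _ _)
  · obtain ⟨rfl, n', rfl⟩ := label_vertex_inj h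
    exact vertex_mem_hull k (n := -n' + n) (by rwa [mul_assoc, ← zpow_add, add_neg_cancel_left])

theorem smul_mem_hull {c : FreeGroup (Fin 2)} (hc : c ∈ subgroupC k) {p : SyllableTree (Fin 2)}
    (hp : p ∈ hull k) : c • p ∈ hull k := by
  rcases hp with ⟨g, hg, rfl⟩ | ⟨t, g, n, hg, rfl⟩
  · rw [smul_center, center_mem_hull]
    exact mul_mem_spelled k hc hg
  · rw [smul_vertex]
    refine vertex_mem_hull k (n := n) ?_
    rw [mul_assoc]
    exact mul_mem_spelled k hc hg

theorem smul_hull {c : FreeGroup (Fin 2)} (hc : c ∈ subgroupC k) : c • hull k = hull k := by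
  ext p
  rw [Set.mem_smul_set_iff_inv_smul_mem]
  refine ⟨fun h => ?_, fun h => smul_mem_hull k (inv_mem hc) h⟩
  simpa using smul_mem_hull k hc h

/-- Two points are joined by a path in the hull. -/
def HullJoined : SyllableTree (Fin 2) → SyllableTree (Fin 2) → Prop :=
  Relation.ReflTransGen fun p q => p ∈ hull k ∧ q ∈ hull k ∧ d p q ≤ 1

theorem HullJoined.symm {p q : SyllableTree (Fin 2)} (h : HullJoined k p q) : HullJoined k q p :=
  have : Std.Symm fun p q => p ∈ hull k ∧ q ∈ hull k ∧ d p q ≤ 1 :=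
    ⟨fun p q h => ⟨h.2.1, h.1, by rw [d_comm]; exact h.2.2⟩⟩
  Std.Symm.symm (r := Relation.ReflTransGen _) _ _ h

theorem hullJoined_mul_zpow {t : Fin 2} {g : FreeGroup (Fin 2)} {n : ℤ} (hg : g ∈ spelled k)
    (hgn : g * FreeGroup.of t ^ n ∈ spelled k) :
    HullJoined k (center g) (center (g * FreeGroup.of t ^ n)) := by
  have h1 : vertex t g ∈ hull k := vertex_mem_hull k (n := n) hgn
  refine (Relation.ReflTransGen.single (b := vertex t g)
    ⟨(center_mem_hull k).2 hg, h1, (d_center_vertex t g).le⟩).trans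
    (Relation.ReflTransGen.single ⟨h1, (center_mem_hull k).2 hgn, ?_⟩)
  rw [d_eq_of_d_eq_zero (d_vertex_mul_zpow t g n), d_comm, d_center_vertex]

theorem hullJoined_vertex {t : Fin 2} {g : FreeGroup (Fin 2)} {n : ℤ}
    (hgn : g * FreeGroup.of t ^ n ∈ spelled k) :
    HullJoined k (center (g * FreeGroup.of t ^ n)) (vertex t g) := by
  refine Relation.ReflTransGen.single ⟨(center_mem_hull k).2 hgn, vertex_mem_hull k hgn, ?_⟩
  rw [d_comm, d_eq_of_d_eq_zero (d_vertex_mul_zpow t g n), d_comm, d_center_vertex]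

theorem hullJoined_initialProd {c : FreeGroup (Fin 2)} (hc : c ∈ subgroupC k) (i : Fin m) (j : ℕ)
    (hj : j ≤ s) : HullJoined k (center c) (center (c * initialProd k i j)) := by
  induction j with
  | zero =>
    rw [initialProd_zero, mul_one]
    exact Relation.ReflTransGen.refl
  | succ j ih =>
    have h1 := initialProd_mem_spelled k hc i j (by omega)
    have h2 : c * initialProd k i j * FreeGroup.of 0 ^ k 0 i ⟨j, hj⟩ ∈ spelled k :=
      ⟨c, hc, Sum.inr (i, ⟨j, hj⟩), by rw [stateRep, mul_assoc]⟩
    have h3 := initialProd_mem_spelled k hc i (j + 1) hj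
    have h4 := initialProd_succ k i ⟨j, hj⟩
    simp only at h4
    rw [h4, ← mul_assoc, ← mul_assoc] at h3 ⊢
    exact ((ih (by omega)).trans (hullJoined_mul_zpow k h1 h2)).trans (hullJoined_mul_zpow k h2 h3)

theorem hullJoined_mul {c : FreeGroup (Fin 2)} (hc : c ∈ subgroupC k) :
    ∀ c' ∈ subgroupC k, HullJoined k (center c') (center (c' * c)) := by
  induction hc using Subgroup.closure_induction with
  | mem x hx =>
    obtain ⟨i, rfl⟩ := hx
    intro c' hc'
    have := hullJoined_initialProd k hc' i s le_rfl
    rwa [initialProd_self] at this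
  | one =>
    intro c' _
    rw [mul_one]
    exact Relation.ReflTransGen.refl
  | mul x y hx hy ihx ihy =>
    intro c' hc'
    have := ihy (c' * x) (mul_mem hc' hx)
    rw [mul_assoc] at this
    exact (ihx c' hc').trans this
  | inv x hx ih =>
    intro c' hc'
    have := ih (c' * x⁻¹) (mul_mem hc' (inv_mem hx))
    rw [inv_mul_cancel_right] at this
    exact this.symm

theorem hullJoined_spelled {g : FreeGroup (Fin 2)} (hg : g ∈ spelled k) :
    HullJoined k (center 1) (center g) := by
  obtain ⟨c, hc, q, rfl⟩ := hg
  have h0 := hullJoined_mul k hc 1 (one_mem _)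
  rw [one_mul] at h0
  refine h0.trans ?_
  rcases q with (_ | ⟨i, j⟩) | ⟨i, j⟩
  · rw [stateRep, mul_one]
  · exact hullJoined_initialProd k hc i j j.2.le
  · refine (hullJoined_initialProd k hc i j j.2.le).trans ?_
    rw [stateRep, ← mul_assoc]
    refine hullJoined_mul_zpow k (initialProd_mem_spelled k hc i j j.2.le)
      ⟨c, hc, Sum.inr (i, j), by rw [stateRep, mul_assoc]⟩

/-- Following the syllables of the words joins every point of the hull to the central vertex of `1`
inside the hull; connected subsets of a tree are convex. -/
theorem isConvex_hull : IsConvex (hull k) := by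
  have h : ∀ p ∈ hull k, HullJoined k (center 1) p := by
    rintro _ (⟨g, hg, rfl⟩ | ⟨t, g, n, hg, rfl⟩)
    · exact hullJoined_spelled k hg
    · exact (hullJoined_spelled k hg).trans (hullJoined_vertex k hg)
  refine isConvex_of_chain (fun p hp q hq => mem_hull_of_d_eq_zero k hp hq) fun p hp q hq => ?_
  exact Relation.ReflTransGen.lift id (fun _ _ h => h.2) _ _ (((h p hp).symm).trans (h q hq))

/-- The translate of the hull that belongs to a coset of the subgroup. -/
def cosetHull (v : FreeGroup (Fin 2) ⧸ subgroupC k) : Set (SyllableTree (Fin 2)) :=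
  v.out • hull k

theorem cosetHull_mk (a : FreeGroup (Fin 2)) : cosetHull k (a : FreeGroup (Fin 2) ⧸ subgroupC k) =
    a • hull k := by
  obtain ⟨c, hc⟩ := QuotientGroup.mk_out_eq_mul (subgroupC k) a
  rw [cosetHull, hc, mul_smul, smul_hull k c.2]

theorem center_mem_cosetHull {a g : FreeGroup (Fin 2)} :
    center g ∈ cosetHull k (a : FreeGroup (Fin 2) ⧸ subgroupC k) ↔ a⁻¹ * g ∈ spelled k := by
  rw [cosetHull_mk, Set.mem_smul_set_iff_inv_smul_mem, smul_center, center_mem_hull]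

variable {k}

namespace AdmissibleExponents

/-- Two central vertices at distance 2 differ by a nontrivial power of one generator. Both
translates contain this turn, and `mem_of_turn` puts the element relating them into the subgroup. -/
theorem eq_of_center_mem_inter (hk : AdmissibleExponents m s k)
    {v w : FreeGroup (Fin 2) ⧸ subgroupC k} {g : FreeGroup (Fin 2)} {y z : SyllableTree (Fin 2)}
    (hxy : d (center g) y = 1) (hyz : d y z = 1) (hxz : d (center g) z = 2)
    (hx : center g ∈ cosetHull k v ∩ cosetHull k w) (hz : z ∈ cosetHull k v ∩ cosetHull k w) :
    v = w := by
  induction v using QuotientGroup.induction_on with | H a => ?_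
  induction w using QuotientGroup.induction_on with | H b => ?_
  rcases y.cases with ⟨y, rfl⟩ | ⟨t, y, rfl⟩
  · obtain ⟨t, g', ⟨-, h⟩ | ⟨-, h⟩⟩ := exists_of_d_eq_one hxy <;>
      exact absurd (d_eq_zero_iff.1 h) (label_center_ne_vertex _ _ _)
  rcases z.cases with ⟨z, rfl⟩ | ⟨t', z, rfl⟩
  swap
  · obtain ⟨t, g', ⟨h, -⟩ | ⟨h, -⟩⟩ := exists_of_d_eq_one hyz <;>
      exact absurd (d_eq_zero_iff.1 h).symm (label_center_ne_vertex _ _ _)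
  obtain ⟨n, rfl⟩ := exists_zpow_of_d_eq_one hxy
  rw [d_comm] at hyz
  obtain ⟨n', hn'⟩ := exists_zpow_of_d_eq_one hyz
  obtain rfl : z = g * FreeGroup.of t ^ (n - n') := by
    rw [zpow_sub, ← mul_assoc, hn', mul_inv_cancel_right]
  have hne : n - n' ≠ 0 := by
    intro h
    rw [h, zpow_zero, mul_one, d_self] at hxz
    omega
  simp only [Set.mem_inter_iff, center_mem_cosetHull] at hx hz
  have := hk.mem_of_turn t (n - n') hne (a⁻¹ * g) (b⁻¹ * a) hx.1
    (by rw [mul_assoc]; exact hz.1) (by simpa [mul_assoc] using hx.2)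
    (by simpa [mul_assoc] using hz.2)
  rw [eq_comm, QuotientGroup.eq]
  exact this

theorem smallCancellation (hk : AdmissibleExponents m s k) :
    SmallCancellation (FreeGroup (Fin 2)) (cosetHull k) where
  isometry := d_smul_smul
  convex v := (isConvex_hull k).smul d_smul_smul _
  nonempty v := ⟨v.out • center 1, Set.smul_mem_smul_set
    ((center_mem_hull k).2 (mem_spelled_of_mem k (one_mem _)))⟩
  smul_set g v := by
    induction v using QuotientGroup.induction_on with | H a => ?_
    rw [MulAction.Quotient.smul_coe, smul_eq_mul, cosetHull_mk, cosetHull_mk, mul_smul]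
  inter v w hvw p hp q hq := by
    by_contra! h
    have hconv : ∀ z, d p z + d z q = d p q → z ∈ cosetHull k v ∩ cosetHull k w := fun z hz =>
      ⟨(isConvex_hull k).smul d_smul_smul _ p hp.1 q hq.1 z hz,
        (isConvex_hull k).smul d_smul_smul _ p hp.2 q hq.2 z hz⟩
    -- Central and coset vertices alternate, so three consecutive edges contain a path from one
    -- central vertex to another of length 2.
    obtain ⟨z₃, h3, h3'⟩ := exists_between p q 3 (by omega)
    obtain ⟨z₂, h2, h2'⟩ := exists_between p z₃ 2 (by omega)
    obtain ⟨z₁, h1, h1'⟩ := exists_between p z₂ 1 (by omega)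
    have t1 := d_triangle p z₂ q
    have t2 := d_triangle z₂ z₃ q
    have t3 := d_triangle p z₁ q
    have t4 := d_triangle z₁ z₂ q
    have t5 := d_triangle p z₁ z₃
    have t6 := d_triangle z₁ z₂ z₃
    rcases p.cases with ⟨g, rfl⟩ | ⟨t, g, rfl⟩
    · exact hvw (hk.eq_of_center_mem_inter h1 (by omega) h2 hp (hconv z₂ (by omega)))
    rcases z₁.cases with ⟨g', rfl⟩ | ⟨t', g', rfl⟩
    · exact hvw (hk.eq_of_center_mem_inter (y := z₂) (z := z₃) (by omega) (by omega) (by omega)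
        (hconv (center g') (by omega)) (hconv z₃ (by omega)))
    · obtain ⟨t, g', ⟨h, -⟩ | ⟨h, -⟩⟩ := exists_of_d_eq_one h1 <;>
        exact absurd (d_eq_zero_iff.1 h).symm (label_center_ne_vertex _ _ _)
  disp v g hg h1 p _ := by
    induction v using QuotientGroup.induction_on with | H a => ?_
    rw [MulAction.Quotient.smul_coe, smul_eq_mul, eq_comm, QuotientGroup.eq] at hg
    have hs := hk.ten_le
    -- Conjugation by `a` moves the stabilizer into the subgroup, where `4 * s - 2 ≥ 38` exceeds the
    -- required 21.
    have key := hk.le_d_smul _ hg (fun h => h1 (by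
      rw [inv_mul_eq_one] at h
      simpa using h.symm)) (a⁻¹ • p)
    rw [← d_smul_smul a] at key
    simp only [smul_smul] at key
    rw [mul_inv_cancel, one_smul] at key
    have e : a * (a⁻¹ * (g * a) * a⁻¹) = g := by group
    rw [e] at key
    omega
  exists_stab v := by
    induction v using QuotientGroup.induction_on with | H a => ?_
    have hm := hk.eight_le
    have hs := hk.ten_le
    refine ⟨a * alphaWord k ⟨0, by omega⟩ * a⁻¹, ?_, ?_⟩
    · rw [MulAction.Quotient.smul_coe, smul_eq_mul, eq_comm, QuotientGroup.eq]
      simpa [mul_assoc] using alphaWord_mem k _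
    · intro h
      rw [mul_inv_eq_one, mul_eq_left] at h
      have := hk.d_letter (⟨0, by omega⟩, true)
      simp [h, d_self] at this
      omega

end AdmissibleExponents

end Hull

theorem theoremT (m s : ℕ) (k : Fin 2 → Fin m → Fin s → ℤ) (hk : AdmissibleExponents m s k) :
    IsMultiMalnormal (subgroupC k) :=
  hk.smallCancellation.isMultiMalnormal
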